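/- Let $N<M$ be positive integers with $N$ even, let $\tau>-1$ with $\tau\neq 0$, and let $\Sigma$ be a real symmetric $N\times N$ matrix with eigenvalues $1$ (with multiplicity $N-1$) and $1+\tau$. Let $X$ be an $N\times M$ random matrix whose columns are independent centred Gaussian vectors in $\mathbb{R}^N$ with covariance matrix $\Sigma$, and let $\lambda_1\le\dots\le\lambda_N$ be the ordered eigenvalues of the real Wishart matrix $Y=\frac1M XX^T$. Then there is a constant $\tilde Z_{M,N}\in\mathbb{C}\setminus\{0\}$ (the normalization constant), depending only on $N$, $M$ and $\tau$, such that the joint law of $(\lambda_1,\dots,\lambda_N)$ is absolutely continuous with respect to Lebesgue measure on $\{0<\lambda_1\le\dots\le\lambda_N\}$, with the nonnegative density $$P(\lambda)=\tilde Z_{M,N}^{-1}\oint_{\Gamma}|\Delta(\lambda)|\,e^{\frac{M\tau}{2(1+\tau)}t}\prod_{j=1}^N e^{-\frac M2\lambda_j}\lambda_j^{\frac{M-N-1}{2}}(t-\lambda_j)^{-\frac12}\,dt .$$ Here $\Delta(\lambda)=\prod_{i<j}(\lambda_j-\lambda_i)$, each power $(t-\lambda_j)^{-1/2}$ is the principal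 branch, with branch cut $\arg(t-\lambda_j)=\pi$, and $\Gamma$ is any closed piecewise $C^1$ contour that encloses all the eigenvalues counterclockwise, in the sense that it does not meet the interval $[\min_j\lambda_j,\max_j\lambda_j]$ and has winding number $1$ about each of its points; the value of $P(\lambda)$ does not depend on the choice of such a $\Gamma$. -/

import Mathlib

open MeasureTheory ProbabilityTheory

namespace SpikedWishart

noncomputable section

/-- The sample covariance matrix `Y = (1/M) X Xᵀ` of an `N × M` data matrix `X`. -/
def sampleCovariance {N M : ℕ} (X : Matrix (Fin N) (Fin M) ℝ) : Matrix (Fin N) (Fin N) ℝ :=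
  (M : ℝ)⁻¹ • (X * X.transpose)

theorem sampleCovariance_isHermitian {N M : ℕ} (X : Matrix (Fin N) (Fin M) ℝ) :
    (sampleCovariance X).IsHermitian := by
  unfold Matrix.IsHermitian sampleCovariance
  rw [Matrix.conjTranspose_eq_transpose_of_trivial, Matrix.transpose_smul, Matrix.transpose_mul,
    Matrix.transpose_transpose]

/-- The eigenvalues of a real symmetric matrix, with multiplicity, in nondecreasing order
`λ₁ ≤ … ≤ λ_N` (Mathlib lists them in nonincreasing order). -/
def orderedEigenvalues {N : ℕ} {A : Matrix (Fin N) (Fin N) ℝ} (hA : A.IsHermitian) :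
    Fin N → ℝ :=
  fun i => hA.eigenvalues₀ (Fin.cast (Fintype.card_fin N).symm i.rev)

/-- `X` is an `N × M` random matrix whose columns are independent centred Gaussian vectors in `ℝ^N`
with covariance matrix `S`. -/
structure IsGaussianData {N M : ℕ} {Ω : Type*} [MeasurableSpace Ω]
    (X : Ω → Matrix (Fin N) (Fin M) ℝ) (S : Matrix (Fin N) (Fin N) ℝ) (μ : Measure Ω) : Prop where
  columns_indep : iIndepFun
    (fun (k : Fin M) (ω : Ω) => (WithLp.toLp 2 (fun i => X ω i k) : EuclideanSpace ℝ (Fin N))) μ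
  column_law : ∀ k : Fin M, HasLaw
    (fun ω : Ω => (WithLp.toLp 2 (fun i => X ω i k) : EuclideanSpace ℝ (Fin N)))
    (multivariateGaussian 0 S) μ

/-- A real symmetric `N × N` matrix is the covariance matrix of the rank-one spiked model with
spike `1 + τ`: its eigenvalues are `1`, with multiplicity `N - 1`, and `1 + τ`. -/
def IsRankOneSpike {N : ℕ} (S : Matrix (Fin N) (Fin N) ℝ) (τ : ℝ) : Prop :=
  S.IsSymm ∧ S.charpoly =
    (Polynomial.X - Polynomial.C 1) ^ (N - 1) * (Polynomial.X - Polynomial.C (1 + τ))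

/-- The contour integral `∮_γ f(t) dt`. -/
def contourIntegral {z : ℂ} (γ : Path z z) (f : ℂ → ℂ) : ℂ :=
  curveIntegral (fun t : ℂ => ContinuousLinearMap.toSpanSingleton ℂ (f t)) γ

/-- A path is piecewise `C¹`: for some finite set of break points, it is `C¹` (up to the ends) on
each closed parameter interval without break points in its interior. -/
def IsPiecewiseC1 {z : ℂ} (γ : Path z z) : Prop :=
  ∃ B : Finset ℝ, ∀ a b : ℝ, 0 ≤ a → a < b → b ≤ 1 → (∀ s ∈ B, s ∉ Set.Ioo a b) →
    ContDiffOn ℝ 1 γ.extend (Set.Icc a b)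

/-- The winding number of a piecewise `C¹` closed path around a point off the path. -/
def windingNumber {z : ℂ} (γ : Path z z) (w : ℂ) : ℂ :=
  (2 * Real.pi * Complex.I)⁻¹ * contourIntegral γ (fun t => (t - w)⁻¹)

/-- The closed contour `γ` encloses the set `K` counterclockwise: it is piecewise `C¹`, does not
meet `K`, and winds exactly once, in the positive direction, around each point of `K`. -/
structure EnclosesCounterclockwise {z : ℂ} (γ : Path z z) (K : Set ℂ) : Prop where
  piecewise : IsPiecewiseC1 γ
  avoids : ∀ s, γ s ∉ K
  winding : ∀ w ∈ K, windingNumber γ w = 1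

/-- The integrand
`|Δ(λ)| e^{Mτt/(2(1+τ))} ∏ⱼ e^{-Mλⱼ/2} λⱼ^{(M-N-1)/2} (t - λⱼ)^{-1/2}`.
The complex power is the principal one: its branch cut is `arg (t - λⱼ) = π`. -/
def densityIntegrand (N M : ℕ) (τ : ℝ) (lam : Fin N → ℝ) (t : ℂ) : ℂ :=
  ((|(Matrix.vandermonde lam).det| : ℝ) : ℂ)
    * Complex.exp (((M * τ / (2 * (1 + τ)) : ℝ) : ℂ) * t)
    * ∏ j : Fin N,
        ((Real.exp (-(M : ℝ) / 2 * lam j) * lam j ^ (((M : ℝ) - N - 1) / 2) : ℝ) : ℂ)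
          * (t - (lam j : ℂ)) ^ (-(1 / 2) : ℂ)

end

end SpikedWishart

namespace SpikedWishart

noncomputable section

/-! Write the covariance as `1 + τ v vᵀ` with a unit vector `v`. Its inverse is `1 - τ/(1+τ) v vᵀ`,
so relative to Lebesgue measure the columns `C k` have density proportional to `exp(-½ ∑ ‖C k‖²)
exp(τ/(2(1+τ)) ∑ ⟪v, C k⟫²)`. The first factor is `exp(-(M/2) ∑ λ)`. Lebesgue measure and the sample
eigenvalues are invariant under rotations of the columns, so the second factor may be averaged over
all unit `v` (`lintegral_colEig_spike`). The average is a function of the eigenvalues alone,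
`sphereExp`: the integral of `exp(c ∑ λ_j x_j²)` over the unit sphere, with `c = Mτ/(2(1+τ))`. Two
tasks remain: the law of the eigenvalues of Lebesgue distributed data, and the spherical integral as
a contour integral.

The first is an induction on the number of rows (`exists_lintegral_gramEig`). If a row `y` is added
to rows with distinct positive Gram eigenvalues `l`, the new eigenvalues are the roots of a secular
equation `∑ t_k/(z - a_k) = 1`. Its nodes are `0` and `l`; its weights are the squared components of
`y` along the right singular vectors and the squared length of the remaining component
(`gramEig_cons`). Passing from roots to weights is a bijection from interlacing points onto the
positive orthant, and its Jacobian is a Cauchy determinant (`lintegral_weight`). This makes the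
transition kernel explicit (`lintegral_gramEig_cons`). Integrating out the old eigenvalues leaves a
Dixon–Anderson integral, whose value does not depend on the new ones (`lintegral_dixonAnderson`); it
comes from the same change of variables. The linear form `β - ε x` serves both uses: it is constant
for the kernel (`ε = 0`) and gives an upper bound on the interlacing points for Dixon–Anderson (`ε =
1`).

For the second task let `N = 2n`. A Gaussian integral computed both coordinatewise and in polar
coordinates gives `∏ z_j^(-1/2) = const · ∫ (∑ z_j x_j²)^(-n)` over the sphere
(`integral_sphere_inv_pow`). For `z_j = t - λ_j` the integrand is `(t - w)^(-n)` with `w = ∑ λ_j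
x_j²` in the convex hull of the eigenvalues (`prod_sub_cpow_eq`). Since `N` is even, the power is
integral. The residue of `exp(ct) (t - w)^(-n)` is `c^(n-1)/(n-1)! · exp(cw)`
(`contourIntegral_exp_mul_inv_pow`), and Fubini yields `sphereExp`. The factor `c^(n-1)` does not
vanish because `τ ≠ 0`. -/

/-! ### Vandermonde, Lagrange and Cauchy determinants -/

open Finset Polynomial in
/-- A real polynomial of degree at most `n` with `n` distinct roots is a multiple of the
corresponding product of linear factors. -/
theorem eq_C_mul_prod_of_roots {n : ℕ} (p : ℝ[X]) (hp : p.natDegree ≤ n) (u : Fin n → ℝ)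
    (hu : Function.Injective u) (h0 : ∀ i, p.eval (u i) = 0) :
    p = C (p.coeff n) * ∏ i, (X - C (u i)) := by
  rw [← sub_eq_zero]
  have hmon : (∏ i, (X - C (u i))).Monic := monic_prod_of_monic _ _ fun i _ => monic_X_sub_C _
  have hdeg : (∏ i, (X - C (u i))).natDegree = n := by
    rw [natDegree_prod_of_monic _ _ fun i _ => monic_X_sub_C _]; simp
  have hcoeff : (∏ i, (X - C (u i))).coeff n = 1 := by
    have := hmon.coeff_natDegree
    rwa [hdeg] at this
  refine eq_zero_of_degree_lt_of_eval_index_eq_zero (v := u) univ hu.injOn ?_ ?_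
  · rw [card_univ, Fintype.card_fin, degree_lt_iff_coeff_zero]
    intro m hm
    rcases hm.eq_or_lt with rfl | hm
    · simp [coeff_C_mul, hcoeff]
    · rw [coeff_sub, coeff_C_mul, coeff_eq_zero_of_natDegree_lt (hp.trans_lt hm),
        coeff_eq_zero_of_natDegree_lt (hdeg.trans_lt hm)]
      simp
  · intro i _
    rw [eval_sub, h0, eval_mul, eval_prod, prod_eq_zero (mem_univ i)] <;> simp

/-- The absolute value of the Vandermonde determinant. -/
def absVdm {n : ℕ} (u : Fin n → ℝ) : ℝ := |(Matrix.vandermonde u).det|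

theorem absVdm_pos {n : ℕ} {u : Fin n → ℝ} (hu : Function.Injective u) : 0 < absVdm u :=
  abs_pos.2 (Matrix.det_vandermonde_ne_zero_iff.2 hu)

theorem absVdm_eq_zero {n : ℕ} {u : Fin n → ℝ} (hu : ¬ Function.Injective u) : absVdm u = 0 := by
  rw [absVdm, abs_eq_zero]
  by_contra h
  exact hu (Matrix.det_vandermonde_ne_zero_iff.1 h)

/-- Each unordered pair of indices contributes its difference twice. -/
theorem prod_prod_erase_abs {n : ℕ} (u : Fin n → ℝ) :
    ∏ i, ∏ j ∈ Finset.univ.erase i, |u i - u j| = absVdm u ^ 2 := by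
  have h := Finset.prod_prod_Ioi_mul_eq_prod_prod_off_diag (fun j i => |u i - u j|)
  have : ∀ i : Fin n, Finset.univ.erase i = ({i} : Finset (Fin n))ᶜ := by
    intro i; ext; simp
  simp only [this]
  rw [← h, absVdm, Matrix.det_vandermonde, Finset.abs_prod, ← Finset.prod_pow]
  refine Finset.prod_congr rfl fun i _ => ?_
  rw [Finset.abs_prod, ← Finset.prod_pow]
  refine Finset.prod_congr rfl fun j _ => ?_
  rw [abs_sub_comm, sq]

-- The entries are values of polynomials of degree below `n`, and only the Vandermonde factor
-- involves the evaluation points `a`. The determinant of the coefficient factor can therefore be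
-- found by specializing to `a = u`.
open Finset Polynomial in
theorem eval_lagrange_matrix {n : ℕ} (a u : Fin n → ℝ) :
    (Matrix.of fun k i => ∏ j ∈ univ.erase i, (a k - u j)) =
      Matrix.vandermonde a * (Matrix.of fun m i : Fin n =>
        (∏ j ∈ univ.erase i, (X - C (u j))).coeff (m : ℕ)) := by
  ext k i
  rw [Matrix.mul_apply]
  simp only [Matrix.of_apply, Matrix.vandermonde_apply]
  have hdeg : (∏ j ∈ univ.erase i, (X - C (u j))).natDegree < n := by
    rw [natDegree_prod_of_monic _ _ fun i _ => monic_X_sub_C _]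
    simp only [natDegree_X_sub_C, sum_const, smul_eq_mul, mul_one]
    rw [card_erase_of_mem (mem_univ i), card_univ, Fintype.card_fin]
    have := i.2; omega
  have h2 : ∏ j ∈ univ.erase i, (a k - u j) = (∏ j ∈ univ.erase i, (X - C (u j))).eval (a k) := by
    rw [eval_prod]; simp
  rw [h2, eval_eq_sum_range' hdeg, Finset.sum_range]
  exact sum_congr rfl fun m _ => mul_comm _ _

open Finset in
/-- The absolute value of the determinant of a Lagrange matrix. -/
theorem abs_det_lagrange {n : ℕ} (a u : Fin n → ℝ) (hu : Function.Injective u) :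
    |(Matrix.of fun k i => ∏ j ∈ univ.erase i, (a k - u j)).det| = absVdm a * absVdm u := by
  have h1 := congrArg (fun A => |Matrix.det A|) (eval_lagrange_matrix a u)
  have h2 := congrArg (fun A => |Matrix.det A|) (eval_lagrange_matrix u u)
  simp only [Matrix.det_mul, abs_mul] at h1 h2
  -- At `a = u` the matrix is diagonal with determinant `± absVdm u ^ 2`, so the coefficient matrix
  -- has determinant `± absVdm u`.
  have h3 : (Matrix.of fun k i => ∏ j ∈ univ.erase i, (u k - u j)) =
      Matrix.diagonal fun i => ∏ j ∈ univ.erase i, (u i - u j) := by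
    ext k i
    by_cases h : k = i
    · subst h; simp
    · rw [Matrix.diagonal_apply_ne _ h, Matrix.of_apply]
      exact prod_eq_zero (mem_erase.2 ⟨h, mem_univ k⟩) (sub_self _)
  rw [h3, Matrix.det_diagonal, abs_prod] at h2
  simp only [abs_prod] at h2
  rw [prod_prod_erase_abs, sq] at h2
  rw [h1]
  congr 1
  exact (mul_left_cancel₀ (absVdm_pos hu).ne' h2).symm

open Finset in
/-- The absolute value of Cauchy's determinant. -/
theorem abs_det_cauchy {n : ℕ} (a u : Fin n → ℝ) (hu : Function.Injective u)
    (hau : ∀ k i, a k ≠ u i) :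
    |(Matrix.of fun k i => (a k - u i)⁻¹).det| =
      absVdm a * absVdm u / ∏ k, ∏ i, |a k - u i| := by
  have hne : ∀ k, ∏ i, |a k - u i| ≠ 0 := fun k =>
    prod_ne_zero_iff.2 fun i _ => abs_ne_zero.2 (sub_ne_zero.2 (hau k i))
  rw [eq_div_iff (prod_ne_zero_iff.2 fun k _ => hne k), ← abs_det_lagrange a u hu, mul_comm]
  simp_rw [← abs_prod]
  -- Clearing the denominators of each row turns the Cauchy matrix into the Lagrange matrix.
  rw [← abs_mul, ← Matrix.det_mul_column]
  congr 3
  ext k i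
  simp only [Matrix.of_apply]
  rw [← mul_prod_erase univ _ (mem_univ i)]
  field_simp [sub_ne_zero.2 (hau k i)]

/-! ### The secular polynomial and the bijection between interlacing points and positive weights -/

/-- Points interlacing the nodes `a`, on which the linear form `β - ε x` is positive. -/
def interlacing {n : ℕ} (β ε : ℝ) (a : Fin n → ℝ) : Set (Fin n → ℝ) :=
  {u | (∀ i j, i < j → u i < a j) ∧ (∀ i, a i < u i) ∧ ∀ i, 0 < β - ε * u i}

/-- The weights at the nodes `a` of the secular polynomial whose roots are `u`. -/
def weight {n : ℕ} (β ε : ℝ) (a u : Fin n → ℝ) (k : Fin n) : ℝ :=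
  -(∏ l, (β - ε * a l)) / ((β - ε * a k) * ∏ l ∈ Finset.univ.erase k, (a k - a l))
    * ∏ i, ((a k - u i) / (β - ε * u i))

open Polynomial in
/-- The secular polynomial with nodes `a` and weights `t`. -/
def secular {n : ℕ} (β ε : ℝ) (a t : Fin n → ℝ) : ℝ[X] :=
  ∏ k, (X - C (a k)) -
    (C β - C ε * X) * ∑ k, C (t k) * ∏ l ∈ Finset.univ.erase k, (X - C (a l))

section Secular

open Finset Polynomial

variable {n : ℕ} {β ε : ℝ} {a u t : Fin n → ℝ}

theorem natDegree_prod_X_sub_C (s : Finset (Fin n)) (a : Fin n → ℝ) :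
    (∏ k ∈ s, (X - C (a k))).natDegree = s.card := by
  rw [natDegree_prod_of_monic _ _ fun i _ => monic_X_sub_C _]; simp

theorem coeff_prod_X_sub_C (s : Finset (Fin n)) (a : Fin n → ℝ) :
    (∏ k ∈ s, (X - C (a k))).coeff s.card = 1 := by
  have h : (∏ k ∈ s, (X - C (a k))).Monic := monic_prod_of_monic _ _ fun i _ => monic_X_sub_C _
  have := h.coeff_natDegree
  rwa [natDegree_prod_X_sub_C] at this

theorem card_erase_fin (k : Fin n) : (univ.erase k).card = n - 1 := by
  rw [card_erase_of_mem (mem_univ k), card_univ, Fintype.card_fin]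

theorem natDegree_secular_le : (secular β ε a t).natDegree ≤ n := by
  refine (natDegree_sub_le _ _).trans (max_le ?_ ?_)
  · rw [natDegree_prod_X_sub_C]; simp
  · rw [Finset.mul_sum]
    refine natDegree_sum_le_of_forall_le _ _ fun k _ => ?_
    refine (natDegree_mul_le).trans ?_
    have h1 : (C β - C ε * X : ℝ[X]).natDegree ≤ 1 :=
      (natDegree_sub_le _ _).trans (max_le (by simp) ((natDegree_C_mul_le _ _).trans (by simp)))
    have h2 : (C (t k) * ∏ l ∈ univ.erase k, (X - C (a l))).natDegree ≤ n - 1 :=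
      (natDegree_C_mul_le _ _).trans (by rw [natDegree_prod_X_sub_C, card_erase_fin])
    have := k.2
    omega

/-- For `ε = 0` the polynomial is monic. For `ε = 1` this coefficient is the factor `1 + ∑ t` of the
Dixon–Anderson integrand. -/
theorem coeff_secular : (secular β ε a t).coeff n = 1 + ε * ∑ k, t k := by
  have h1 := coeff_prod_X_sub_C univ a
  rw [card_univ, Fintype.card_fin] at h1
  rw [secular, coeff_sub, h1, Finset.mul_sum, finsetSum_coeff, Finset.mul_sum, sub_eq_add_neg,
    ← sum_neg_distrib]
  congr 1
  refine sum_congr rfl fun k _ => ?_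
  have hn : n = (n - 1) + 1 := by have := k.2; omega
  have h2 := coeff_prod_X_sub_C (univ.erase k) a
  have h3 := natDegree_prod_X_sub_C (univ.erase k) a
  rw [card_erase_fin] at h2 h3
  have h4 : (∏ l ∈ univ.erase k, (X - C (a l))).coeff n = 0 :=
    coeff_eq_zero_of_natDegree_lt (by omega)
  have h5 : (X * ∏ l ∈ univ.erase k, (X - C (a l))).coeff n = 1 := by
    conv_lhs => rw [show ∀ p : ℝ[X], p.coeff n = p.coeff ((n - 1) + 1) by rw [← hn]; simp]
    rw [coeff_X_mul, h2]
  rw [show (C β - C ε * X) * (C (t k) * ∏ l ∈ univ.erase k, (X - C (a l))) =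
    C (β * t k) * (∏ l ∈ univ.erase k, (X - C (a l)))
      - C (ε * t k) * (X * ∏ l ∈ univ.erase k, (X - C (a l))) by rw [C_mul, C_mul]; ring,
    coeff_sub, coeff_C_mul, coeff_C_mul, h4, h5]
  ring

theorem eval_secular (z : ℝ) : (secular β ε a t).eval z =
    ∏ k, (z - a k) - (β - ε * z) * ∑ k, t k * ∏ l ∈ univ.erase k, (z - a l) := by
  simp [secular, eval_prod, eval_finsetSum]

theorem eval_secular_node (k : Fin n) : (secular β ε a t).eval (a k) =
    -((β - ε * a k) * t k * ∏ l ∈ univ.erase k, (a k - a l)) := by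
  rw [eval_secular, prod_eq_zero (mem_univ k) (sub_self _),
    sum_eq_single_of_mem k (mem_univ k)]
  · ring
  · intro j _ hj
    rw [prod_eq_zero (i := k), mul_zero]
    · exact mem_erase.2 ⟨hj.symm, mem_univ k⟩
    · simp

theorem prod_erase_node_ne_zero (ha : Function.Injective a) (k : Fin n) :
    ∏ l ∈ univ.erase k, (a k - a l) ≠ 0 :=
  prod_ne_zero_iff.2 fun _ hl => sub_ne_zero.2 fun h => (mem_erase.1 hl).1 (ha h).symm

/-- The secular polynomial with the weights of `u` has the roots `u`. -/
theorem secular_weight (ha : Function.Injective a) (hδ : ∀ k, 0 < β - ε * a k)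
    (hu : ∀ k, 0 < β - ε * u k) :
    C (∏ k, (β - ε * u k)) * secular β ε a (weight β ε a u) =
      C (∏ k, (β - ε * a k)) * ∏ k, (X - C (u k)) := by
  rw [← sub_eq_zero]
  set R := C (∏ k, (β - ε * u k)) * secular β ε a (weight β ε a u) -
      C (∏ k, (β - ε * a k)) * ∏ k, (X - C (u k)) with hR
  have hdeg : R.natDegree ≤ n := by
    refine (natDegree_sub_le _ _).trans (max_le ?_ ?_)
    · exact (natDegree_C_mul_le _ _).trans natDegree_secular_le
    · exact (natDegree_C_mul_le _ _).trans (by rw [natDegree_prod_X_sub_C]; simp)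
  have hroot : ∀ k, R.eval (a k) = 0 := by
    intro k
    have h1 := prod_erase_node_ne_zero ha k
    have h2 := (hδ k).ne'
    have h3 : ∏ k, (β - ε * u k) ≠ 0 := prod_ne_zero_iff.2 fun i _ => (hu i).ne'
    rw [hR, eval_sub, eval_mul, eval_C, eval_secular_node, eval_mul, eval_C, eval_prod, weight,
      prod_div_distrib]
    simp only [eval_sub, eval_X, eval_C]
    field_simp
    ring
  have hRe := eq_C_mul_prod_of_roots R hdeg a ha hroot
  -- The `n` nodes determine `R` up to its top coefficient, which needs one more condition. For `ε =
  -- 0` it is read off directly; otherwise `R` also vanishes at `β / ε`, the zero of the linear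
  -- form.
  suffices R.coeff n = 0 by rw [hRe, this]; simp
  by_cases hε : ε = 0
  · have h1 := coeff_prod_X_sub_C univ u
    rw [card_univ, Fintype.card_fin] at h1
    rw [hR, coeff_sub, coeff_C_mul, coeff_C_mul, coeff_secular, h1]
    simp [hε]
  · have h1 := congrArg (eval (β / ε)) hRe
    have h2 : ∏ k, (β / ε - a k) ≠ 0 := by
      refine prod_ne_zero_iff.2 fun k _ h => (hδ k).ne' ?_
      have : a k = β / ε := by linarith
      rw [this]; field_simp; ring
    have h3 : ∀ v : Fin n → ℝ, ∏ k, (β - ε * v k) = ε ^ n * ∏ k, (β / ε - v k) := by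
      intro v
      have : ∀ k, β - ε * v k = ε * (β / ε - v k) := fun k => by field_simp
      simp_rw [this, prod_mul_distrib]; simp
    have h4 : R.eval (β / ε) = 0 := by
      rw [hR, eval_sub, eval_mul, eval_mul, eval_C, eval_C, eval_secular, eval_prod, h3, h3]
      have : β - ε * (β / ε) = 0 := by field_simp; ring
      rw [this]
      simp only [eval_sub, eval_X, eval_C]
      ring
    rw [h4, eval_mul, eval_C, eval_prod] at h1
    simp only [eval_sub, eval_X, eval_C] at h1
    exact (mul_eq_zero.1 h1.symm).resolve_right h2

theorem strictMono_of_mem_interlacing (hu : u ∈ interlacing β ε a) :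
    StrictMono u := fun i j hij => (hu.1 i j hij).trans (hu.2.1 j)

theorem node_ne_of_mem_interlacing (ha : StrictMono a) (hu : u ∈ interlacing β ε a)
    (k i : Fin n) : a k ≠ u i := by
  rcases lt_or_ge i k with h | h
  · exact (hu.1 i k h).ne'
  · exact ((ha.monotone h).trans_lt (hu.2.1 i)).ne

/-- Interlacing puts `u l` and `a l` on the same side of `a k` whenever `l ≠ k`, so every quotient
is positive. -/
theorem prod_div_node_pos (ha : StrictMono a) (hu : u ∈ interlacing β ε a) (k : Fin n) :
    0 < ∏ l ∈ univ.erase k, ((a k - u l) / (a k - a l)) := by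
  refine prod_pos fun l hl => ?_
  rcases lt_or_gt_of_ne (mem_erase.1 hl).1 with h | h
  · exact div_pos (sub_pos.2 (hu.1 l k h)) (sub_pos.2 (ha h))
  · exact div_pos_of_neg_of_neg (sub_neg.2 ((ha h).trans (hu.2.1 l))) (sub_neg.2 (ha h))

theorem weight_pos (ha : StrictMono a) (hδ : ∀ k, 0 < β - ε * a k)
    (hu : u ∈ interlacing β ε a) (k : Fin n) : 0 < weight β ε a u k := by
  have h1 := prod_div_node_pos ha hu k
  have h2 : ∀ v : Fin n → ℝ, (∀ k, 0 < β - ε * v k) → 0 < ∏ k, (β - ε * v k) :=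
    fun v hv => prod_pos fun i _ => hv i
  have h3 : weight β ε a u k = (∏ l, (β - ε * a l)) / (β - ε * a k) / (∏ l, (β - ε * u l))
      * (u k - a k) * ∏ l ∈ univ.erase k, ((a k - u l) / (a k - a l)) := by
    rw [weight, prod_div_distrib, prod_div_distrib, ← mul_prod_erase univ (fun i => a k - u i)
      (mem_univ k)]
    have := (h2 u hu.2.2).ne'
    have := (hδ k).ne'
    have := prod_erase_node_ne_zero ha.injective k
    field_simp
    ring
  rw [h3]
  exact mul_pos (mul_pos (div_pos (div_pos (h2 a hδ) (hδ k)) (h2 u hu.2.2))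
    (sub_pos.2 (hu.2.1 k))) h1

/-- The secular polynomial is positive somewhere to the right of the nodes, where `β - ε x ≥ 0`. -/
theorem exists_eval_secular_pos (hε : 0 ≤ ε) (hδ : ∀ k, 0 < β - ε * a k) :
    ∃ z, (∀ k, a k < z) ∧ (∀ x < z, (∃ k, a k < x) → 0 < β - ε * x) ∧
      0 < (secular β ε a t).eval z := by
  -- For `ε = 0` the polynomial is monic and any sufficiently large point serves. For `ε > 0` the
  -- point `β / ε` removes the sum with the weights and leaves a product of positive factors.
  rcases hε.eq_or_lt with rfl | hε
  · have hev : ∀ᶠ z in Filter.atTop, 0 < (secular β 0 a t).eval z := by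
      rcases Nat.eq_zero_or_pos n with rfl | hn
      · simp [eval_secular]
      · have h0 : (secular β 0 a t).coeff n = 1 := by rw [coeff_secular]; simp
        have hd : (secular β 0 a t).natDegree = n :=
          natDegree_eq_of_le_of_coeff_ne_zero natDegree_secular_le (by rw [h0]; exact one_ne_zero)
        have h1 : Filter.Tendsto (fun z => (secular β 0 a t).eval z) Filter.atTop Filter.atTop := by
          refine tendsto_atTop_of_leadingCoeff_nonneg _ ?_ ?_
          · exact natDegree_pos_iff_degree_pos.1 (hd.symm ▸ hn)
          · rw [leadingCoeff, hd, h0]; exact zero_le_one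
        exact h1.eventually_gt_atTop 0
    have hlt : ∀ᶠ z in Filter.atTop, ∀ k, a k < z :=
      Filter.eventually_all.2 fun k => Filter.eventually_gt_atTop (a k)
    obtain ⟨z, hz1, hz2⟩ := (hev.and hlt).exists
    refine ⟨z, hz2, fun x _ ⟨k, _⟩ => ?_, hz1⟩
    have := hδ k
    linarith
  · have h1 : ∀ k, a k < β / ε := fun k => by rw [lt_div_iff₀ hε]; linarith [hδ k]
    refine ⟨β / ε, h1, fun x hx _ => ?_, ?_⟩
    · rw [lt_div_iff₀ hε] at hx; linarith
    · rw [eval_secular, mul_div_cancel₀ _ hε.ne', sub_self, zero_mul, sub_zero]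
      exact prod_pos fun k _ => sub_pos.2 (h1 k)

theorem exists_root_of_mul_neg {f : ℝ → ℝ} (hf : Continuous f) {x y : ℝ} (hxy : x < y)
    (h : f x * f y < 0) : ∃ z ∈ Set.Ioo x y, f z = 0 := by
  rcases mul_neg_iff.1 h with ⟨h1, h2⟩ | ⟨h1, h2⟩
  · exact intermediate_value_Ioo' hxy.le hf.continuousOn ⟨h2, h1⟩
  · exact intermediate_value_Ioo hxy.le hf.continuousOn ⟨h1, h2⟩

/-- Every other node lies on the same side of two neighbours, so the sign comes only from their
mutual differences. This produces the sign change of the secular polynomial between consecutive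
nodes. -/
theorem prod_erase_succ_mul_neg (ha : StrictMono a) (i j : Fin n) (hij : (j : ℕ) = i + 1) :
    (∏ l ∈ univ.erase i, (a i - a l)) * ∏ l ∈ univ.erase j, (a j - a l) < 0 := by
  have hlt : i < j := by rw [Fin.lt_def]; omega
  rw [← mul_prod_erase (univ.erase i) _ (mem_erase.2 ⟨hlt.ne', mem_univ j⟩),
    ← mul_prod_erase (univ.erase j) _ (mem_erase.2 ⟨hlt.ne, mem_univ i⟩), erase_right_comm,
    mul_mul_mul_comm, ← prod_mul_distrib]
  refine mul_neg_of_neg_of_pos ?_ (prod_pos fun l hl => ?_)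
  · have := ha hlt
    exact mul_neg_of_neg_of_pos (by linarith) (by linarith)
  · have h2 := (mem_erase.1 hl).1
    have h1 := (mem_erase.1 (mem_erase.1 hl).2).1
    rcases lt_or_gt_of_ne h2 with h | h
    · exact mul_pos (sub_pos.2 (ha h)) (sub_pos.2 (ha (h.trans hlt)))
    · have : j < l := by
        have h3 : (l : ℕ) ≠ j := fun h => h1 (Fin.ext h)
        rw [Fin.lt_def] at h ⊢; omega
      exact mul_pos_of_neg_of_neg (sub_neg.2 (ha h)) (sub_neg.2 (ha this))

/-- The secular polynomial with positive weights has interlacing roots. -/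
theorem exists_interlacing_roots (ha : StrictMono a) (hε : 0 ≤ ε) (hδ : ∀ k, 0 < β - ε * a k)
    (ht : ∀ k, 0 < t k) :
    ∃ u ∈ interlacing β ε a, ∀ i, (secular β ε a t).eval (u i) = 0 := by
  obtain ⟨z, hz, hzδ, hzpos⟩ := exists_eval_secular_pos (t := t) hε hδ
  have hc : Continuous fun x => (secular β ε a t).eval x := (secular β ε a t).continuous
  have key : ∀ i : Fin n, ∃ x, a i < x ∧ x < z ∧ (∀ j, i < j → x < a j) ∧
      (secular β ε a t).eval x = 0 := by
    intro i
    by_cases hi : (i : ℕ) + 1 < n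
    · set j : Fin n := ⟨i + 1, hi⟩ with hj
      have hij : i < j := by rw [Fin.lt_def, hj]; simp
      obtain ⟨x, hx, hx0⟩ := exists_root_of_mul_neg hc (ha hij) (by
        rw [eval_secular_node, eval_secular_node]
        have h1 := prod_erase_succ_mul_neg ha i j rfl
        have h2 := mul_pos (mul_pos (hδ i) (ht i)) (mul_pos (hδ j) (ht j))
        nlinarith [mul_neg_of_pos_of_neg h2 h1])
      refine ⟨x, hx.1, hx.2.trans (hz j), fun k hk => hx.2.trans_le (ha.monotone ?_), hx0⟩
      rw [Fin.lt_def] at hk; rw [Fin.le_def, hj]; exact hk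
    · obtain ⟨x, hx, hx0⟩ := exists_root_of_mul_neg hc (hz i) (by
        rw [eval_secular_node]
        refine mul_neg_of_neg_of_pos (neg_neg_of_pos (mul_pos (mul_pos (hδ i) (ht i))
          (prod_pos fun l hl => sub_pos.2 (ha ?_)))) hzpos
        have h1 := (mem_erase.1 hl).1
        have h3 : (l : ℕ) ≠ i := fun h => h1 (Fin.ext h)
        have := l.2
        rw [Fin.lt_def]; omega)
      refine ⟨x, hx.1, hx.2, fun k hk => ?_, hx0⟩
      have := k.2
      rw [Fin.lt_def] at hk; omega
  choose u h1 h2 h3 h4 using key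
  exact ⟨u, ⟨h3, h1, fun i => hzδ _ (h2 i) ⟨i, h1 i⟩⟩, h4⟩

/-- Positive weights are the weights of the interlacing roots of the secular polynomial. -/
theorem weight_eq_of_roots (ha : StrictMono a) (hδ : ∀ k, 0 < β - ε * a k)
    (hu : u ∈ interlacing β ε a) (hroot : ∀ i, (secular β ε a t).eval (u i) = 0) :
    weight β ε a u = t := by
  have h1 := eq_C_mul_prod_of_roots _ natDegree_secular_le u
    (strictMono_of_mem_interlacing hu).injective hroot
  have h2 := secular_weight ha.injective hδ hu.2.2
  set p := ∏ i, (X - C (u i)) with hp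
  have hpc : p.coeff n = 1 := by
    have h1 := coeff_prod_X_sub_C univ u
    rwa [card_univ, Fintype.card_fin] at h1
  rw [coeff_secular] at h1
  have h3 : (∏ k, (β - ε * u k)) * (1 + ε * ∑ k, weight β ε a u k) = ∏ k, (β - ε * a k) := by
    have := congrArg (fun q => coeff q n) h2
    simpa only [coeff_C_mul, coeff_secular, hpc, mul_one] using this
  have hδu : 0 < ∏ k, (β - ε * u k) := prod_pos fun i _ => hu.2.2 i
  have hδa : 0 < ∏ k, (β - ε * a k) := prod_pos fun i _ => hδ i
  have h4 : ∀ k, weight β ε a u k * ((1 + ε * ∑ k, t k) * ∏ k, (β - ε * u k)) =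
      (∏ k, (β - ε * a k)) * t k := by
    intro k
    have e1 := congrArg (eval (a k)) h1
    have e2 := congrArg (eval (a k)) h2
    rw [eval_mul, eval_C, eval_secular_node] at e1
    rw [eval_mul, eval_mul, eval_C, eval_C, eval_secular_node] at e2
    have hP := mul_ne_zero (hδ k).ne' (prod_erase_node_ne_zero ha.injective k)
    apply mul_right_cancel₀ hP
    linear_combination (∏ k, (β - ε * a k)) * e1 - (1 + ε * ∑ k, t k) * e2
  have h5 : (∑ k, weight β ε a u k) * ((1 + ε * ∑ k, t k) * ∏ k, (β - ε * u k)) =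
      (∏ k, (β - ε * a k)) * ∑ k, t k := by
    rw [Finset.sum_mul, Finset.mul_sum univ t (∏ k, (β - ε * a k))]; exact sum_congr rfl fun k _ => h4 k
  -- By `h4` the two families of weights are proportional. Eliminating the sum of the weights of `u`
  -- between `h3` and `h5` shows that the factor of proportionality is `1`.
  have h6 : (1 + ε * ∑ k, t k) * ∏ k, (β - ε * u k) = ∏ k, (β - ε * a k) := by
    linear_combination (1 + ε * ∑ k, t k) * h3 - ε * h5
  funext k
  have := h4 k
  rw [h6, mul_comm] at this
  exact mul_left_cancel₀ hδa.ne' this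

theorem secular_weight_eval_root (ha : StrictMono a) (hδ : ∀ k, 0 < β - ε * a k)
    (hu : u ∈ interlacing β ε a) (i : Fin n) :
    (secular β ε a (weight β ε a u)).eval (u i) = 0 := by
  have h2 := congrArg (eval (u i)) (secular_weight ha.injective hδ hu.2.2)
  rw [eval_mul, eval_mul, eval_C, eval_C, eval_prod,
    prod_eq_zero (f := fun j => eval (u i) (X - C (u j))) (mem_univ i) (by rw [eval_sub, eval_X, eval_C, sub_self]),
    mul_zero] at h2
  exact (mul_eq_zero.1 h2).resolve_left (prod_ne_zero_iff.2 fun i _ => (hu.2.2 i).ne')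

/-- Equal weights give the same secular polynomial up to a nonzero factor, so each `u i` is some `v
j`; interlacing with the same nodes forces `j = i`. -/
theorem weight_injOn (ha : StrictMono a) (hδ : ∀ k, 0 < β - ε * a k) :
    Set.InjOn (weight β ε a) (interlacing β ε a) := by
  intro u hu v hv huv
  funext i
  have h1 := secular_weight_eval_root ha hδ hu i
  have h2 := congrArg (eval (u i)) (secular_weight ha.injective hδ hv.2.2)
  rw [← huv, eval_mul, h1, mul_zero, eval_mul, eval_C, eval_prod] at h2
  have h3 := (mul_eq_zero.1 h2.symm).resolve_left (prod_ne_zero_iff.2 fun i _ => (hδ i).ne')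
  obtain ⟨j, -, hj⟩ := prod_eq_zero_iff.1 h3
  simp only [eval_sub, eval_X, eval_C, sub_eq_zero] at hj
  rcases lt_trichotomy i j with h | rfl | h
  · have := hu.1 i j h
    have := hv.2.1 j
    linarith
  · exact hj
  · have := hv.1 j i h
    have := hu.2.1 i
    linarith

theorem weight_image (ha : StrictMono a) (hε : 0 ≤ ε) (hδ : ∀ k, 0 < β - ε * a k) :
    weight β ε a '' interlacing β ε a = {t | ∀ k, 0 < t k} := by
  ext t
  constructor
  · rintro ⟨u, hu, rfl⟩
    exact weight_pos ha hδ hu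
  · intro ht
    obtain ⟨u, hu, hr⟩ := exists_interlacing_roots ha hε hδ ht
    exact ⟨u, hu, weight_eq_of_roots ha hδ hu hr⟩

theorem measurableSet_interlacing : MeasurableSet (interlacing β ε a) := by
  unfold interlacing
  measurability

/-- The Jacobian of the weights of interlacing points. -/
def weightJacobian (β ε : ℝ) (a u : Fin n → ℝ) : ℝ :=
  (∏ k, weight β ε a u k) * (∏ k, (β - ε * a k)) / (∏ k, (β - ε * u k)) *
    (absVdm a * absVdm u / ∏ k, ∏ i, |a k - u i|)

theorem exists_hasFDerivAt_weight (ha : StrictMono a) (hδ : ∀ k, 0 < β - ε * a k)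
    (hu : u ∈ interlacing β ε a) :
    ∃ L : (Fin n → ℝ) →L[ℝ] (Fin n → ℝ), HasFDerivAt (weight β ε a) L u ∧
      |L.det| = weightJacobian β ε a u := by
  -- Logarithmic differentiation of the product defining the weight: `(a - x)/(β - ε x)` has
  -- logarithmic derivative `-(β - ε a)/((β - ε x)(a - x))`. Up to row and column factors this is a
  -- Cauchy matrix.
  set J : Matrix (Fin n) (Fin n) ℝ := Matrix.of fun k i =>
    weight β ε a u k * (((β - ε * a k)) * (-(β - ε * u i)⁻¹ * (a k - u i)⁻¹)) with hJ
  have hne := node_ne_of_mem_interlacing ha hu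
  refine ⟨LinearMap.toContinuousLinearMap (Matrix.toLin' J), ?_, ?_⟩
  · rw [hasFDerivAt_pi']
    intro k
    have h1 : ∀ i ∈ (univ : Finset (Fin n)), HasFDerivAt
        (fun v : Fin n → ℝ => (a k - v i) / (β - ε * v i))
        ((-(β - ε * a k) / (β - ε * u i) ^ 2) •
          (ContinuousLinearMap.proj i : (Fin n → ℝ) →L[ℝ] ℝ)) u := by
      intro i _
      have hd : HasDerivAt (fun x : ℝ => (a k - x) / (β - ε * x))
          (-(β - ε * a k) / (β - ε * u i) ^ 2) (u i) := by
        have e1 : HasDerivAt (fun x : ℝ => a k - x) (-1) (u i) := by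
          simpa using (hasDerivAt_id (u i)).const_sub (a k)
        have e2 : HasDerivAt (fun x : ℝ => β - ε * x) (-ε) (u i) := by
          simpa using ((hasDerivAt_id (u i)).const_mul ε).const_sub β
        exact (e1.div e2 (hu.2.2 i).ne').congr_deriv (by ring)
      exact hd.comp_hasFDerivAt u
        (ContinuousLinearMap.proj i : (Fin n → ℝ) →L[ℝ] ℝ).hasFDerivAt
    have h2 := (HasFDerivAt.finsetProd h1).const_mul
      (-(∏ l, (β - ε * a l)) / ((β - ε * a k) * ∏ l ∈ univ.erase k, (a k - a l)))
    refine HasFDerivAt.congr_fderiv h2 ?_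
    refine ContinuousLinearMap.ext fun v => ?_
    simp only [ContinuousLinearMap.coe_comp, Function.comp_apply,
      LinearMap.coe_toContinuousLinearMap', ContinuousLinearMap.proj_apply, Matrix.toLin'_apply,
      Matrix.mulVec, dotProduct, _root_.smul_apply, _root_.sum_apply,
      smul_eq_mul, Finset.mul_sum]
    refine sum_congr rfl fun i _ => ?_
    rw [hJ, Matrix.of_apply, weight,
      ← mul_prod_erase univ (fun i => (a k - u i) / (β - ε * u i)) (mem_univ i)]
    have := (hu.2.2 i).ne'
    have := sub_ne_zero.2 (hne k i)
    field_simp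
  · rw [ContinuousLinearMap.det]
    simp only [LinearMap.coe_toContinuousLinearMap, LinearMap.det_toLin']
    have h1 : J = Matrix.of fun k i => weight β ε a u k * (Matrix.of fun k i => (β - ε * a k) *
        (Matrix.of fun k i => (-(β - ε * u i)⁻¹) *
          (Matrix.of fun k i => (a k - u i)⁻¹) k i) k i) k i := rfl
    rw [h1, Matrix.det_mul_column, Matrix.det_mul_column, Matrix.det_mul_row, abs_mul, abs_mul,
      abs_mul, abs_det_cauchy a u (strictMono_of_mem_interlacing hu).injective hne, weightJacobian,
      abs_of_pos (prod_pos fun k _ => weight_pos ha hδ hu k), abs_of_pos (prod_pos fun k _ => hδ k),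
      abs_prod]
    have : ∀ i, |-(β - ε * u i)⁻¹| = (β - ε * u i)⁻¹ := fun i => by
      rw [abs_neg, abs_of_pos (inv_pos.2 (hu.2.2 i))]
    simp_rw [this, prod_inv_distrib]
    ring

/-- Change of variables from interlacing points to positive weights. -/
theorem lintegral_weight (ha : StrictMono a) (hε : 0 ≤ ε) (hδ : ∀ k, 0 < β - ε * a k)
    (H : (Fin n → ℝ) → ENNReal) :
    ∫⁻ t in {t | ∀ k, 0 < t k}, H t =
      ∫⁻ u in interlacing β ε a,
        ENNReal.ofReal (weightJacobian β ε a u) * H (weight β ε a u) := by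
  have hex : ∀ u, ∃ L : (Fin n → ℝ) →L[ℝ] (Fin n → ℝ), u ∈ interlacing β ε a →
      HasFDerivAt (weight β ε a) L u ∧ |L.det| = weightJacobian β ε a u := by
    intro u
    by_cases hu : u ∈ interlacing β ε a
    · obtain ⟨L, hL⟩ := exists_hasFDerivAt_weight ha hδ hu
      exact ⟨L, fun _ => hL⟩
    · exact ⟨0, fun h => absurd h hu⟩
  choose L hL using hex
  rw [← weight_image ha hε hδ, lintegral_image_eq_lintegral_abs_det_fderiv_mul volume
    measurableSet_interlacing (fun u hu => (hL u hu).1.hasFDerivWithinAt) (weight_injOn ha hδ)]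
  refine setLIntegral_congr_fun measurableSet_interlacing fun u hu => ?_
  rw [(hL u hu).2]

theorem prod_weight (ha : StrictMono a) (hδ : ∀ k, 0 < β - ε * a k)
    (hu : u ∈ interlacing β ε a) :
    ∏ k, weight β ε a u k = ((∏ k, (β - ε * a k)) / ∏ k, (β - ε * u k)) ^ n *
      (∏ k, ∏ i, |a k - u i|) / ((∏ k, (β - ε * a k)) * absVdm a ^ 2) := by
  have h0 : ∀ k, weight β ε a u k = ((∏ k, (β - ε * a k)) / ∏ k, (β - ε * u k)) *
      (∏ i, |a k - u i|) / ((β - ε * a k) * ∏ l ∈ univ.erase k, |a k - a l|) := by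
    intro k
    rw [← abs_of_pos (weight_pos ha hδ hu k), weight, abs_mul, abs_div, abs_neg, abs_mul,
      abs_of_pos (hδ k), abs_of_pos (prod_pos fun k _ => hδ k), prod_div_distrib, abs_div,
      abs_of_pos (prod_pos fun k _ => hu.2.2 k), abs_prod, abs_prod]
    ring
  simp_rw [h0]
  rw [prod_div_distrib, prod_mul_distrib, prod_mul_distrib, prod_prod_erase_abs, prod_const,
    card_univ, Fintype.card_fin]

theorem one_add_sum_weight (ha : StrictMono a) (hδ : ∀ k, 0 < β - ε * a k)
    (hu : u ∈ interlacing β ε a) :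
    1 + ε * ∑ k, weight β ε a u k = (∏ k, (β - ε * a k)) / ∏ k, (β - ε * u k) := by
  have h2 := secular_weight ha.injective hδ hu.2.2
  have hpc := coeff_prod_X_sub_C univ u
  rw [card_univ, Fintype.card_fin] at hpc
  have := congrArg (fun q => coeff q n) h2
  simp only [coeff_C_mul, coeff_secular, hpc, mul_one] at this
  rw [eq_div_iff (prod_ne_zero_iff.2 fun i _ => (hu.2.2 i).ne'), mul_comm, this]

end Secular

/-! ### The Dixon–Anderson integral and the kernel for adding a row -/

section Kernels

open Finset

variable {n : ℕ}

/-- Squaring reduces the identities between densities to rational identities between a few positive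
products. -/
theorem div_sqrt_eq_div_sqrt {x y z w : ℝ} (hx : 0 ≤ x) (hy : 0 < y) (hz : 0 ≤ z) (hw : 0 < w)
    (h : x ^ 2 * w = z ^ 2 * y) : x / √y = z / √w := by
  rw [div_eq_div_iff (Real.sqrt_ne_zero'.2 hy) (Real.sqrt_ne_zero'.2 hw)]
  refine (sq_eq_sq₀ (by positivity) (by positivity)).1 ?_
  rw [mul_pow, mul_pow, Real.sq_sqrt hw.le, Real.sq_sqrt hy.le, h]

theorem prod_prod_abs_pos {β ε : ℝ} {a u : Fin n → ℝ} (ha : StrictMono a)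
    (hu : u ∈ interlacing β ε a) : 0 < ∏ k, ∏ i, |a k - u i| :=
  prod_pos fun k _ => prod_pos fun i _ =>
    abs_pos.2 (sub_ne_zero.2 (node_ne_of_mem_interlacing ha hu k i))

/-- The normalization constant of the Dixon–Anderson integral with all exponents `1/2`. -/
def dixonAndersonConst (n : ℕ) : ENNReal :=
  ∫⁻ t in {t : Fin n → ℝ | ∀ k, 0 < t k},
    ENNReal.ofReal (1 / √((∏ k, t k) * (1 + ∑ k, t k) ^ (n + 1)))

/-- The Dixon–Anderson integral with all exponents `1/2`. -/
theorem lintegral_dixonAnderson (x : Fin (n + 1) → ℝ) (hx : StrictMono x) :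
    ∫⁻ u in interlacing (x (Fin.last n)) 1 (fun k => x k.castSucc),
      ENNReal.ofReal (absVdm u / √(∏ k, ∏ i, |x k - u i|)) = dixonAndersonConst n := by
  set b := x (Fin.last n) with hb
  set a : Fin n → ℝ := fun k => x k.castSucc with ha_def
  have ha : StrictMono a := fun i j hij => hx (Fin.castSucc_lt_castSucc_iff.2 hij)
  have hδ : ∀ k, 0 < b - 1 * a k := fun k => by
    rw [one_mul, sub_pos]; exact hx (Fin.castSucc_lt_last k)
  -- All points but the last serve as nodes and the last one is `β`. In the weight variables the
  -- integrand no longer involves `x`.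
  rw [dixonAndersonConst, lintegral_weight ha zero_le_one hδ]
  refine setLIntegral_congr_fun measurableSet_interlacing fun u hu => ?_
  have hDa : 0 < ∏ k, (b - 1 * a k) := prod_pos fun k _ => hδ k
  have hDu : 0 < ∏ k, (b - 1 * u k) := prod_pos fun k _ => hu.2.2 k
  have hP := prod_prod_abs_pos ha hu
  have hVa := absVdm_pos ha.injective
  have hVu := absVdm_pos (strictMono_of_mem_interlacing hu).injective
  have hT : 0 < ∏ k, weight b 1 a u k := prod_pos fun k _ => weight_pos ha hδ hu k
  have hTe := prod_weight ha hδ hu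
  have hS := one_add_sum_weight ha hδ hu
  rw [one_mul] at hS
  have hsplit : ∏ k, ∏ i, |x k - u i| = (∏ k, ∏ i, |a k - u i|) * ∏ k, (b - 1 * u k) := by
    rw [Fin.prod_univ_castSucc]
    congr 1
    refine prod_congr rfl fun i _ => ?_
    rw [one_mul, abs_of_pos]
    simpa using hu.2.2 i
  rw [hsplit, hS, weightJacobian]
  set Da := ∏ k, (b - 1 * a k)
  set Du := ∏ k, (b - 1 * u k)
  set P := ∏ k, ∏ i, |a k - u i|
  set T := ∏ k, weight b 1 a u k
  rw [← ENNReal.ofReal_mul (by positivity), mul_one_div]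
  congr 1
  refine div_sqrt_eq_div_sqrt hVu.le (by positivity) (by positivity) (by positivity) ?_
  rw [hTe]
  field_simp
  rw [pow_succ]
  field_simp

/-- The transition density, from the eigenvalues `l` to the eigenvalues `u`, when a row is added. -/
def addRowDensity (e : ℝ) (l : Fin n → ℝ) (u : Fin (n + 1) → ℝ) : ℝ :=
  absVdm u * ((∏ i, u i) / ∏ k, l k) ^ e / √((∏ i, u i) * ∏ k, ∏ i, |l k - u i|)

theorem strictMono_cons_zero {l : Fin n → ℝ} (hl : StrictMono l) (hl0 : ∀ k, 0 < l k) :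
    StrictMono (Fin.cons 0 l : Fin (n + 1) → ℝ) := by
  intro i j hij
  induction i using Fin.cases with
  | zero =>
    induction j using Fin.cases with
    | zero => exact absurd hij (lt_irrefl _)
    | succ j => simpa using hl0 j
  | succ i =>
    induction j using Fin.cases with
    | zero => exact absurd hij (by simp)
    | succ j => simpa using hl (Fin.succ_lt_succ_iff.1 hij)

theorem pos_of_mem_interlacing_cons {β ε : ℝ} {l : Fin n → ℝ} (hl0 : ∀ k, 0 < l k)
    {u : Fin (n + 1) → ℝ} (hu : u ∈ interlacing β ε (Fin.cons 0 l : Fin (n + 1) → ℝ))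
    (i : Fin (n + 1)) : 0 < u i := by
  have h := hu.2.1 i
  induction i using Fin.cases with
  | zero => simpa using h
  | succ i => exact (hl0 i).trans (by simpa using h)

/-- The quotient of the new by the old Gram determinant; it is the source of the power `e` in
`addRowDensity`. -/
theorem weight_cons_zero (l : Fin n → ℝ) (u : Fin (n + 1) → ℝ) :
    weight 1 0 (Fin.cons 0 l : Fin (n + 1) → ℝ) u 0 = (∏ i, u i) / ∏ k, l k := by
  have h : (univ.erase (0 : Fin (n + 1))) = univ.map (Fin.succEmb n) := by
    ext i
    simp only [mem_erase, mem_univ, and_true, mem_map, true_and, Fin.coe_succEmb]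
    exact ⟨fun h => Fin.exists_succ_eq.2 h, fun ⟨j, hj⟩ => hj ▸ Fin.succ_ne_zero j⟩
  rw [weight, h, prod_map]
  simp only [Fin.cons_zero, zero_mul, sub_zero, prod_const_one, one_mul, Fin.coe_succEmb,
    Fin.cons_succ, zero_sub, div_one, prod_neg, card_univ, Fintype.card_fin, pow_succ]
  rcases neg_one_pow_eq_or ℝ n with h | h <;> rw [h] <;> ring_nf

/-- The change of variables with nodes `0, l` and constant linear form. The left side has the shape
of the law of the squared components of a Lebesgue distributed row, with `w 0` the part orthogonal
to the old rows. -/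
theorem lintegral_addRowDensity (e : ℝ) {l : Fin n → ℝ} (hl : StrictMono l)
    (hl0 : ∀ k, 0 < l k) (H : (Fin (n + 1) → ℝ) → ENNReal) :
    ∫⁻ w in {w : Fin (n + 1) → ℝ | ∀ k, 0 < w k},
        ENNReal.ofReal (w 0 ^ e / √(∏ k, w k)) * H w =
      ∫⁻ u in interlacing 1 0 (Fin.cons 0 l : Fin (n + 1) → ℝ),
        ENNReal.ofReal (addRowDensity e l u) * H (weight 1 0 (Fin.cons 0 l) u) := by
  have ha := strictMono_cons_zero hl hl0
  set a : Fin (n + 1) → ℝ := Fin.cons 0 l with ha_def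
  have hδ : ∀ k, 0 < 1 - 0 * a k := fun k => by simp
  rw [lintegral_weight ha le_rfl hδ]
  refine setLIntegral_congr_fun measurableSet_interlacing fun u hu => ?_
  have hu0 := pos_of_mem_interlacing_cons hl0 hu
  have hP := prod_prod_abs_pos ha hu
  have hVa := absVdm_pos ha.injective
  have hVu := absVdm_pos (strictMono_of_mem_interlacing hu).injective
  have hT : 0 < ∏ k, weight 1 0 a u k := prod_pos fun k _ => weight_pos ha hδ hu k
  have hTe := prod_weight ha hδ hu
  have hw0 : weight 1 0 a u 0 = (∏ i, u i) / ∏ k, l k := weight_cons_zero l u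
  have hpos : 0 < (∏ i, u i) / ∏ k, l k :=
    div_pos (prod_pos fun k _ => hu0 k) (prod_pos fun k _ => hl0 k)
  have hsplit : ∏ k, ∏ i, |a k - u i| = (∏ i, u i) * ∏ k, ∏ i, |l k - u i| := by
    rw [Fin.prod_univ_succ]
    congr 1
    refine prod_congr rfl fun i _ => ?_
    rw [ha_def, Fin.cons_zero, zero_sub, abs_neg, abs_of_pos (hu0 i)]
  rw [← mul_assoc, hw0, addRowDensity, ← hsplit, weightJacobian]
  simp only [zero_mul, sub_zero, prod_const_one, one_pow, one_mul, mul_one, div_one] at hTe ⊢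
  set R := (∏ i, u i) / ∏ k, l k
  set P := ∏ k, ∏ i, |a k - u i|
  set T := ∏ k, weight 1 0 a u k
  have hRe : 0 ≤ R ^ e := Real.rpow_nonneg hpos.le e
  rw [← ENNReal.ofReal_mul (by positivity), mul_div_assoc']
  congr 2
  refine div_sqrt_eq_div_sqrt (by positivity) (by positivity) (by positivity) (by positivity) ?_
  rw [hTe]
  field_simp

end Kernels

/-! ### Ordered eigenvalues and their measurability -/

section Eigenvalues

open Finset Polynomial

variable {N : ℕ}

theorem monotone_orderedEigenvalues {A : Matrix (Fin N) (Fin N) ℝ} (hA : A.IsHermitian) :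
    Monotone (orderedEigenvalues hA) := fun i j hij =>
  hA.eigenvalues₀_antitone (by simpa [Fin.le_def] using Fin.rev_le_rev.2 hij)

theorem exists_perm_orderedEigenvalues {A : Matrix (Fin N) (Fin N) ℝ} (hA : A.IsHermitian) :
    ∃ e : Equiv.Perm (Fin N), ∀ i, orderedEigenvalues hA i = hA.eigenvalues (e i) :=
  ⟨Fin.revPerm.trans ((finCongr (Fintype.card_fin N).symm).trans
    (Fintype.equivOfCardEq (Fintype.card_fin _))), fun i => by
      simp [orderedEigenvalues, Matrix.IsHermitian.eigenvalues]⟩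

theorem charpoly_eq_prod_orderedEigenvalues {A : Matrix (Fin N) (Fin N) ℝ} (hA : A.IsHermitian) :
    A.charpoly = ∏ i, (X - C (orderedEigenvalues hA i)) := by
  obtain ⟨e, he⟩ := exists_perm_orderedEigenvalues hA
  rw [hA.charpoly_eq]
  simp_rw [he]
  exact (Equiv.prod_comp e fun i => X - C (hA.eigenvalues i)).symm

theorem eq_of_monotone_of_prod_eq {l m : Fin N → ℝ} (hl : Monotone l) (hm : Monotone m)
    (h : ∏ i, (X - C (l i)) = ∏ i, (X - C (m i))) : l = m := by
  have h1 := congrArg roots h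
  have hr : ∀ f : Fin N → ℝ, (∏ i, (X - C (f i))).roots = (List.ofFn f : Multiset ℝ) := by
    intro f
    rw [← Fin.univ_val_map, ← roots_multiset_prod_X_sub_C (univ.val.map f), Multiset.map_map]
    rfl
  rw [hr, hr, Multiset.coe_eq_coe] at h1
  exact List.ofFn_injective
    (h1.eq_of_pairwise' hl.sortedLE_ofFn.pairwise hm.sortedLE_ofFn.pairwise)

theorem orderedEigenvalues_eq {A : Matrix (Fin N) (Fin N) ℝ} (hA : A.IsHermitian)
    {l : Fin N → ℝ} (hl : Monotone l) (h : A.charpoly = ∏ i, (X - C (l i))) :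
    orderedEigenvalues hA = l :=
  eq_of_monotone_of_prod_eq (monotone_orderedEigenvalues hA) hl
    (by rw [← charpoly_eq_prod_orderedEigenvalues hA, h])

/-- The values at `0, …, N` of the monic polynomial with given ordered roots. -/
def rootsToValues (N : ℕ) (l : {l : Fin N → ℝ // Monotone l}) (i : Fin (N + 1)) : ℝ :=
  ∏ j, ((i : ℝ) - l.1 j)

/-- Values at `N + 1` points determine a polynomial of degree at most `N`, and an injective
continuous map on a Polish space is a measurable embedding. Measurability of ordered roots thus
reduces to that of values of the characteristic polynomial, which are polynomials in the entries. -/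
theorem measurableEmbedding_rootsToValues : MeasurableEmbedding (rootsToValues N) := by
  have hcl : IsClosed {l : Fin N → ℝ | Monotone l} := by
    simp only [Monotone, Set.ofPred_forall]
    exact isClosed_iInter fun i => isClosed_iInter fun j => isClosed_iInter fun _ =>
      isClosed_le (continuous_apply i) (continuous_apply j)
  have : PolishSpace {l : Fin N → ℝ // Monotone l} := hcl.polishSpace
  refine Continuous.measurableEmbedding ?_ ?_
  · refine continuous_pi fun i => continuous_finsetProd _ fun j _ => ?_
    exact continuous_const.sub ((continuous_apply j).comp continuous_subtype_val)
  · intro l m hlm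
    refine Subtype.ext (eq_of_monotone_of_prod_eq l.2 m.2 ?_)
    rw [← sub_eq_zero]
    refine eq_zero_of_degree_lt_of_eval_index_eq_zero (v := fun i : Fin (N + 1) => (i : ℝ)) univ
      (fun i _ j _ h => Fin.ext (by simpa using h)) ?_ ?_
    · rw [card_univ, Fintype.card_fin]
      have hd : (∏ i, (X - C (l.1 i)) - ∏ i, (X - C (m.1 i))).natDegree ≤ N :=
        (natDegree_sub_le _ _).trans (max_le (by rw [natDegree_prod_X_sub_C]; simp)
          (by rw [natDegree_prod_X_sub_C]; simp))
      exact (degree_le_of_natDegree_le hd).trans_lt (by exact_mod_cast Nat.lt_succ_self N)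
    · intro i _
      have := congrFun hlm i
      simp only [rootsToValues] at this
      simp [eval_prod, this]

/-- Ordered eigenvalues depend measurably on the matrix. -/
theorem measurable_orderedEigenvalues {α : Type*} [MeasurableSpace α]
    {A : α → Matrix (Fin N) (Fin N) ℝ} (hA : ∀ x, (A x).IsHermitian)
    (hm : ∀ i j, Measurable fun x => A x i j) :
    Measurable fun x => orderedEigenvalues (hA x) := by
  suffices h : Measurable fun x => (⟨orderedEigenvalues (hA x), monotone_orderedEigenvalues (hA x)⟩ :
      {l : Fin N → ℝ // Monotone l}) from measurable_subtype_coe.comp h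
  rw [← measurableEmbedding_rootsToValues.measurable_comp_iff]
  refine measurable_pi_lambda _ fun i => ?_
  have h1 : ∀ x, (rootsToValues N ∘ fun x => (⟨orderedEigenvalues (hA x),
      monotone_orderedEigenvalues (hA x)⟩ : {l : Fin N → ℝ // Monotone l})) x i =
      (Matrix.scalar (Fin N) (i : ℝ) - A x).det := by
    intro x
    rw [← Matrix.eval_charpoly, charpoly_eq_prod_orderedEigenvalues (hA x)]
    simp [rootsToValues, eval_prod]
  simp_rw [h1, Matrix.det_apply, Matrix.sub_apply]
  fun_prop

end Eigenvalues

/-! ### Densities of finite product measures -/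

section PiMeasure

variable {α : Type*} [MeasurableSpace α]

theorem lintegral_pi_succ (μ : Measure α) [SigmaFinite μ] {n : ℕ}
    {F : (Fin (n + 1) → α) → ENNReal} (hF : Measurable F) :
    ∫⁻ x, F x ∂(Measure.pi fun _ => μ) =
      ∫⁻ a, ∫⁻ x, F (Fin.cons a x) ∂(Measure.pi fun _ : Fin n => μ) ∂μ := by
  have h := (measurePreserving_piFinSuccAbove (fun _ : Fin (n + 1) => μ) 0).symm
  rw [← h.lintegral_comp hF, lintegral_prod]
  · simp only [MeasurableEquiv.piFinSuccAbove_symm_apply, Fin.insertNthEquiv_zero]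
    rfl
  · exact (hF.comp (MeasurableEquiv.measurable _)).aemeasurable

theorem measurable_cons {n : ℕ} :
    Measurable fun p : α × (Fin n → α) => (Fin.cons p.1 p.2 : Fin (n + 1) → α) := by
  refine measurable_pi_lambda _ fun i => ?_
  induction i using Fin.cases with
  | zero => simpa using measurable_fst
  | succ i =>
    simp only [Fin.cons_succ]
    exact (measurable_pi_apply i).comp measurable_snd

theorem lintegral_pi_withDensity (μ : Measure α) [SigmaFinite μ] {f : α → ENNReal}
    (hf : Measurable f) [SigmaFinite (μ.withDensity f)] (n : ℕ)
    {F : (Fin n → α) → ENNReal} (hF : Measurable F) :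
    ∫⁻ x, F x ∂(Measure.pi fun _ => μ.withDensity f) =
      ∫⁻ x, (∏ i, f (x i)) * F x ∂(Measure.pi fun _ => μ) := by
  induction n with
  | zero =>
    have h : ∀ ν ν' : Measure α, (Measure.pi fun _ : Fin 0 => ν) = Measure.pi fun _ => ν' := by
      intro ν ν'
      rw [Measure.pi_of_empty, Measure.pi_of_empty]
    rw [h _ μ]
    simp
  | succ n ih =>
    have hFc : Measurable fun p : α × (Fin n → α) => F (Fin.cons p.1 p.2) :=
      hF.comp measurable_cons
    rw [lintegral_pi_succ _ hF, lintegral_pi_succ _ (by fun_prop)]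
    have ih' : ∀ a, ∫⁻ x, F (Fin.cons a x) ∂(Measure.pi fun _ : Fin n => μ.withDensity f) =
        ∫⁻ x, (∏ i, f (x i)) * F (Fin.cons a x) ∂(Measure.pi fun _ => μ) :=
      fun a => ih (hFc.comp measurable_prodMk_left)
    simp_rw [ih']
    rw [lintegral_withDensity_eq_lintegral_mul _ hf]
    · refine lintegral_congr fun a => ?_
      rw [Pi.mul_apply, ← lintegral_const_mul]
      · refine lintegral_congr fun x => ?_
        rw [Fin.prod_univ_succ, mul_assoc]
        simp
      · exact Measurable.mul (by fun_prop) (hFc.comp measurable_prodMk_left)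
    · refine Measurable.lintegral_prod_right' (f := fun p : α × (Fin n → α) =>
        (∏ i, f (p.2 i)) * F (Fin.cons p.1 p.2)) ?_
      exact Measurable.mul (by fun_prop) hFc

/-- A finite power of a measure with density has the product density. -/
theorem pi_withDensity (μ : Measure α) [SigmaFinite μ] {f : α → ENNReal}
    (hf : Measurable f) [SigmaFinite (μ.withDensity f)] (n : ℕ) :
    (Measure.pi fun _ : Fin n => μ.withDensity f) =
      (Measure.pi fun _ => μ).withDensity fun x => ∏ i, f (x i) := by
  refine Measure.ext_of_lintegral _ fun F hF => ?_
  rw [lintegral_pi_withDensity μ hf n hF, lintegral_withDensity_eq_lintegral_mul _ (by fun_prop) hF]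
  rfl

end PiMeasure

/-! ### Polar coordinates and the squared norm -/

section Radial

open Set Module

variable {E : Type*} [NormedAddCommGroup E] [NormedSpace ℝ E] [FiniteDimensional ℝ E]
  [Nontrivial E] [MeasurableSpace E] [BorelSpace E] (μ : Measure E) [μ.IsAddHaarMeasure]

/-- Integration in polar coordinates. -/
theorem lintegral_polar {f : E → ENNReal} (hf : Measurable f) :
    ∫⁻ x, f x ∂μ = ∫⁻ ω, (∫⁻ r in Ioi (0 : ℝ), ENNReal.ofReal (r ^ (finrank ℝ E - 1)) *
      f (r • (ω : E))) ∂μ.toSphere := by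
  have h1 : ∫⁻ x, f x ∂μ = ∫⁻ x : ({(0)}ᶜ : Set E), f x ∂(μ.comap (↑)) := by
    rw [lintegral_subtype_comap (measurableSet_singleton _).compl, restrict_compl_singleton]
  have h2 := μ.measurePreserving_homeomorphUnitSphereProd.lintegral_comp_emb
    (Homeomorph.measurableEmbedding _) (fun p => f ((p.2 : ℝ) • (p.1 : E)))
  rw [h1]
  have h3 : ∀ x : ({(0)}ᶜ : Set E), f (((homeomorphUnitSphereProd E x).2 : ℝ) •
      ((homeomorphUnitSphereProd E x).1 : E)) = f x := by
    intro x
    congr 1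
    have : ‖(x : E)‖ ≠ 0 := norm_ne_zero_iff.2 x.2
    simp [smul_smul, this]
  simp_rw [h3] at h2
  rw [h2, lintegral_prod _ (by fun_prop)]
  refine lintegral_congr fun ω => ?_
  rw [Measure.volumeIoiPow, lintegral_withDensity_eq_lintegral_mul _ (by fun_prop) (by fun_prop)]
  simp only [Pi.mul_apply]
  rw [lintegral_subtype_comap measurableSet_Ioi
    fun r : ℝ => ENNReal.ofReal (r ^ (finrank ℝ E - 1)) * f (r • (ω : E))]

theorem lintegral_Ioi_sq (g : ℝ → ENNReal) :
    ∫⁻ w in Ioi (0 : ℝ), g w = ∫⁻ r in Ioi (0 : ℝ), ENNReal.ofReal (2 * r) * g (r ^ 2) := by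
  have him : (fun r : ℝ => r ^ 2) '' Ioi 0 = Ioi 0 := by
    ext w
    constructor
    · rintro ⟨r, hr, rfl⟩
      exact pow_pos (mem_Ioi.1 hr) 2
    · intro hw
      exact ⟨√w, Real.sqrt_pos.2 hw, Real.sq_sqrt (le_of_lt hw)⟩
  conv_lhs => rw [← him]
  rw [lintegral_image_eq_lintegral_abs_deriv_mul (f' := fun r => 2 * r) measurableSet_Ioi
    (fun r _ => by simpa using (hasDerivAt_pow 2 r).hasDerivWithinAt)
    (fun r hr s hs h => (sq_eq_sq₀ (le_of_lt hr) (le_of_lt hs)).1 h)]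
  refine setLIntegral_congr_fun measurableSet_Ioi fun r hr => ?_
  rw [abs_of_pos (mul_pos two_pos hr)]

/-- The distribution of the squared norm under Lebesgue measure. -/
theorem lintegral_norm_sq {f : ℝ → ENNReal} (hf : Measurable f) :
    ∫⁻ x, f (‖x‖ ^ 2) ∂μ = μ.toSphere univ / 2 *
      ∫⁻ w in Ioi (0 : ℝ), ENNReal.ofReal (w ^ (((finrank ℝ E : ℝ) - 2) / 2)) * f w := by
  rw [lintegral_polar μ (by fun_prop)]
  have h : ∀ ω : Metric.sphere (0 : E) 1, ∫⁻ r in Ioi (0 : ℝ),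
      ENNReal.ofReal (r ^ (finrank ℝ E - 1)) * f (‖r • (ω : E)‖ ^ 2) =
      ∫⁻ r in Ioi (0 : ℝ), ENNReal.ofReal (r ^ (finrank ℝ E - 1)) * f (r ^ 2) := by
    intro ω
    simp [norm_smul]
  simp_rw [h]
  rw [lintegral_const, mul_comm, lintegral_Ioi_sq fun w =>
      ENNReal.ofReal (w ^ (((finrank ℝ E : ℝ) - 2) / 2)) * f w,
    ENNReal.div_eq_inv_mul, mul_comm 2⁻¹, mul_assoc,
    ← lintegral_const_mul 2⁻¹ (by fun_prop)]
  refine congrArg (μ.toSphere univ * ·) (setLIntegral_congr_fun (measurableSet_Ioi (a := (0 : ℝ))) fun r hr => ?_)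
  have hr0 : (0 : ℝ) < r := hr
  have hd : 1 ≤ finrank ℝ E := finrank_pos
  have h2 : (2 : ENNReal)⁻¹ = ENNReal.ofReal (2⁻¹) := by
    rw [ENNReal.ofReal_inv_of_pos two_pos]; simp
  rw [← mul_assoc, ← mul_assoc, h2, ← ENNReal.ofReal_mul (by positivity),
    ← ENNReal.ofReal_mul (by positivity)]
  congr 2
  rw [← Real.rpow_natCast r 2, ← Real.rpow_mul hr0.le, ← Real.rpow_natCast, Nat.cast_sub hd,
    show 2⁻¹ * (2 * r) = r ^ (1 : ℝ) by rw [Real.rpow_one]; ring, ← Real.rpow_add hr0]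
  congr 1
  push_cast
  ring

end Radial

/-! ### Gram eigenvalues after adding a row -/

section AddRow

open Finset RealInnerProductSpace

variable {N M : ℕ}

/-- The ordered eigenvalues of the Gram matrix of the rows `X`. -/
def gramEig (X : Fin N → EuclideanSpace ℝ (Fin M)) : Fin N → ℝ :=
  orderedEigenvalues (Matrix.isHermitian_gram ℝ X)

theorem measurable_gramEig :
    Measurable (gramEig : (Fin N → EuclideanSpace ℝ (Fin M)) → Fin N → ℝ) := by
  refine measurable_orderedEigenvalues _ fun i j => ?_
  simp only [Matrix.gram_apply]
  fun_prop

theorem gramEig_eq {X : Fin N → EuclideanSpace ℝ (Fin M)} {x : Fin N → ℝ} (hx : StrictMono x)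
    (h : ∀ k, ((Matrix.gram ℝ X).charpoly).eval (x k) = 0) : gramEig X = x := by
  refine orderedEigenvalues_eq _ hx.monotone ?_
  have hd : (Matrix.gram ℝ X).charpoly.natDegree = N := by
    rw [Matrix.charpoly_natDegree_eq_dim, Fintype.card_fin]
  have hm := (Matrix.charpoly_monic (Matrix.gram ℝ X)).coeff_natDegree
  rw [hd] at hm
  rw [eq_C_mul_prod_of_roots _ hd.le x hx.injective h, hm, Polynomial.C_1, one_mul]

/-- An ordered orthonormal eigenbasis of a real symmetric matrix. -/
theorem exists_eigenbasis {A : Matrix (Fin N) (Fin N) ℝ} (hA : A.IsHermitian) :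
    ∃ u : OrthonormalBasis (Fin N) ℝ (EuclideanSpace ℝ (Fin N)),
      ∀ i k, ∑ j, A k j * u i j = orderedEigenvalues hA i * u i k := by
  obtain ⟨e, he⟩ := exists_perm_orderedEigenvalues hA
  refine ⟨hA.eigenvectorBasis.reindex e.symm, fun i k => ?_⟩
  have := congrFun (hA.mulVec_eigenvectorBasis (e i)) k
  rw [OrthonormalBasis.reindex_apply, Equiv.symm_symm, he]
  simpa [Matrix.mulVec, dotProduct] using this

/-- Right singular vectors of a family of rows whose Gram matrix is nonsingular. -/
theorem exists_singularVectors (X : Fin N → EuclideanSpace ℝ (Fin M))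
    (hpos : ∀ i, 0 < gramEig X i) :
    ∃ (u : OrthonormalBasis (Fin N) ℝ (EuclideanSpace ℝ (Fin N)))
      (v : Fin N → EuclideanSpace ℝ (Fin M)), Orthonormal ℝ v ∧
      (∀ i k, ∑ j, ⟪X k, X j⟫ * u i j = gramEig X i * u i k) ∧
      ∀ i, ∑ k, u i k • X k = √(gramEig X i) • v i := by
  obtain ⟨u, hu⟩ := exists_eigenbasis (Matrix.isHermitian_gram ℝ X)
  have hu' : ∀ i k, ∑ j, ⟪X k, X j⟫ * u i j = gramEig X i * u i k := hu
  refine ⟨u, fun i => (√(gramEig X i))⁻¹ • ∑ k, u i k • X k, ?_, hu', fun i => ?_⟩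
  · rw [orthonormal_iff_ite]
    intro i j
    have h1 : ⟪∑ k, u i k • X k, ∑ k, u j k • X k⟫ = gramEig X j * ⟪u i, u j⟫ := by
      rw [sum_inner]
      simp_rw [inner_sum, real_inner_smul_left, real_inner_smul_right]
      have : ∀ k, ∑ m, u i k * (u j m * ⟪X k, X m⟫) = u i k * (gramEig X j * u j k) := by
        intro k
        rw [← hu' j k, Finset.mul_sum]
        exact sum_congr rfl fun m _ => by ring
      simp_rw [this, PiLp.inner_apply, Finset.mul_sum]
      refine sum_congr rfl fun k _ => ?_
      simp only [RCLike.inner_apply, conj_trivial]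
      ring
    rw [real_inner_smul_left, real_inner_smul_right, h1, orthonormal_iff_ite.1 u.orthonormal]
    by_cases hij : i = j
    · subst hij
      have h2 := Real.mul_self_sqrt (hpos i).le
      have h3 := (Real.sqrt_pos.2 (hpos i)).ne'
      simp only [if_true, mul_one]
      rw [← mul_assoc, ← mul_inv, h2, inv_mul_cancel₀ (hpos i).ne']
    · simp [hij]
  · rw [smul_smul, mul_inv_cancel₀ (Real.sqrt_pos.2 (hpos i)).ne', one_smul]

theorem secular_one_zero_root {n : ℕ} {a t : Fin n → ℝ} {z : ℝ} (hz : ∀ k, z ≠ a k)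
    (h : (secular 1 0 a t).eval z = 0) : ∑ k, t k / (z - a k) = 1 := by
  rw [eval_secular] at h
  have h0 : ∏ k, (z - a k) ≠ 0 := prod_ne_zero_iff.2 fun k _ => sub_ne_zero.2 (hz k)
  have h1 : ∀ k, t k * ∏ l ∈ univ.erase k, (z - a l) = t k / (z - a k) * ∏ k, (z - a k) := by
    intro k
    rw [← mul_prod_erase univ (fun l => z - a l) (mem_univ k)]
    field_simp [sub_ne_zero.2 (hz k)]
  simp_rw [h1, ← Finset.sum_mul] at h
  apply mul_right_cancel₀ h0
  linarith

/-- The effect of an additional row on the eigenvalues of the Gram matrix. -/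
theorem gramEig_cons (X : Fin N → EuclideanSpace ℝ (Fin M)) (y : EuclideanSpace ℝ (Fin M))
    (hmono : StrictMono (gramEig X)) (hpos : ∀ i, 0 < gramEig X i)
    (u : OrthonormalBasis (Fin N) ℝ (EuclideanSpace ℝ (Fin N)))
    (v : Fin N → EuclideanSpace ℝ (Fin M))
    (hu : ∀ i k, ∑ j, ⟪X k, X j⟫ * u i j = gramEig X i * u i k)
    (hv : ∀ i, ∑ k, u i k • X k = √(gramEig X i) • v i)
    (x : Fin (N + 1) → ℝ)
    (hx : x ∈ interlacing 1 0 (Fin.cons 0 (gramEig X) : Fin (N + 1) → ℝ))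
    (hw : weight 1 0 (Fin.cons 0 (gramEig X)) x =
      Fin.cons (‖y‖ ^ 2 - ∑ i, ⟪v i, y⟫ ^ 2) fun i => ⟪v i, y⟫ ^ 2) :
    gramEig (Fin.cons y X : Fin (N + 1) → EuclideanSpace ℝ (Fin M)) = x := by
  set l := gramEig X with hl
  have ha := strictMono_cons_zero hmono hpos
  refine gramEig_eq (strictMono_of_mem_interlacing hx) fun k => ?_
  set z := x k with hz
  have hza : ∀ i, z ≠ (Fin.cons 0 l : Fin (N + 1) → ℝ) i := fun i =>
    (node_ne_of_mem_interlacing ha hx i k).symm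
  have hz0 : z ≠ 0 := by simpa using hza 0
  have hzl : ∀ i, z - l i ≠ 0 := fun i => sub_ne_zero.2 (by simpa using hza i.succ)
  have hsec := secular_one_zero_root hza
    (hw ▸ secular_weight_eval_root ha (fun k => by simp) hx k)
  rw [Fin.sum_univ_succ] at hsec
  simp only [Fin.cons_zero, Fin.cons_succ, sub_zero] at hsec
  rw [Matrix.eval_charpoly, ← Matrix.exists_mulVec_eq_zero_iff]
  -- The bordered Gram matrix has an eigenvector for `z` with first entry `1`. In the eigenbasis `u`
  -- its other entries must have coordinates `p`; the remaining equation, in row `0`, is the secular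
  -- equation.
  set p : Fin N → ℝ := fun i => √(l i) * ⟪v i, y⟫ / (z - l i) with hp
  have hp2 : ∀ i, (z - l i) * p i = √(l i) * ⟪v i, y⟫ := fun i => by
    rw [hp]; field_simp [hzl i]
  have hXy : ∀ i, ∑ j, u i j * ⟪X j, y⟫ = √(l i) * ⟪v i, y⟫ := fun i => by
    rw [← real_inner_smul_left, ← hv, sum_inner]
    simp_rw [real_inner_smul_left]
  refine ⟨Fin.cons 1 fun j => ∑ i, p i * u i j, fun h => ?_, ?_⟩
  · have := congrFun h 0
    simp at this
  rw [Matrix.sub_mulVec, sub_eq_zero]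
  funext m
  rw [Matrix.scalar_apply, Matrix.mulVec_diagonal, Matrix.mulVec, dotProduct, Fin.sum_univ_succ]
  simp only [Matrix.gram_apply, Fin.cons_zero, Fin.cons_succ, mul_one]
  induction m using Fin.cases with
  | zero =>
    simp only [Fin.cons_zero, mul_one]
    have h1 : ∑ j, ⟪y, X j⟫ * ∑ i, p i * u i j = ∑ i, l i * ⟪v i, y⟫ ^ 2 / (z - l i) := by
      simp_rw [Finset.mul_sum]
      rw [sum_comm]
      refine sum_congr rfl fun i _ => ?_
      have : ∑ j, ⟪y, X j⟫ * (p i * u i j) = p i * ∑ j, u i j * ⟪X j, y⟫ := by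
        rw [Finset.mul_sum]
        exact sum_congr rfl fun j _ => by rw [real_inner_comm]; ring
      rw [this, hXy, hp]
      have h2 := Real.mul_self_sqrt (hpos i).le
      field_simp [hzl i]
      rw [sq, h2, mul_comm]
    have h3 : ∀ i, l i * ⟪v i, y⟫ ^ 2 / (z - l i) =
        z * (⟪v i, y⟫ ^ 2 / (z - l i)) - ⟪v i, y⟫ ^ 2 := fun i => by
      field_simp [hzl i]
      ring
    rw [h1, real_inner_self_eq_norm_sq]
    simp_rw [h3, sum_sub_distrib, ← Finset.mul_sum]
    field_simp at hsec
    linear_combination -hsec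
  | succ m =>
    simp only [Fin.cons_succ]
    have h1 : ∑ j, ⟪X m, X j⟫ * ∑ i, p i * u i j = ∑ i, p i * (l i * u i m) := by
      simp_rw [Finset.mul_sum]
      rw [sum_comm]
      refine sum_congr rfl fun i _ => ?_
      rw [← hu, Finset.mul_sum]
      exact sum_congr rfl fun j _ => by ring
    have h2 : ⟪X m, y⟫ = ∑ i, √(l i) * ⟪v i, y⟫ * u i m := by
      obtain ⟨g, hg⟩ : ∃ g : Fin N → ℝ, ∀ j, g j = ⟪X j, y⟫ := ⟨_, fun _ => rfl⟩
      have := congrArg (fun f : EuclideanSpace ℝ (Fin N) => f m) (u.sum_repr' (WithLp.toLp 2 g))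
      simp only [PiLp.inner_apply, RCLike.inner_apply, conj_trivial] at this
      rw [← hg, ← this]
      simp only [WithLp.ofLp_sum, WithLp.ofLp_smul, Finset.sum_apply, Pi.smul_apply, smul_eq_mul]
      refine sum_congr rfl fun i _ => ?_
      rw [← hXy]
      congr 1
      exact sum_congr rfl fun j _ => by rw [hg, mul_comm]
    rw [h1, h2, Finset.mul_sum, ← sum_add_distrib]
    refine sum_congr rfl fun i _ => ?_
    rw [← hp2]
    ring

end AddRow

/-! ### The law of the new eigenvalues for a Lebesgue distributed row -/

section AddRowIntegral

open Finset RealInnerProductSpace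

/-- The constant in the law of the squared norm on `ℝ^d`. -/
def sqNormConst (d : ℕ) : ENNReal :=
  (volume : Measure (EuclideanSpace ℝ (Fin d))).toSphere Set.univ / 2

/-- The density of the law of the squared norm on `ℝ^d` under Lebesgue measure. -/
def sqNormDensity (d : ℕ) (w : ℝ) : ENNReal :=
  (Set.Ioi (0 : ℝ)).indicator
    (fun w => sqNormConst d * ENNReal.ofReal (w ^ (((d : ℝ) - 2) / 2))) w

theorem sqNormConst_ne_top (d : ℕ) : sqNormConst d ≠ ⊤ :=
  ENNReal.div_ne_top (measure_ne_top _ _) two_ne_zero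

theorem measurable_sqNormDensity (d : ℕ) : Measurable (sqNormDensity d) :=
  Measurable.indicator (by fun_prop) measurableSet_Ioi

theorem sqNormDensity_ne_top (d : ℕ) (w : ℝ) : sqNormDensity d w ≠ ⊤ := by
  unfold sqNormDensity
  by_cases hw : w ∈ Set.Ioi (0 : ℝ)
  · rw [Set.indicator_of_mem hw]
    exact ENNReal.mul_ne_top (sqNormConst_ne_top d) ENNReal.ofReal_ne_top
  · rw [Set.indicator_of_notMem hw]; exact ENNReal.zero_ne_top

theorem lintegral_sum_sq {d : ℕ} (hd : 0 < d) {f : ℝ → ENNReal} (hf : Measurable f) :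
    ∫⁻ q : Fin d → ℝ, f (∑ j, q j ^ 2) = ∫⁻ w, sqNormDensity d w * f w := by
  have : Nonempty (Fin d) := ⟨⟨0, hd⟩⟩
  have h1 := (PiLp.volume_preserving_toLp (Fin d)).lintegral_comp
    (f := fun x : EuclideanSpace ℝ (Fin d) => f (‖x‖ ^ 2)) (by fun_prop)
  simp only [EuclideanSpace.real_norm_sq_eq] at h1
  rw [h1]
  simp only [← EuclideanSpace.real_norm_sq_eq]
  rw [lintegral_norm_sq _ hf, finrank_euclideanSpace_fin, ← sqNormConst,
    ← lintegral_const_mul _ (by fun_prop), ← lintegral_indicator measurableSet_Ioi]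
  refine lintegral_congr fun w => ?_
  simp only [sqNormDensity, Set.indicator_apply]
  split_ifs <;> ring

theorem map_sq_volume :
    (volume : Measure ℝ).map (fun x => x ^ 2) = volume.withDensity (sqNormDensity 1) := by
  refine Measure.ext_of_lintegral _ fun f hf => ?_
  rw [lintegral_map hf (by fun_prop),
    lintegral_withDensity_eq_lintegral_mul _ (measurable_sqNormDensity 1) hf]
  have h := (volume_preserving_funUnique (Fin 1) ℝ).lintegral_comp
    (f := fun x => f (x ^ 2)) (by fun_prop)
  have h2 := lintegral_sum_sq one_pos hf
  rw [← h]
  simp only [Fin.sum_univ_one] at h2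
  exact h2

theorem lintegral_pi_sq {n : ℕ} {F : (Fin n → ℝ) → ENNReal} (hF : Measurable F) :
    ∫⁻ p : Fin n → ℝ, F (fun i => p i ^ 2) =
      ∫⁻ w, (∏ i, sqNormDensity 1 (w i)) * F w := by
  have hs : SigmaFinite ((volume : Measure ℝ).withDensity (sqNormDensity 1)) :=
    SigmaFinite.withDensity_of_ne_top (ae_of_all _ (sqNormDensity_ne_top 1))
  have hs' : ∀ _ : Fin n, SigmaFinite ((volume : Measure ℝ).map fun x => x ^ 2) := fun _ => by
    rw [map_sq_volume]; exact hs
  have h := Measure.pi_map_pi (ι := Fin n) (μ := fun _ => (volume : Measure ℝ))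
    (f := fun _ x => x ^ 2) (hμ := hs') (fun _ => by fun_prop)
  simp only [map_sq_volume] at h
  rw [pi_withDensity _ (measurable_sqNormDensity 1)] at h
  have h2 := lintegral_map (μ := Measure.pi fun _ : Fin n => (volume : Measure ℝ)) hF
    (g := fun x i => x i ^ 2) (by fun_prop)
  have hg : Measurable fun w : Fin n → ℝ => ∏ i, sqNormDensity 1 (w i) :=
    Finset.measurable_prod _ fun i _ => (measurable_sqNormDensity 1).comp (measurable_pi_apply i)
  rw [h, lintegral_withDensity_eq_lintegral_mul _ hg hF] at h2
  exact h2.symm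

/-- The law of the squared norms of an orthogonal decomposition `ℝ^d × ℝ^n`. -/
theorem lintegral_prod_sq {n d : ℕ} (hd : 0 < d) {H : (Fin (n + 1) → ℝ) → ENNReal}
    (hH : Measurable H) :
    ∫⁻ p : (Fin n → ℝ) × (Fin d → ℝ), H (Fin.cons (∑ j, p.2 j ^ 2) fun i => p.1 i ^ 2) =
      sqNormConst d * sqNormConst 1 ^ n * ∫⁻ w in {w : Fin (n + 1) → ℝ | ∀ k, 0 < w k},
        ENNReal.ofReal (w 0 ^ (((d : ℝ) - 1) / 2) / √(∏ k, w k)) * H w := by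
  have hHc : Measurable fun p : ℝ × (Fin n → ℝ) => H (Fin.cons p.1 p.2) := hH.comp measurable_cons
  have hm : Measurable fun p : (Fin n → ℝ) × (Fin d → ℝ) =>
      H (Fin.cons (∑ j, p.2 j ^ 2) fun i => p.1 i ^ 2) :=
    hHc.comp (f := fun p : (Fin n → ℝ) × (Fin d → ℝ) => (∑ j, p.2 j ^ 2, fun i => p.1 i ^ 2))
      (by fun_prop)
  have hg : ∀ n, Measurable fun w : Fin n → ℝ => ∏ i, sqNormDensity 1 (w i) := fun n =>
    Finset.measurable_prod _ fun i _ => (measurable_sqNormDensity 1).comp (measurable_pi_apply i)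
  rw [Measure.volume_eq_prod, lintegral_prod_symm _ hm.aemeasurable]
  have h1 : ∀ s : ℝ, ∫⁻ x : Fin n → ℝ, H (Fin.cons s fun i => x i ^ 2) =
      ∫⁻ w, (∏ i, sqNormDensity 1 (w i)) * H (Fin.cons s w) := fun s =>
    lintegral_pi_sq (hHc.comp measurable_prodMk_left)
  simp_rw [h1]
  have hm2 : Measurable fun p : ℝ × (Fin n → ℝ) =>
      (∏ i, sqNormDensity 1 (p.2 i)) * H (Fin.cons p.1 p.2) :=
    ((hg n).comp measurable_snd).mul hHc
  rw [lintegral_sum_sq hd hm2.lintegral_prod_right']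
  have h2 : ∫⁻ w : Fin (n + 1) → ℝ, sqNormDensity d (w 0) *
      ((∏ i : Fin n, sqNormDensity 1 (w i.succ)) * H w) =
      ∫⁻ a, sqNormDensity d a * ∫⁻ x : Fin n → ℝ,
        (∏ i, sqNormDensity 1 (x i)) * H (Fin.cons a x) := by
    rw [volume_pi, lintegral_pi_succ]
    · refine lintegral_congr fun a => ?_
      have hm3 : Measurable fun x : Fin n → ℝ =>
          (∏ i, sqNormDensity 1 (x i)) * H (Fin.cons a x) := hm2.comp measurable_prodMk_left
      rw [← volume_pi, ← lintegral_const_mul _ hm3]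
      simp
    · refine ((measurable_sqNormDensity d).comp (measurable_pi_apply 0)).mul (Measurable.mul ?_ hH)
      exact Finset.measurable_prod _ fun i _ =>
        (measurable_sqNormDensity 1).comp (measurable_pi_apply i.succ)
  rw [← h2, ← lintegral_const_mul _ (by fun_prop), ← lintegral_indicator]
  · refine lintegral_congr fun w => ?_
    by_cases hw : ∀ k, 0 < w k
    · rw [Set.indicator_of_mem (by exact hw)]
      have h3 : ∀ d k, sqNormDensity d (w k) =
          sqNormConst d * ENNReal.ofReal (w k ^ (((d : ℝ) - 2) / 2)) := fun d k =>
        Set.indicator_of_mem (Set.mem_Ioi.2 (hw k)) _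
      simp_rw [h3]
      rw [prod_mul_distrib, prod_const, card_univ, Fintype.card_fin,
        ← ENNReal.ofReal_prod_of_nonneg (fun i _ => Real.rpow_nonneg (hw _).le _)]
      -- Writing `(d - 2)/2` as `(d - 1)/2 - 1/2` gives `w 0` the same inverse square root as the
      -- one-dimensional components.
      have h4 : w 0 ^ (((d : ℝ) - 1) / 2) / √(∏ k, w k) =
          w 0 ^ (((d : ℝ) - 2) / 2) * ∏ i : Fin n, w i.succ ^ (((1 : ℕ) - 2 : ℝ) / 2) := by
        rw [Real.finsetProd_rpow _ _ (fun i _ => (hw _).le), Real.sqrt_eq_rpow,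
          Fin.prod_univ_succ, Real.mul_rpow (hw 0).le (prod_nonneg fun i _ => (hw _).le),
          div_eq_mul_inv, mul_inv, ← Real.rpow_neg (hw 0).le,
          ← Real.rpow_neg (prod_nonneg fun i _ => (hw _).le), ← mul_assoc, ← Real.rpow_add (hw 0)]
        norm_num
        left
        congr 1
        ring
      rw [h4, ENNReal.ofReal_mul (Real.rpow_nonneg (hw 0).le _)]
      ring
    · rw [Set.indicator_of_notMem (by exact hw)]
      push Not at hw
      obtain ⟨k, hk⟩ := hw
      have h3 : ∀ d, sqNormDensity d (w k) = 0 := fun d =>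
        Set.indicator_of_notMem (by simpa using hk) _
      induction k using Fin.cases with
      | zero => rw [h3, zero_mul]
      | succ k => rw [prod_eq_zero (mem_univ k) (h3 1), zero_mul, mul_zero]
  · simp only [Set.ofPred_forall]
    exact MeasurableSet.iInter fun k => measurableSet_lt measurable_const (measurable_pi_apply k)

/-- An orthonormal family extends to an orthonormal basis. -/
theorem exists_orthonormalBasis_sum {N d M : ℕ} (hM : N + d = M)
    {v : Fin N → EuclideanSpace ℝ (Fin M)} (hv : Orthonormal ℝ v) :
    ∃ b : OrthonormalBasis (Fin N ⊕ Fin d) ℝ (EuclideanSpace ℝ (Fin M)),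
      ∀ i, b (Sum.inl i) = v i := by
  have hcard : Module.finrank ℝ (EuclideanSpace ℝ (Fin M)) = Fintype.card (Fin N ⊕ Fin d) := by
    simp [hM]
  have hs : Orthonormal ℝ ((Set.range Sum.inl).domRestrict
      (Sum.elim v 0 : Fin N ⊕ Fin d → EuclideanSpace ℝ (Fin M))) := by
    have hch : ∀ x : Set.range (Sum.inl : Fin N → Fin N ⊕ Fin d), Sum.inl x.2.choose = x.1 :=
      fun x => x.2.choose_spec
    have := hv.comp (fun x : Set.range (Sum.inl : Fin N → Fin N ⊕ Fin d) => x.2.choose)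
      (fun x y hxy => Subtype.ext (by rw [← hch x, ← hch y]; exact congrArg _ hxy))
    convert this using 1
    funext x
    rw [Set.domRestrict_apply, ← hch x]
    simp
  obtain ⟨b, hb⟩ := hs.exists_orthonormalBasis_extension_of_card_eq hcard
  exact ⟨b, fun i => by rw [hb _ ⟨i, rfl⟩]; rfl⟩

theorem measurePreserving_coords {N d M : ℕ}
    (b : OrthonormalBasis (Fin N ⊕ Fin d) ℝ (EuclideanSpace ℝ (Fin M))) :
    MeasurePreserving (fun y : EuclideanSpace ℝ (Fin M) =>
      ((fun i => ⟪b (Sum.inl i), y⟫, fun j => ⟪b (Sum.inr j), y⟫) :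
        (Fin N → ℝ) × (Fin d → ℝ))) := by
  have h := (volume_measurePreserving_sumPiEquivProdPi fun _ : Fin N ⊕ Fin d => ℝ).comp
    ((PiLp.volume_preserving_ofLp (Fin N ⊕ Fin d)).comp b.measurePreserving_repr)
  suffices e : (fun y : EuclideanSpace ℝ (Fin M) =>
      ((fun i => ⟪b (Sum.inl i), y⟫, fun j => ⟪b (Sum.inr j), y⟫) :
        (Fin N → ℝ) × (Fin d → ℝ))) = _ by rw [e]; exact h
  funext y
  simp [MeasurableEquiv.sumPiEquivProdPi, Equiv.sumPiEquivProdPi, b.repr_apply_apply]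

theorem ae_inner_ne_zero {M : ℕ} {v : EuclideanSpace ℝ (Fin M)} (hv : v ≠ 0) :
    ∀ᵐ y : EuclideanSpace ℝ (Fin M), ⟪v, y⟫ ≠ 0 := by
  have h := Measure.addHaar_submodule (volume : Measure (EuclideanSpace ℝ (Fin M)))
    (LinearMap.ker (innerSL ℝ v).toLinearMap) (fun h => hv ?_)
  · rw [ae_iff]
    convert h using 2
    ext y
    simp
  · have : v ∈ LinearMap.ker (innerSL ℝ v).toLinearMap := h ▸ Submodule.mem_top
    simpa using this

/-- The transition kernel of the eigenvalues when a row, distributed according to Lebesgue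
measure, is added. -/
theorem lintegral_gramEig_cons {N M : ℕ} (hNM : N < M)
    (X : Fin N → EuclideanSpace ℝ (Fin M)) (hmono : StrictMono (gramEig X))
    (hpos : ∀ i, 0 < gramEig X i) {F : (Fin (N + 1) → ℝ) → ENNReal} (hF : Measurable F) :
    ∫⁻ y : EuclideanSpace ℝ (Fin M),
        F (gramEig (Fin.cons y X : Fin (N + 1) → EuclideanSpace ℝ (Fin M))) =
      sqNormConst (M - N) * sqNormConst 1 ^ N *
        ∫⁻ x in interlacing 1 0 (Fin.cons 0 (gramEig X) : Fin (N + 1) → ℝ),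
          ENNReal.ofReal (addRowDensity (((M : ℝ) - N - 1) / 2) (gramEig X) x) * F x := by
  obtain ⟨u, v, hvo, hu, hv⟩ := exists_singularVectors X hpos
  set d := M - N with hd
  have hdpos : 0 < d := Nat.sub_pos_of_lt hNM
  obtain ⟨b, hb⟩ := exists_orthonormalBasis_sum (d := d) (by omega) hvo
  have ha := strictMono_cons_zero hmono hpos
  let j0 : Fin d := ⟨0, hdpos⟩
  -- A representative row with squared components `w`. For positive `w` the new eigenvalues depend
  -- on the row only through them, so `H` is a measurable substitute for the map from weights to
  -- roots.
  let Y : (Fin (N + 1) → ℝ) → EuclideanSpace ℝ (Fin M) := fun w =>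
    √(w 0) • b (Sum.inr j0) + ∑ i : Fin N, √(w i.succ) • b (Sum.inl i)
  let H : (Fin (N + 1) → ℝ) → ENNReal := fun w =>
    F (gramEig (Fin.cons (Y w) X : Fin (N + 1) → EuclideanSpace ℝ (Fin M)))
  have hH : Measurable H := by
    refine hF.comp (measurable_gramEig.comp (measurable_cons.comp
      (f := fun w => (Y w, X)) (Measurable.prodMk ?_ measurable_const)))
    fun_prop
  have hnorm : ∀ y : EuclideanSpace ℝ (Fin M), ‖y‖ ^ 2 - ∑ i, ⟪v i, y⟫ ^ 2 =
      ∑ j, ⟪b (Sum.inr j), y⟫ ^ 2 := by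
    intro y
    rw [← b.sum_sq_norm_inner_right, Fintype.sum_sum_type]
    simp only [hb, Real.norm_eq_abs, sq_abs]
    ring
  have hroot : ∀ w : Fin (N + 1) → ℝ, (∀ k, 0 < w k) →
      ∃ x ∈ interlacing 1 0 (Fin.cons 0 (gramEig X) : Fin (N + 1) → ℝ),
        weight 1 0 (Fin.cons 0 (gramEig X)) x = w := by
    intro w hw
    have := weight_image (β := 1) (ε := 0) ha le_rfl (fun k => by simp)
    rw [Set.ext_iff] at this
    exact (this w).2 hw
  have hYi : ∀ w i, ⟪v i, Y w⟫ = √(w i.succ) := by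
    intro w i
    simp only [Y, ← hb, inner_add_right, inner_sum, real_inner_smul_right,
      orthonormal_iff_ite.1 b.orthonormal]
    simp
  have hYj : ∀ w j, ⟪b (Sum.inr j), Y w⟫ = if j = j0 then √(w 0) else 0 := by
    intro w j
    simp only [Y, inner_add_right, inner_sum, real_inner_smul_right,
      orthonormal_iff_ite.1 b.orthonormal]
    simp
  have hHx : ∀ x ∈ interlacing 1 0 (Fin.cons 0 (gramEig X) : Fin (N + 1) → ℝ),
      H (weight 1 0 (Fin.cons 0 (gramEig X)) x) = F x := by
    intro x hx
    set w := weight 1 0 (Fin.cons 0 (gramEig X)) x with hw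
    have hwpos : ∀ k, 0 < w k := weight_pos ha (fun k => by simp) hx
    refine congrArg F (gramEig_cons X _ hmono hpos u v hu hv x hx ?_)
    rw [← hw, hnorm]
    simp_rw [hYi, hYj]
    funext k
    induction k using Fin.cases with
    | zero => simp [Real.sq_sqrt (hwpos 0).le]
    | succ k => simp [Real.sq_sqrt (hwpos k.succ).le]
  have hae : ∀ᵐ y : EuclideanSpace ℝ (Fin M),
      F (gramEig (Fin.cons y X : Fin (N + 1) → EuclideanSpace ℝ (Fin M))) =
      H (Fin.cons (∑ j, ⟪b (Sum.inr j), y⟫ ^ 2) fun i => ⟪b (Sum.inl i), y⟫ ^ 2) := by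
    have h0 : ∀ i, b i ≠ 0 := fun i => b.orthonormal.ne_zero i
    -- Almost every row avoids the coordinate hyperplanes, so its weights are positive and come from
    -- interlacing roots.
    filter_upwards [ae_inner_ne_zero (h0 (Sum.inr j0)),
      ae_all_iff.2 fun i => ae_inner_ne_zero (h0 (Sum.inl i))] with y hy0 hyi
    have hwpos : ∀ k, 0 < (Fin.cons (∑ j, ⟪b (Sum.inr j), y⟫ ^ 2)
        fun i => ⟪b (Sum.inl i), y⟫ ^ 2 : Fin (N + 1) → ℝ) k := by
      intro k
      induction k using Fin.cases with
      | zero =>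
        exact sum_pos' (fun j _ => sq_nonneg _) ⟨j0, mem_univ _, by positivity⟩
      | succ k =>
        have := hyi k
        simp only [Fin.cons_succ]
        positivity
    obtain ⟨x, hx, hxw⟩ := hroot _ hwpos
    rw [← hxw, hHx x hx]
    refine congrArg F (gramEig_cons X _ hmono hpos u v hu hv x hx ?_)
    rw [hxw, hnorm]
    simp_rw [hb]
  have hcm : Measurable fun p : (Fin N → ℝ) × (Fin d → ℝ) =>
      H (Fin.cons (∑ j, p.2 j ^ 2) fun i => p.1 i ^ 2) :=
    (hH.comp measurable_cons).comp
      (f := fun p : (Fin N → ℝ) × (Fin d → ℝ) => (∑ j, p.2 j ^ 2, fun i => p.1 i ^ 2))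
      (by fun_prop)
  rw [lintegral_congr_ae hae, (measurePreserving_coords b).lintegral_comp hcm,
    lintegral_prod_sq hdpos hH, lintegral_addRowDensity _ hmono hpos]
  congr 1
  have hcast : ((d : ℝ) - 1) / 2 = ((M : ℝ) - N - 1) / 2 := by
    rw [hd, Nat.cast_sub hNM.le]
  rw [hcast]
  refine setLIntegral_congr_fun measurableSet_interlacing fun x hx => ?_
  rw [hHx x hx]

end AddRowIntegral

/-! ### Eigenvalues of Lebesgue distributed data -/

section NullWishart

open Finset

variable {N M : ℕ}

/-- The open Weyl chamber of ordered positive eigenvalues. -/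
def chamber (N : ℕ) : Set (Fin N → ℝ) := {l | (∀ i, 0 < l i) ∧ StrictMono l}

/-- The eigenvalue density of the null Wishart ensemble relative to Lebesgue measure on data. -/
def wishartDensity (N M : ℕ) (l : Fin N → ℝ) : ℝ :=
  absVdm l * (∏ i, l i) ^ (((M : ℝ) - N - 1) / 2)

theorem measurable_absVdm : Measurable (absVdm : (Fin N → ℝ) → ℝ) := by
  unfold absVdm
  simp_rw [Matrix.det_vandermonde]
  fun_prop

theorem measurable_wishartDensity : Measurable (wishartDensity N M) :=
  measurable_absVdm.mul (Measurable.pow_const (by fun_prop) _)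

theorem measurableSet_chamber : MeasurableSet (chamber N) := by
  unfold chamber StrictMono
  measurability

theorem measurableSet_mem_interlacing_cons :
    MeasurableSet {p : (Fin N → ℝ) × (Fin (N + 1) → ℝ) |
      p.2 ∈ interlacing 1 0 (Fin.cons 0 p.1 : Fin (N + 1) → ℝ)} := by
  have hc : ∀ i, Measurable fun p : (Fin N → ℝ) × (Fin (N + 1) → ℝ) =>
      (Fin.cons 0 p.1 : Fin (N + 1) → ℝ) i := by
    intro i
    induction i using Fin.cases with
    | zero => simp
    | succ i => simp only [Fin.cons_succ]; fun_prop
  have hx : ∀ i, Measurable fun p : (Fin N → ℝ) × (Fin (N + 1) → ℝ) => p.2 i := fun i => by fun_prop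
  simp only [interlacing, zero_mul, sub_zero, Set.mem_ofPred_eq]
  refine (MeasurableSet.inter ?_ ?_).congr ?_ (s := {p | ∀ i j, i < j → p.2 i <
    (Fin.cons 0 p.1 : Fin (N + 1) → ℝ) j} ∩ {p | ∀ i, (Fin.cons 0 p.1 : Fin (N + 1) → ℝ) i < p.2 i})
  · simp only [Set.ofPred_forall]
    exact MeasurableSet.iInter fun i => MeasurableSet.iInter fun j => MeasurableSet.iInter fun _ =>
      measurableSet_lt (hx i) (hc j)
  · simp only [Set.ofPred_forall]
    exact MeasurableSet.iInter fun i => measurableSet_lt (hc i) (hx i)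
  · ext p
    simp

theorem measurable_addRowDensity (e : ℝ) : Measurable fun p : (Fin N → ℝ) × (Fin (N + 1) → ℝ) =>
    addRowDensity e p.1 p.2 := by
  unfold addRowDensity
  have := (measurable_absVdm (N := N + 1)).comp
    (measurable_snd : Measurable (Prod.snd : (Fin N → ℝ) × (Fin (N + 1) → ℝ) → _))
  refine Measurable.div (this.mul (Measurable.pow_const ?_ _)) (Measurable.sqrt ?_) <;> fun_prop

/-- The interlacing relation seen from the two sides. -/
theorem mem_interlacing_cons_iff (l : Fin N → ℝ) (x : Fin (N + 1) → ℝ) :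
    (l ∈ chamber N ∧ x ∈ interlacing 1 0 (Fin.cons 0 l : Fin (N + 1) → ℝ)) ↔
      x ∈ chamber (N + 1) ∧ l ∈ interlacing (x (Fin.last N)) 1 (fun k => x k.castSucc) := by
  constructor
  · rintro ⟨⟨hl0, hl⟩, hx⟩
    have hmono := strictMono_of_mem_interlacing hx
    have h2 : ∀ i : Fin N, l i < x i.succ := fun i => by simpa using hx.2.1 i.succ
    refine ⟨⟨pos_of_mem_interlacing_cons hl0 hx, hmono⟩, fun i j hij => ?_, fun i => ?_, fun i => ?_⟩
    · exact (h2 i).trans_le (hmono.monotone (Fin.succ_le_castSucc_iff.2 hij))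
    · simpa using hx.1 i.castSucc i.succ Fin.castSucc_lt_succ
    · have := (h2 i).trans_le (hmono.monotone (Fin.le_last _))
      linarith
  · rintro ⟨⟨hx0, hx⟩, hl⟩
    refine ⟨⟨fun i => (hx0 _).trans (hl.2.1 i), strictMono_of_mem_interlacing hl⟩,
      fun i j hij => ?_, fun i => ?_, fun i => by simp⟩
    · induction j using Fin.cases with
      | zero => exact absurd hij (by simp)
      | succ j =>
        rw [Fin.cons_succ]
        exact (hx.monotone (show i ≤ j.castSucc from Nat.lt_succ_iff.1 hij)).trans_lt (hl.2.1 j)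
    · induction i using Fin.cases with
      | zero => simpa using hx0 0
      | succ i =>
        rw [Fin.cons_succ]
        by_cases h : (i : ℕ) + 1 < N
        · exact hl.1 i ⟨i + 1, h⟩ (by simp [Fin.lt_def])
        · have : i.succ = Fin.last N := Fin.ext (by have := i.2; simp; omega)
          rw [this]
          have := hl.2.2 i
          linarith

/-- The powers of `∏ l` cancel exactly, and the extra `√(∏ x)` lowers the exponent by `1/2`. What
remains in `l` is the Dixon–Anderson integrand. -/
theorem wishartDensity_mul_addRowDensity {l : Fin N → ℝ} {x : Fin (N + 1) → ℝ}
    (hl : l ∈ chamber N) (hx : ∀ i, 0 < x i) :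
    wishartDensity N M l * addRowDensity (((M : ℝ) - N - 1) / 2) l x =
      wishartDensity (N + 1) M x * (absVdm l / √(∏ k, ∏ i, |x k - l i|)) := by
  have hpl : 0 < ∏ i, l i := prod_pos fun i _ => hl.1 i
  have hpx : 0 < ∏ i, x i := prod_pos fun i _ => hx i
  have hcomm : ∏ k, ∏ i, |l k - x i| = ∏ k, ∏ i, |x k - l i| := by
    rw [prod_comm]
    simp_rw [abs_sub_comm]
  rw [wishartDensity, wishartDensity, addRowDensity, hcomm, Real.sqrt_mul hpx.le,
    Real.div_rpow hpx.le hpl.le,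
    show ((M : ℝ) - (N + 1 : ℕ) - 1) / 2 = ((M : ℝ) - N - 1) / 2 - 1 / 2 by push_cast; ring,
    Real.rpow_sub hpx _ (1 / 2), ← Real.sqrt_eq_rpow]
  have := (Real.rpow_pos_of_pos hpl (((M : ℝ) - N - 1) / 2)).ne'
  field_simp

/-- The law of the ordered eigenvalues of the Gram matrix of Lebesgue distributed rows. -/
theorem exists_lintegral_gramEig (hNM : N ≤ M) :
    ∃ K : ENNReal, ∀ F : (Fin N → ℝ) → ENNReal, Measurable F →
      ∫⁻ X : Fin N → EuclideanSpace ℝ (Fin M), F (gramEig X) =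
        K * ∫⁻ l in chamber N, ENNReal.ofReal (wishartDensity N M l) * F l := by
  induction N with
  | zero =>
    refine ⟨1, fun F _ => ?_⟩
    have h1 : chamber 0 = Set.univ := by
      ext l; simp [chamber, Subsingleton.strictMono]
    rw [h1, Measure.restrict_univ, one_mul, volume_pi, volume_pi, Measure.pi_of_empty,
      Measure.pi_of_empty, lintegral_dirac, lintegral_dirac]
    simp only [wishartDensity, absVdm, Matrix.det_fin_zero, Finset.univ_eq_empty, prod_empty,
      Real.one_rpow, abs_one, mul_one, ENNReal.ofReal_one, one_mul]
    exact congrArg F (Subsingleton.elim _ _)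
  | succ N ih =>
    obtain ⟨K, hK⟩ := ih (by omega)
    refine ⟨sqNormConst (M - N) * sqNormConst 1 ^ N * K * dixonAndersonConst N, fun F hF => ?_⟩
    -- The induction hypothesis, tested on the complement of the chamber, supplies the distinctness
    -- and positivity that the kernel requires.
    have hgood : ∀ᵐ X : Fin N → EuclideanSpace ℝ (Fin M), gramEig X ∈ chamber N := by
      have h := hK ((chamber N)ᶜ.indicator 1)
        (measurable_one.indicator measurableSet_chamber.compl)
      have h0 : ∫⁻ l in chamber N, ENNReal.ofReal (wishartDensity N M l) *
          (chamber N)ᶜ.indicator 1 l = 0 := by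
        rw [setLIntegral_congr_fun (g := 0) measurableSet_chamber fun l hl => by simp [hl]]
        simp
      have hm : Measurable fun X : Fin N → EuclideanSpace ℝ (Fin M) =>
          (chamber N)ᶜ.indicator (1 : (Fin N → ℝ) → ENNReal) (gramEig X) :=
        (measurable_one.indicator measurableSet_chamber.compl).comp measurable_gramEig
      rw [h0, mul_zero, lintegral_eq_zero_iff hm] at h
      filter_upwards [h] with X hX
      by_contra hc
      simp [Set.indicator_of_mem (show gramEig X ∈ (chamber N)ᶜ from hc)] at hX
    set e : ℝ := ((M : ℝ) - N - 1) / 2 with he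
    let J : (Fin N → ℝ) × (Fin (N + 1) → ℝ) → ENNReal :=
      {p | p.2 ∈ interlacing 1 0 (Fin.cons 0 p.1 : Fin (N + 1) → ℝ)}.indicator
        fun p => ENNReal.ofReal (addRowDensity e p.1 p.2) * F p.2
    have hJ : Measurable J := Measurable.indicator
      ((measurable_addRowDensity e).ennreal_ofReal.mul (hF.comp measurable_snd))
      measurableSet_mem_interlacing_cons
    have hstep : ∫⁻ X : Fin (N + 1) → EuclideanSpace ℝ (Fin M), F (gramEig X) =
        sqNormConst (M - N) * sqNormConst 1 ^ N *
          ∫⁻ X : Fin N → EuclideanSpace ℝ (Fin M), ∫⁻ x, J (gramEig X, x) := by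
      have hFm : Measurable fun p : EuclideanSpace ℝ (Fin M) × (Fin N → EuclideanSpace ℝ (Fin M)) =>
          F (gramEig (Fin.cons p.1 p.2 : Fin (N + 1) → EuclideanSpace ℝ (Fin M))) :=
        hF.comp (measurable_gramEig.comp measurable_cons)
      have hFg : Measurable fun X : Fin (N + 1) → EuclideanSpace ℝ (Fin M) => F (gramEig X) :=
        hF.comp measurable_gramEig
      have hJm : Measurable fun X : Fin N → EuclideanSpace ℝ (Fin M) =>
          ∫⁻ x, J (gramEig X, x) :=
        hJ.lintegral_prod_right'.comp measurable_gramEig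
      rw [volume_pi, lintegral_pi_succ _ hFg,
        lintegral_lintegral_swap hFm.aemeasurable, ← volume_pi, ← lintegral_const_mul _ hJm]
      refine lintegral_congr_ae ?_
      filter_upwards [hgood] with X hX
      rw [lintegral_gramEig_cons (by omega) X hX.2 hX.1 hF, ← lintegral_indicator
        measurableSet_interlacing]
      rfl
    rw [hstep, hK (fun l => ∫⁻ x, J (l, x)) hJ.lintegral_prod_right', mul_assoc _ K,
      mul_assoc _ (K * _), mul_assoc K]
    congr 2
    have hWF : Measurable ((chamber (N + 1)).indicator fun x =>
        ENNReal.ofReal (wishartDensity (N + 1) M x) * F x) :=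
      Measurable.indicator (measurable_wishartDensity.ennreal_ofReal.mul hF) measurableSet_chamber
    rw [← lintegral_indicator measurableSet_chamber, ← lintegral_indicator measurableSet_chamber,
      ← lintegral_const_mul _ hWF]
    have hw : Measurable fun p : (Fin N → ℝ) × (Fin (N + 1) → ℝ) =>
        (chamber N).indicator (fun l => ENNReal.ofReal (wishartDensity N M l)) p.1 * J p :=
      (Measurable.comp (Measurable.indicator measurable_wishartDensity.ennreal_ofReal
        measurableSet_chamber) measurable_fst).mul hJ
    calc ∫⁻ l, (chamber N).indicator (fun l => ENNReal.ofReal (wishartDensity N M l) *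
          ∫⁻ x, J (l, x)) l
        = ∫⁻ l, ∫⁻ x, (chamber N).indicator (fun l => ENNReal.ofReal (wishartDensity N M l)) l *
            J (l, x) := by
          refine lintegral_congr fun l => ?_
          have hJl : Measurable fun x => J (l, x) := hJ.comp measurable_prodMk_left
          rw [lintegral_const_mul _ hJl]
          by_cases hl : l ∈ chamber N <;> simp [hl]
      _ = ∫⁻ x, ∫⁻ l, (chamber N).indicator (fun l => ENNReal.ofReal (wishartDensity N M l)) l *
            J (l, x) := lintegral_lintegral_swap hw.aemeasurable
      _ = _ := by
          refine lintegral_congr fun x => ?_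
          -- Viewing interlacing from the side of `x` makes the set of admissible `l` the domain of
          -- the Dixon–Anderson integral, so that integrating out `l` leaves a constant.
          have hpt : ∀ l, (chamber N).indicator
              (fun l => ENNReal.ofReal (wishartDensity N M l)) l * J (l, x) =
              (chamber (N + 1)).indicator (fun x =>
                ENNReal.ofReal (wishartDensity (N + 1) M x) * F x) x *
              (interlacing (x (Fin.last N)) 1 fun k => x k.castSucc).indicator (fun l =>
                ENNReal.ofReal (absVdm l / √(∏ k, ∏ i, |x k - l i|))) l := by
            intro l
            have hiff := mem_interlacing_cons_iff l x
            by_cases h : x ∈ chamber (N + 1) ∧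
                l ∈ interlacing (x (Fin.last N)) 1 (fun k => x k.castSucc)
            · have h' := hiff.2 h
              rw [Set.indicator_of_mem h'.1, Set.indicator_of_mem h.1, Set.indicator_of_mem h.2]
              simp only [J]
              rw [Set.indicator_of_mem (by exact h'.2), ← mul_assoc, ← ENNReal.ofReal_mul
                (by unfold wishartDensity absVdm
                    have := prod_pos fun i (_ : i ∈ univ) => h'.1.1 i
                    positivity),
                wishartDensity_mul_addRowDensity h'.1 h.1.1, ENNReal.ofReal_mul
                (by unfold wishartDensity absVdm
                    have := prod_pos fun i (_ : i ∈ univ) => h.1.1 i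
                    positivity)]
              ring
            · have h' := mt hiff.1 h
              rw [not_and_or] at h h'
              have e1 : (chamber N).indicator
                  (fun l => ENNReal.ofReal (wishartDensity N M l)) l * J (l, x) = 0 := by
                rcases h' with h' | h'
                · rw [Set.indicator_of_notMem h', zero_mul]
                · simp only [J]
                  exact mul_eq_zero_of_right _ (Set.indicator_of_notMem (by exact h') _)
              rw [e1]
              rcases h with h | h
              · rw [Set.indicator_of_notMem h, zero_mul]
              · rw [Set.indicator_of_notMem h, mul_zero]
          simp_rw [hpt]
          by_cases hx : x ∈ chamber (N + 1)
          · have hm : Measurable fun l : Fin N → ℝ =>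
                ENNReal.ofReal (absVdm l / √(∏ k, ∏ i, |x k - l i|)) :=
              (measurable_absVdm.div (Measurable.sqrt (by fun_prop))).ennreal_ofReal
            rw [lintegral_const_mul _ (hm.indicator measurableSet_interlacing),
              lintegral_indicator measurableSet_interlacing, lintegral_dixonAnderson x hx.2,
              mul_comm]
          · simp [hx]

end NullWishart

/-! ### Rotation invariant measure on the sphere -/

section SphereMeasure

open Set Module Pointwise

variable {E : Type*} [NormedAddCommGroup E] [InnerProductSpace ℝ E] [FiniteDimensional ℝ E]
  [MeasurableSpace E] [BorelSpace E]

variable (E) in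
/-- The surface measure of the unit sphere, as a measure on the ambient space. -/
def sphereMeasure : Measure E := (volume : Measure E).toSphere.map (↑)

instance : IsFiniteMeasure (sphereMeasure E) := by
  unfold sphereMeasure; infer_instance

theorem sphereMeasure_ne_zero [Nontrivial E] : sphereMeasure E ≠ 0 := by
  unfold sphereMeasure
  rw [Ne, Measure.map_eq_zero_iff (by fun_prop)]
  exact (volume : Measure E).toSphere_ne_zero

theorem ae_norm_eq_one_sphereMeasure : ∀ᵐ x ∂sphereMeasure E, ‖x‖ = 1 := by
  unfold sphereMeasure
  rw [ae_map_iff (by fun_prop) (measurableSet_eq_fun (by fun_prop) (by fun_prop))]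
  exact Filter.Eventually.of_forall fun x => by simp

theorem sphereMeasure_apply {s : Set E} (hs : MeasurableSet s) :
    sphereMeasure E s = finrank ℝ E * volume (Ioo (0 : ℝ) 1 • (s ∩ Metric.sphere 0 1)) := by
  unfold sphereMeasure
  rw [Measure.map_apply (by fun_prop) hs, Measure.toSphere_apply' _ (hs.preimage (by fun_prop)),
    Subtype.image_preimage_coe, inter_comm]

/-- The surface measure of a set is a multiple of the volume of the cone over it, and an isometry
preserves both cones and volume. -/
theorem measurePreserving_sphereMeasure (R : E ≃ₗᵢ[ℝ] E) :
    MeasurePreserving R (sphereMeasure E) (sphereMeasure E) := by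
  refine ⟨R.continuous.measurable, ?_⟩
  ext s hs
  rw [Measure.map_apply R.continuous.measurable hs, sphereMeasure_apply hs,
    sphereMeasure_apply (hs.preimage R.continuous.measurable)]
  have : Ioo (0 : ℝ) 1 • (R ⁻¹' s ∩ Metric.sphere 0 1) =
      R ⁻¹' (Ioo (0 : ℝ) 1 • (s ∩ Metric.sphere 0 1)) := by
    ext x
    simp only [mem_preimage, mem_smul]
    constructor
    · rintro ⟨r, hr, y, hy, rfl⟩
      exact ⟨r, hr, R y, ⟨hy.1, by simpa using hy.2⟩, by simp⟩
    · rintro ⟨r, hr, y, hy, h⟩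
      refine ⟨r, hr, R.symm y, ⟨by simpa using hy.1, by simpa using hy.2⟩, ?_⟩
      rw [← map_smul, h, R.symm_apply_apply]
  have hR : MeasurePreserving R volume volume := R.measurePreserving
  rw [this, hR.measure_preimage_emb R.toHomeomorph.measurableEmbedding]

end SphereMeasure

/-! ### The spiked Gaussian density -/

section Gaussian

open Finset RealInnerProductSpace MatrixOrder

variable {N M : ℕ}

/-- The roots of the characteristic polynomial single out one eigenvector with eigenvalue `1 + τ`.
All the others have eigenvalue `1`, so the matrix is the identity plus a rank-one term. -/
theorem exists_spike_direction {S : Matrix (Fin N) (Fin N) ℝ} {τ : ℝ}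
    (hS : IsRankOneSpike S τ) : ∃ v : EuclideanSpace ℝ (Fin N), ‖v‖ = 1 ∧
      ∀ x, Matrix.toEuclideanCLM (𝕜 := ℝ) S x = x + (τ * ⟪v, x⟫) • v := by
  classical
  have hA : S.IsHermitian := by
    rw [Matrix.IsHermitian, Matrix.conjTranspose_eq_transpose_of_trivial]; exact hS.1
  obtain ⟨u, hu⟩ := exists_eigenbasis hA
  have hchar := charpoly_eq_prod_orderedEigenvalues hA
  set l := orderedEigenvalues hA
  have hroots : (univ : Finset (Fin N)).val.map l =
      Multiset.replicate (N - 1) 1 + {1 + τ} := by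
    have h := congrArg Polynomial.roots (hchar.symm.trans hS.2)
    rw [Polynomial.roots_mul (mul_ne_zero (pow_ne_zero _ (Polynomial.X_sub_C_ne_zero _))
      (Polynomial.X_sub_C_ne_zero _)), Polynomial.roots_pow, Polynomial.roots_X_sub_C,
      Polynomial.roots_X_sub_C, Multiset.nsmul_singleton] at h
    rw [← h, ← Polynomial.roots_multiset_prod_X_sub_C (univ.val.map l), Multiset.map_map]
    rfl
  obtain ⟨i₀, hi₀⟩ : ∃ i₀, l i₀ = 1 + τ := by
    have : 1 + τ ∈ (univ : Finset (Fin N)).val.map l := by rw [hroots]; simp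
    simpa using this
  have hi : ∀ i, i ≠ i₀ → l i = 1 := by
    intro i hi
    have h1 : (univ.erase i₀).val.map l = Multiset.replicate (N - 1) 1 := by
      rw [← insert_erase (mem_univ i₀), insert_val_of_notMem (notMem_erase _ _),
        Multiset.map_cons, hi₀, ← Multiset.singleton_add, add_comm] at hroots
      exact add_right_cancel hroots
    refine Multiset.eq_of_mem_replicate (n := N - 1) (h1 ▸ Multiset.mem_map_of_mem l ?_)
    exact mem_erase.2 ⟨hi, mem_univ i⟩
  refine ⟨u i₀, u.norm_eq_one i₀, fun x => ?_⟩
  have hb : ∀ i, Matrix.toEuclideanCLM (𝕜 := ℝ) S (u i) = l i • u i := by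
    intro i
    ext k
    simpa [Matrix.mulVec, dotProduct] using hu i k
  have hlin : ((Matrix.toEuclideanCLM (𝕜 := ℝ) S : _ →L[ℝ] _) : EuclideanSpace ℝ (Fin N) →ₗ[ℝ] _) =
      LinearMap.id + (τ • (innerₛₗ ℝ (u i₀))).smulRight (u i₀) := by
    refine u.toBasis.ext fun i => ?_
    rw [u.coe_toBasis]
    simp only [ContinuousLinearMap.coe_coe, hb, LinearMap.add_apply, LinearMap.id_apply,
      LinearMap.smulRight_apply, LinearMap.smul_apply, innerₛₗ_apply_apply, smul_eq_mul,
      orthonormal_iff_ite.1 u.orthonormal]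
    by_cases h : i₀ = i
    · subst h; simp [hi₀, add_smul]
    · simp [h, hi i (Ne.symm h)]
  simpa using LinearMap.congr_fun hlin x

/-- Only the shape of the density matters: constants such as `K` stay unspecified and are fixed at
the end by the total mass `1`. -/
theorem exists_lintegral_stdGaussian : ∃ K : ENNReal, ∀ f : EuclideanSpace ℝ (Fin N) → ENNReal,
    Measurable f → ∫⁻ x, f x ∂(stdGaussian (EuclideanSpace ℝ (Fin N))) =
      K * ∫⁻ x, ENNReal.ofReal (Real.exp (-‖x‖ ^ 2 / 2)) * f x := by
  refine ⟨ENNReal.ofReal ((√(2 * Real.pi))⁻¹ ^ N), fun f hf => ?_⟩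
  rw [← map_pi_eq_stdGaussian, lintegral_map hf (by fun_prop), gaussianReal_of_var_ne_zero _
    one_ne_zero]
  have : SigmaFinite ((volume : Measure ℝ).withDensity (gaussianPDF 0 1)) := by
    rw [← gaussianReal_of_var_ne_zero _ one_ne_zero]; infer_instance
  rw [lintegral_pi_withDensity _ (measurable_gaussianPDF 0 1) N (by fun_prop), ← volume_pi,
    ← lintegral_const_mul _ (by fun_prop),
    ← (PiLp.volume_preserving_ofLp (Fin N)).lintegral_comp (by fun_prop)]
  refine lintegral_congr fun x => ?_
  rw [← mul_assoc, ← ENNReal.ofReal_mul (by positivity), WithLp.toLp_ofLp]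
  congr 1
  unfold gaussianPDF gaussianPDFReal
  rw [← ENNReal.ofReal_prod_of_nonneg fun i _ => by positivity]
  congr 1
  rw [prod_mul_distrib, ← Real.exp_sum, EuclideanSpace.real_norm_sq_eq]
  simp [sum_div, neg_div]

/-- Cauchy–Schwarz bounds `⟪v, x⟫²` by `‖x‖²`, and `τ > -1` then keeps `‖x‖² + τ ⟪v, x⟫²`
nonnegative. -/
theorem posSemidef_of_spike {S : Matrix (Fin N) (Fin N) ℝ} (hS : S.IsHermitian) {τ : ℝ}
    (hτ : -1 < τ) {v : EuclideanSpace ℝ (Fin N)} (hv : ‖v‖ = 1)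
    (hSv : ∀ x, Matrix.toEuclideanCLM (𝕜 := ℝ) S x = x + (τ * ⟪v, x⟫) • v) : S.PosSemidef := by
  refine Matrix.PosSemidef.of_dotProduct_mulVec_nonneg hS fun x => ?_
  have h := Matrix.inner_toEuclideanCLM S (WithLp.toLp 2 x) (WithLp.toLp 2 x)
  rw [hSv, inner_add_right, real_inner_smul_right, real_inner_self_eq_norm_sq, real_inner_comm] at h
  have hc := abs_real_inner_le_norm v (WithLp.toLp 2 x)
  rw [hv, one_mul] at hc
  have hsq := sq_le_sq' (abs_le.1 hc).1 (abs_le.1 hc).2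
  rw [star_trivial]
  rw [real_inner_comm] at h
  refine le_of_le_of_eq ?_ h
  nlinarith [sq_nonneg ⟪v, WithLp.toLp 2 x⟫]

/-- The Gaussian measure is the image of the standard one under `T = √S`, an invertible linear map.
Substituting `T x` into the quadratic form of `S⁻¹` gives `‖x‖²`, and the determinant of `T` is
absorbed into the constant. -/
theorem exists_lintegral_multivariateGaussian {S : Matrix (Fin N) (Fin N) ℝ} (hS : S.IsHermitian)
    {τ : ℝ} (hτ : -1 < τ) {v : EuclideanSpace ℝ (Fin N)} (hv : ‖v‖ = 1)
    (hSv : ∀ x, Matrix.toEuclideanCLM (𝕜 := ℝ) S x = x + (τ * ⟪v, x⟫) • v) :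
    ∃ K : ENNReal, ∀ f : EuclideanSpace ℝ (Fin N) → ENNReal, Measurable f →
      ∫⁻ x, f x ∂(multivariateGaussian 0 S) =
        K * ∫⁻ x, ENNReal.ofReal (Real.exp (-(‖x‖ ^ 2 - τ / (1 + τ) * ⟪v, x⟫ ^ 2) / 2)) * f x := by
  have hτ1 : 1 + τ ≠ 0 := by linarith
  have hvv : ⟪v, v⟫ = (1 : ℝ) := by rw [real_inner_self_eq_norm_sq, hv]; norm_num
  set A := Matrix.toEuclideanCLM (𝕜 := ℝ) S with hA
  set T := Matrix.toEuclideanCLM (𝕜 := ℝ) (CFC.sqrt S) with hT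
  have hTT : T * T = A := by
    rw [hT, ← map_mul, CFC.sqrt_mul_sqrt_self _ (posSemidef_of_spike hS hτ hv hSv).nonneg]
  have hTs : IsSelfAdjoint T := (CFC.sqrt_nonneg S).isSelfAdjoint.map _
  -- The inverse of `S` by the Sherman–Morrison formula.
  let B : EuclideanSpace ℝ (Fin N) →L[ℝ] EuclideanSpace ℝ (Fin N) :=
    ContinuousLinearMap.id ℝ _ - ((τ / (1 + τ)) • innerSL ℝ v).smulRight v
  have hB : ∀ x, B x = x - (τ / (1 + τ) * ⟪v, x⟫) • v := fun x => by simp [B]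
  have hAB : A * B = 1 := by
    ext1 x
    simp only [mul_apply_eq_comp, hSv, hB, one_apply_eq_self,
      inner_sub_right, real_inner_smul_right, hvv]
    rw [sub_add, ← sub_smul, sub_eq_self]
    convert zero_smul ℝ v using 2
    field_simp
    ring
  have hBA : B * A = 1 := by
    ext1 x
    simp only [mul_apply_eq_comp, hSv, hB, one_apply_eq_self,
      inner_add_right, real_inner_smul_right, hvv]
    rw [add_sub_assoc, ← sub_smul, add_eq_left]
    convert zero_smul ℝ v using 2
    field_simp
    ring
  have hTB : T * B = B * T := by
    calc T * B = B * A * (T * B) := by rw [hBA, one_mul]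
      _ = B * T * (A * B) := by rw [← hTT]; simp only [mul_assoc]
      _ = B * T := by rw [hAB, mul_one]
  have hq : ∀ x, ‖T x‖ ^ 2 - τ / (1 + τ) * ⟪v, T x⟫ ^ 2 = ‖x‖ ^ 2 := by
    intro x
    have h1 : ⟪T x, B (T x)⟫ = ‖x‖ ^ 2 := by
      have h2 : T (B (T x)) = x := by
        calc T (B (T x)) = (T * B * T) x := rfl
          _ = (B * (T * T)) x := by rw [hTB, mul_assoc]
          _ = x := by rw [hTT, hBA]; rfl
      have h3 := ContinuousLinearMap.adjoint_inner_left T (B (T x)) x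
      rw [hTs.adjoint_eq, h2, real_inner_self_eq_norm_sq] at h3
      exact h3
    rw [← h1, hB, inner_sub_right, real_inner_smul_right, real_inner_self_eq_norm_sq,
      real_inner_comm]
    ring
  have hdet : LinearMap.det (T : EuclideanSpace ℝ (Fin N) →ₗ[ℝ] EuclideanSpace ℝ (Fin N)) ≠ 0 := by
    have h : (T : EuclideanSpace ℝ (Fin N) →ₗ[ℝ] EuclideanSpace ℝ (Fin N)) * (T * B : _ →L[ℝ] _) =
        1 := by
      ext1 x
      exact congrArg (fun L : EuclideanSpace ℝ (Fin N) →L[ℝ] EuclideanSpace ℝ (Fin N) => L x)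
        (show T * (T * B) = 1 by rw [← mul_assoc, hTT, hAB])
    exact left_ne_zero_of_mul_eq_one (b := LinearMap.det _) (by rw [← map_mul, h, map_one])
  obtain ⟨K, hK⟩ := exists_lintegral_stdGaussian (N := N)
  refine ⟨K * ENNReal.ofReal |(LinearMap.det
    (T : EuclideanSpace ℝ (Fin N) →ₗ[ℝ] EuclideanSpace ℝ (Fin N)))⁻¹|, fun f hf => ?_⟩
  have hm := Measure.map_linearMap_addHaar_eq_smul_addHaar
    (volume : Measure (EuclideanSpace ℝ (Fin N))) hdet
  unfold multivariateGaussian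
  rw [← hT, lintegral_map hf (by fun_prop), hK _ (by fun_prop), mul_assoc]
  congr 1
  have hg : Measurable fun x : EuclideanSpace ℝ (Fin N) =>
      ENNReal.ofReal (Real.exp (-(‖x‖ ^ 2 - τ / (1 + τ) * ⟪v, x⟫ ^ 2) / 2)) * f x := by fun_prop
  have h := lintegral_map (μ := volume) hg T.continuous.measurable
  simp only [hq] at h
  simp only [zero_add]
  rw [← h, ← smul_eq_mul, ← lintegral_smul_measure, ← hm]
  rfl

end Gaussian

/-! ### From rows to columns, and spherical averages -/

section ColumnLaw

open Finset RealInnerProductSpace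

variable {N M : ℕ}

/-- The ordered eigenvalues of the sample covariance matrix with columns `C`. -/
def colEig (C : Fin M → EuclideanSpace ℝ (Fin N)) : Fin N → ℝ :=
  orderedEigenvalues (sampleCovariance_isHermitian (Matrix.of fun i k => C k i))

theorem sampleCovariance_apply (X : Matrix (Fin N) (Fin M) ℝ) (i j : Fin N) :
    sampleCovariance X i j = (M : ℝ)⁻¹ * ∑ k, X i k * X j k := by
  simp [sampleCovariance, Matrix.mul_apply]

theorem measurable_colEig :
    Measurable (colEig : (Fin M → EuclideanSpace ℝ (Fin N)) → Fin N → ℝ) := by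
  refine measurable_orderedEigenvalues _ fun i j => ?_
  simp only [sampleCovariance_apply, Matrix.of_apply]
  fun_prop

/-- Transposition of data, with the normalization of the sample covariance. -/
def columnsToRows (hM : 0 < M) :
    (Fin M → EuclideanSpace ℝ (Fin N)) ≃ₗ[ℝ] (Fin N → EuclideanSpace ℝ (Fin M)) where
  toFun C i := WithLp.toLp 2 fun k => (√M)⁻¹ * C k i
  invFun X k := WithLp.toLp 2 fun i => √M * X i k
  map_add' C D := by ext i k; simp [mul_add]
  map_smul' r C := by ext i k; simp; ring
  left_inv C := by
    have : √(M : ℝ) ≠ 0 := by positivity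
    ext k i; simp [this]
  right_inv X := by
    have : √(M : ℝ) ≠ 0 := by positivity
    ext i k; simp [this]

theorem gramEig_columnsToRows (hM : 0 < M) (C : Fin M → EuclideanSpace ℝ (Fin N)) :
    gramEig (columnsToRows hM C) = colEig C := by
  refine orderedEigenvalues_eq _ (monotone_orderedEigenvalues _) ?_
  unfold colEig
  rw [← charpoly_eq_prod_orderedEigenvalues]
  congr 1
  ext i j
  rw [sampleCovariance_apply, Matrix.gram_apply, PiLp.inner_apply, mul_sum]
  refine sum_congr rfl fun k _ => ?_
  have : (√(M : ℝ))⁻¹ * (√(M : ℝ))⁻¹ = (M : ℝ)⁻¹ := by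
    rw [← mul_inv, Real.mul_self_sqrt (by positivity)]
  simp only [columnsToRows, LinearEquiv.coe_mk, LinearMap.coe_mk, AddHom.coe_mk, Matrix.of_apply,
    RCLike.inner_apply, conj_trivial, ← this]
  ring

/-- Transposing the data is a linear isomorphism, so it carries Lebesgue measure to a multiple of
Lebesgue measure. -/
theorem exists_lintegral_colEig (hNM : N ≤ M) (hM : 0 < M) :
    ∃ K : ENNReal, ∀ F : (Fin N → ℝ) → ENNReal, Measurable F →
      ∫⁻ C : Fin M → EuclideanSpace ℝ (Fin N), F (colEig C) =
        K * ∫⁻ l in chamber N, ENNReal.ofReal (wishartDensity N M l) * F l := by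
  obtain ⟨K, hK⟩ := exists_lintegral_gramEig hNM
  let e := (columnsToRows (N := N) hM).toContinuousLinearEquiv
  have hH : (Measure.map e volume).IsAddHaarMeasure := e.isAddHaarMeasure_map _
  obtain ⟨c, hc⟩ : ∃ c : ENNReal, Measure.map e volume = c • volume :=
    ⟨_, Measure.isAddLeftInvariant_eq_smul (Measure.map e volume) volume⟩
  refine ⟨c * K, fun F hF => ?_⟩
  have hFg : Measurable fun X : Fin N → EuclideanSpace ℝ (Fin M) => F (gramEig X) :=
    hF.comp measurable_gramEig
  rw [mul_assoc, ← hK F hF, ← smul_eq_mul, ← lintegral_smul_measure, ← hc,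
    lintegral_map hFg e.continuous.measurable]
  refine lintegral_congr fun C => ?_
  rw [← gramEig_columnsToRows hM C]
  rfl

/-- A real symmetric quadratic form in eigencoordinates. -/
theorem exists_quadraticForm_eq {A : Matrix (Fin N) (Fin N) ℝ} (hA : A.IsHermitian) :
    ∃ R : EuclideanSpace ℝ (Fin N) ≃ₗᵢ[ℝ] EuclideanSpace ℝ (Fin N), ∀ x : EuclideanSpace ℝ (Fin N),
      ∑ i, ∑ j, x i * A i j * x j = ∑ a, orderedEigenvalues hA a * R x a ^ 2 := by
  obtain ⟨u, hu⟩ := exists_eigenbasis hA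
  refine ⟨u.repr, fun x => ?_⟩
  have h1 : ∀ j, ∑ i, x i * A i j = ∑ a, orderedEigenvalues hA a * u.repr x a * u a j := by
    intro j
    have hx : ∀ i, x i = ∑ a, u.repr x a * u a i := by
      intro i
      conv_lhs => rw [← u.sum_repr x]
      simp
    have hs : ∀ i, A i j = A j i := fun i => by simpa using (hA.apply j i)
    calc ∑ i, x i * A i j = ∑ i, ∑ a, u.repr x a * (A j i * u a i) := by
          refine sum_congr rfl fun i _ => ?_
          rw [hx i, sum_mul, hs]
          exact sum_congr rfl fun a _ => by ring
      _ = _ := by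
          rw [sum_comm]
          refine sum_congr rfl fun a _ => ?_
          rw [← mul_sum, hu]
          ring
  rw [sum_comm]
  simp_rw [← sum_mul, h1, sum_mul]
  rw [sum_comm]
  refine sum_congr rfl fun a _ => ?_
  have h2 : u.repr x a = ∑ j, u a j * x j := by
    rw [u.repr_apply_apply, PiLp.inner_apply]
    simp [mul_comm]
  simp_rw [mul_assoc]
  rw [← mul_sum, ← mul_sum, ← h2]
  ring

theorem sum_norm_sq_eq (hM : 0 < M) (C : Fin M → EuclideanSpace ℝ (Fin N)) :
    ∑ k, ‖C k‖ ^ 2 = M * ∑ i, colEig C i := by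
  have hA := sampleCovariance_isHermitian (Matrix.of fun i k => C k i)
  obtain ⟨e, he⟩ := exists_perm_orderedEigenvalues hA
  have h := hA.trace_eq_sum_eigenvalues
  rw [← Equiv.sum_comp e] at h
  have h2 : ∑ i, colEig C i = (sampleCovariance (Matrix.of fun i k => C k i)).trace := by
    rw [h]
    exact sum_congr rfl fun i _ => by simp [colEig, he]
  rw [h2, Matrix.trace]
  simp only [Matrix.diag_apply, sampleCovariance_apply, Matrix.of_apply]
  rw [← mul_sum, mul_inv_cancel_left₀ (by positivity), sum_comm]
  exact sum_congr rfl fun k _ => by rw [EuclideanSpace.real_norm_sq_eq]; simp [sq]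

theorem sum_inner_sq_eq (hM : 0 < M) (C : Fin M → EuclideanSpace ℝ (Fin N))
    (v : EuclideanSpace ℝ (Fin N)) :
    ∑ k, ⟪v, C k⟫ ^ 2 = M * ∑ i, ∑ j, v i * sampleCovariance (Matrix.of fun i k => C k i) i j * v j
    := by
  simp only [sampleCovariance_apply, Matrix.of_apply, PiLp.inner_apply, RCLike.inner_apply,
    conj_trivial, sq, mul_sum, sum_mul]
  rw [sum_comm]
  refine sum_congr rfl fun i _ => ?_
  rw [sum_comm]
  refine sum_congr rfl fun j _ => sum_congr rfl fun k _ => ?_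
  field_simp

/-- The spherical average of the exponential of a diagonal quadratic form. -/
def sphereExp (N : ℕ) (c : ℝ) (l : Fin N → ℝ) : ENNReal :=
  ∫⁻ x, ENNReal.ofReal (Real.exp (c * ∑ j, l j * x j ^ 2)) ∂sphereMeasure (EuclideanSpace ℝ (Fin N))

theorem measurable_sphereExp (c : ℝ) : Measurable (sphereExp N c) := by
  unfold sphereExp
  refine Measurable.lintegral_prod_right' (f := fun p : (Fin N → ℝ) × EuclideanSpace ℝ (Fin N) =>
    ENNReal.ofReal (Real.exp (c * ∑ j, p.1 j * p.2 j ^ 2))) ?_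
  fun_prop

/-- The exponent is a multiple of the quadratic form of the sample covariance matrix at `v`.
Rotating `v` into eigencoordinates preserves the sphere measure and leaves only the eigenvalues. -/
theorem lintegral_sphere_colEig (hM : 0 < M) (a : ℝ) (C : Fin M → EuclideanSpace ℝ (Fin N)) :
    ∫⁻ v, ENNReal.ofReal (Real.exp (a / 2 * ∑ k, ⟪v, C k⟫ ^ 2))
      ∂sphereMeasure (EuclideanSpace ℝ (Fin N)) = sphereExp N (M * a / 2) (colEig C) := by
  obtain ⟨R, hR⟩ := exists_quadraticForm_eq
    (sampleCovariance_isHermitian (Matrix.of fun i k => C k i))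
  unfold sphereExp
  have hm : Measurable fun x : EuclideanSpace ℝ (Fin N) =>
      ENNReal.ofReal (Real.exp (M * a / 2 * ∑ j, colEig C j * x j ^ 2)) := by fun_prop
  rw [← (measurePreserving_sphereMeasure R).lintegral_comp hm]
  refine lintegral_congr fun v => ?_
  rw [sum_inner_sq_eq hM, hR]
  congr 2
  unfold colEig
  ring

/-- Rotating the columns by `O` conjugates the sample covariance matrix by the orthogonal matrix
`O`. -/
theorem colEig_comp_isometry (R : EuclideanSpace ℝ (Fin N) ≃ₗᵢ[ℝ] EuclideanSpace ℝ (Fin N))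
    (C : Fin M → EuclideanSpace ℝ (Fin N)) : colEig (fun k => R (C k)) = colEig C := by
  refine orderedEigenvalues_eq _ (monotone_orderedEigenvalues _) ?_
  unfold colEig
  rw [← charpoly_eq_prod_orderedEigenvalues]
  let O : Matrix (Fin N) (Fin N) ℝ := Matrix.of fun i j => R (EuclideanSpace.single j 1) i
  have hO : O.transpose * O = 1 := by
    ext i j
    have h := R.inner_map_map (EuclideanSpace.single i (1 : ℝ)) (EuclideanSpace.single j 1)
    rw [PiLp.inner_apply] at h
    simp only [RCLike.inner_apply, conj_trivial] at h
    simp only [Matrix.mul_apply, Matrix.transpose_apply, O, Matrix.of_apply, Matrix.one_apply]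
    simp_rw [mul_comm (R (EuclideanSpace.single i 1) _), h]
    simp [EuclideanSpace.inner_single_left]
  have hC : (Matrix.of fun i k => R (C k) i) = O * Matrix.of fun i k => C k i := by
    ext i k
    simp only [Matrix.of_apply, Matrix.mul_apply, O]
    have h : C k = ∑ j, C k j • EuclideanSpace.single j (1 : ℝ) := by
      ext i; simp [Pi.single_apply]
    conv_lhs => rw [h]
    simp [mul_comm]
  rw [hC]
  have : sampleCovariance (O * Matrix.of fun i k => C k i) =
      O * (sampleCovariance (Matrix.of fun i k => C k i) * O.transpose) := by
    unfold sampleCovariance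
    simp only [Matrix.transpose_mul, Matrix.smul_mul, Matrix.mul_smul, Matrix.mul_assoc]
  rw [this, Matrix.charpoly_mul_comm, Matrix.mul_assoc, hO, Matrix.mul_one]

end ColumnLaw

/-! ### The eigenvalue law of the spiked model -/

section SpikedLaw

open Finset RealInnerProductSpace

variable {N M : ℕ}

theorem measurePreserving_comp_isometry
    (R : EuclideanSpace ℝ (Fin N) ≃ₗᵢ[ℝ] EuclideanSpace ℝ (Fin N)) :
    MeasurePreserving (fun (C : Fin M → EuclideanSpace ℝ (Fin N)) k => R (C k)) :=
  volume_preserving_pi fun _ => R.measurePreserving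

/-- Weighted by a rotation invariant density, Lebesgue distributed columns have eigenvalues whose
law does not depend on the spike direction, so that it can be averaged over the sphere. -/
theorem lintegral_colEig_spike (hN : 0 < N) (hM : 0 < M) (a : ℝ) {v : EuclideanSpace ℝ (Fin N)}
    (hv : ‖v‖ = 1) {F : (Fin N → ℝ) → ENNReal} (hF : Measurable F) :
    ∫⁻ C : Fin M → EuclideanSpace ℝ (Fin N),
        ENNReal.ofReal (Real.exp (a / 2 * ∑ k, ⟪v, C k⟫ ^ 2)) * F (colEig C) =
      (sphereMeasure (EuclideanSpace ℝ (Fin N)) Set.univ)⁻¹ *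
        ∫⁻ C : Fin M → EuclideanSpace ℝ (Fin N),
          sphereExp N (M * a / 2) (colEig C) * F (colEig C) := by
  have : Nonempty (Fin N) := ⟨⟨0, hN⟩⟩
  have hFc : Measurable fun C : Fin M → EuclideanSpace ℝ (Fin N) => F (colEig C) :=
    hF.comp measurable_colEig
  set L : EuclideanSpace ℝ (Fin N) → ENNReal := fun w => ∫⁻ C : Fin M → EuclideanSpace ℝ (Fin N),
        ENNReal.ofReal (Real.exp (a / 2 * ∑ k, ⟪w, C k⟫ ^ 2)) * F (colEig C) with hL
  have hrot : ∀ w, ‖w‖ = 1 → L w = L v := by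
    intro w hw
    -- The reflection that exchanges the unit vectors `v` and `w`.
    let R := (ℝ ∙ (v - w))ᗮ.reflection
    have hR : R v = w := Submodule.reflection_sub (hv.trans hw.symm)
    have hm : Measurable fun C : Fin M → EuclideanSpace ℝ (Fin N) =>
        ENNReal.ofReal (Real.exp (a / 2 * ∑ k, ⟪w, C k⟫ ^ 2)) * F (colEig C) :=
      Measurable.mul (by fun_prop) hFc
    simp only [hL]
    rw [← (measurePreserving_comp_isometry R).lintegral_comp hm]
    simp only [colEig_comp_isometry, ← hR, LinearIsometryEquiv.inner_map_map]
  have h1 : ∫⁻ w, L w ∂sphereMeasure (EuclideanSpace ℝ (Fin N)) =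
      L v * sphereMeasure (EuclideanSpace ℝ (Fin N)) Set.univ := by
    rw [← lintegral_const]
    refine lintegral_congr_ae ?_
    filter_upwards [ae_norm_eq_one_sphereMeasure] with w hw using hrot w hw
  have h2 : ∫⁻ w, L w ∂sphereMeasure (EuclideanSpace ℝ (Fin N)) =
      ∫⁻ C : Fin M → EuclideanSpace ℝ (Fin N),
          sphereExp N (M * a / 2) (colEig C) * F (colEig C) := by
    simp only [hL]
    have hm : Measurable fun p : EuclideanSpace ℝ (Fin N) × (Fin M → EuclideanSpace ℝ (Fin N)) =>
        ENNReal.ofReal (Real.exp (a / 2 * ∑ k, ⟪p.1, p.2 k⟫ ^ 2)) * F (colEig p.2) :=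
      Measurable.mul (by fun_prop) (hFc.comp measurable_snd)
    rw [lintegral_lintegral_swap hm.aemeasurable]
    refine lintegral_congr fun C => ?_
    rw [lintegral_mul_const _ (by fun_prop), lintegral_sphere_colEig hM]
  have hs0 : sphereMeasure (EuclideanSpace ℝ (Fin N)) Set.univ ≠ 0 := by
    rw [Ne, Measure.measure_univ_eq_zero]
    exact sphereMeasure_ne_zero
  rw [← h2, h1, mul_comm, mul_assoc, ENNReal.mul_inv_cancel hs0 (measure_ne_top _ _), mul_one]

/-- The law of the sample eigenvalues of independent Gaussian columns, up to normalization. -/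
theorem exists_lintegral_gaussian_colEig (hN : 0 < N) (hNM : N ≤ M) {τ : ℝ} (hτ : -1 < τ)
    {S : Matrix (Fin N) (Fin N) ℝ} (hS : IsRankOneSpike S τ) :
    ∃ K : ENNReal, ∀ F : (Fin N → ℝ) → ENNReal, Measurable F →
      ∫⁻ C : Fin M → EuclideanSpace ℝ (Fin N), F (colEig C)
          ∂(Measure.pi fun _ => multivariateGaussian 0 S) =
        K * ∫⁻ l in chamber N, ENNReal.ofReal (wishartDensity N M l) *
          (ENNReal.ofReal (Real.exp (-(M : ℝ) / 2 * ∑ i, l i)) *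
            sphereExp N (M * τ / (2 * (1 + τ))) l) * F l := by
  have hM : 0 < M := hN.trans_le hNM
  obtain ⟨v, hv, hSv⟩ := exists_spike_direction hS
  have hSh : S.IsHermitian := by
    rw [Matrix.IsHermitian, Matrix.conjTranspose_eq_transpose_of_trivial]; exact hS.1
  obtain ⟨K₁, hK₁⟩ := exists_lintegral_multivariateGaussian hSh hτ hv hSv
  obtain ⟨K₂, hK₂⟩ := exists_lintegral_colEig hNM hM
  set q : EuclideanSpace ℝ (Fin N) → ENNReal := fun x =>
    ENNReal.ofReal (Real.exp (-(‖x‖ ^ 2 - τ / (1 + τ) * ⟪v, x⟫ ^ 2) / 2)) with hq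
  have hqm : Measurable q := by fun_prop
  have hdens : multivariateGaussian 0 S = volume.withDensity fun x => K₁ * q x := by
    refine Measure.ext_of_lintegral _ fun f hf => ?_
    rw [hK₁ f hf, lintegral_withDensity_eq_lintegral_mul _ (by fun_prop) hf,
      ← lintegral_const_mul _ (by fun_prop)]
    exact lintegral_congr fun x => (mul_assoc _ _ _).symm
  have hsig : SigmaFinite ((volume : Measure (EuclideanSpace ℝ (Fin N))).withDensity
      fun x => K₁ * q x) := by
    rw [← hdens]; infer_instance
  refine ⟨K₁ ^ M * ((sphereMeasure (EuclideanSpace ℝ (Fin N)) Set.univ)⁻¹ * K₂), fun F hF => ?_⟩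
  have hFc : Measurable fun C : Fin M → EuclideanSpace ℝ (Fin N) => F (colEig C) :=
    hF.comp measurable_colEig
  let G : (Fin N → ℝ) → ENNReal := fun l => ENNReal.ofReal (Real.exp (-(M : ℝ) / 2 * ∑ i, l i)) * F l
  have hG : Measurable G := Measurable.mul (by fun_prop) hF
  rw [hdens, lintegral_pi_withDensity _ (by fun_prop) M hFc, ← volume_pi]
  have hprod : ∀ C : Fin M → EuclideanSpace ℝ (Fin N), (∏ k, K₁ * q (C k)) * F (colEig C) =
      K₁ ^ M * (ENNReal.ofReal (Real.exp (τ / (1 + τ) / 2 * ∑ k, ⟪v, C k⟫ ^ 2)) * G (colEig C)) := by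
    intro C
    rw [prod_mul_distrib, prod_const, card_univ, Fintype.card_fin, mul_assoc]
    congr 1
    simp only [hq, G]
    rw [← ENNReal.ofReal_prod_of_nonneg fun i _ => by positivity, ← mul_assoc,
      ← ENNReal.ofReal_mul (by positivity), ← Real.exp_sum, ← Real.exp_add]
    congr 3
    have h := sum_norm_sq_eq hM C
    rw [← sum_div, sum_neg_distrib, sum_sub_distrib, ← mul_sum, h]
    ring
  have hGc : Measurable fun C : Fin M → EuclideanSpace ℝ (Fin N) =>
      ENNReal.ofReal (Real.exp (τ / (1 + τ) / 2 * ∑ k, ⟪v, C k⟫ ^ 2)) * G (colEig C) :=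
    Measurable.mul (by fun_prop) (hG.comp measurable_colEig)
  simp_rw [hprod]
  rw [lintegral_const_mul _ hGc, lintegral_colEig_spike hN hM _ hv hG, mul_assoc, mul_assoc,
    hK₂ (fun l => sphereExp N (M * (τ / (1 + τ)) / 2) l * G l)
      ((measurable_sphereExp _).mul hG)]
  congr 4
  ext l
  simp only [G]
  rw [show (M : ℝ) * (τ / (1 + τ)) / 2 = M * τ / (2 * (1 + τ)) by rw [mul_div_assoc', div_div,
    mul_comm (1 + τ)]]
  ring

/-- The unnormalized density of the sample eigenvalues. -/
def spikedDensity (N M : ℕ) (τ : ℝ) (l : Fin N → ℝ) : ENNReal :=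
  ENNReal.ofReal (wishartDensity N M l) * (ENNReal.ofReal (Real.exp (-(M : ℝ) / 2 * ∑ i, l i)) *
    sphereExp N (M * τ / (2 * (1 + τ))) l)

theorem measurable_spikedDensity (τ : ℝ) : Measurable (spikedDensity N M τ) :=
  measurable_wishartDensity.ennreal_ofReal.mul
    (Measurable.mul (by fun_prop) (measurable_sphereExp _))

theorem exists_isRankOneSpike (hN : 0 < N) (τ : ℝ) :
    ∃ S : Matrix (Fin N) (Fin N) ℝ, IsRankOneSpike S τ := by
  obtain ⟨n, rfl⟩ := Nat.exists_eq_succ_of_ne_zero hN.ne'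
  refine ⟨Matrix.diagonal (Fin.cons (1 + τ) fun _ => 1), Matrix.isSymm_diagonal _, ?_⟩
  rw [Matrix.charpoly_diagonal, Fin.prod_univ_succ]
  simp [mul_comm]

variable (N M) in
/-- The total mass of the unnormalized density. -/
def spikedMass (τ : ℝ) : ENNReal := ∫⁻ l in chamber N, spikedDensity N M τ l

/-- Testing the law on the constant function `1` identifies the unknown constant as the inverse of
the total mass, which is therefore neither zero nor infinite. -/
theorem lintegral_gaussian_colEig (hN : 0 < N) (hNM : N ≤ M) {τ : ℝ} (hτ : -1 < τ)
    {S : Matrix (Fin N) (Fin N) ℝ} (hS : IsRankOneSpike S τ) :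
    (spikedMass N M τ ≠ 0 ∧ spikedMass N M τ ≠ ⊤) ∧
    ∀ F : (Fin N → ℝ) → ENNReal, Measurable F →
      ∫⁻ C : Fin M → EuclideanSpace ℝ (Fin N), F (colEig C)
          ∂(Measure.pi fun _ => multivariateGaussian 0 S) =
        (spikedMass N M τ)⁻¹ * ∫⁻ l in chamber N, spikedDensity N M τ l * F l := by
  obtain ⟨K, hK⟩ := exists_lintegral_gaussian_colEig hN hNM hτ hS
  have h1 : K * spikedMass N M τ = 1 := by
    have := hK (fun _ => 1) measurable_const
    simp only [lintegral_const, measure_univ, mul_one] at this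
    exact this.symm
  have hK0 : K = (spikedMass N M τ)⁻¹ := ENNReal.eq_inv_of_mul_eq_one_left h1
  refine ⟨⟨fun h => ?_, fun h => ?_⟩, fun F hF => ?_⟩
  · simp [h] at h1
  · simp [hK0, h] at h1
  · rw [hK F hF, hK0]
    rfl

/-- The mass does not involve the covariance matrix, so one example suffices; the normalization has
to be fixed before that matrix is given. -/
theorem spikedMass_ne_zero_ne_top (hN : 0 < N) (hNM : N ≤ M) {τ : ℝ} (hτ : -1 < τ) :
    spikedMass N M τ ≠ 0 ∧ spikedMass N M τ ≠ ⊤ := by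
  obtain ⟨S, hS⟩ := exists_isRankOneSpike hN τ
  exact (lintegral_gaussian_colEig hN hNM hτ hS).1

/-- The law of the ordered eigenvalues of the spiked Wishart matrix. -/
theorem hasLaw_orderedEigenvalues (hN : 0 < N) (hNM : N ≤ M) {τ : ℝ} (hτ : -1 < τ)
    {S : Matrix (Fin N) (Fin N) ℝ} (hS : IsRankOneSpike S τ) {Ω : Type*} [MeasurableSpace Ω]
    {μ : Measure Ω} [IsProbabilityMeasure μ] {X : Ω → Matrix (Fin N) (Fin M) ℝ}
    (hX : IsGaussianData X S μ) :
    HasLaw (fun ω => orderedEigenvalues (sampleCovariance_isHermitian (X ω)))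
      ((volume.restrict (chamber N)).withDensity fun l =>
        (spikedMass N M τ)⁻¹ * spikedDensity N M τ l) μ := by
  set Y : Ω → Fin M → EuclideanSpace ℝ (Fin N) := fun ω k => WithLp.toLp 2 fun i => X ω i k with hY
  have hYm : ∀ k, AEMeasurable (fun ω => Y ω k) μ := fun k => (hX.column_law k).aemeasurable
  have hmap : μ.map Y = Measure.pi fun _ => multivariateGaussian 0 S := by
    have h := (iIndepFun_iff_map_fun_eq_pi_map hYm).1 hX.columns_indep
    rw [show (fun ω i => Y ω i) = Y from rfl] at h
    rw [h]
    congr 1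
    funext k
    exact (hX.column_law k).map_eq
  have hYae : AEMeasurable Y μ := aemeasurable_pi_lambda _ hYm
  have heq : (fun ω => orderedEigenvalues (sampleCovariance_isHermitian (X ω))) = colEig ∘ Y := rfl
  rw [heq]
  refine ⟨measurable_colEig.comp_aemeasurable hYae, ?_⟩
  refine Measure.ext_of_lintegral _ fun F hF => ?_
  have hd : Measurable fun l => (spikedMass N M τ)⁻¹ * spikedDensity N M τ l :=
    (measurable_spikedDensity τ).const_mul _
  have hdF : Measurable fun l => spikedDensity N M τ l * F l := (measurable_spikedDensity τ).mul hF
  rw [← AEMeasurable.map_map_of_aemeasurable measurable_colEig.aemeasurable hYae, hmap,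
    lintegral_map hF measurable_colEig, (lintegral_gaussian_colEig hN hNM hτ hS).2 F hF,
    lintegral_withDensity_eq_lintegral_mul _ hd hF,
    ← lintegral_const_mul _ hdF]
  exact lintegral_congr fun l => (mul_assoc _ _ _).symm

end SpikedLaw

/-! ### Products of inverse square roots as spherical integrals -/

section SphereIdentity

open Finset Complex Filter Topology Module

theorem integrableOn_pow_mul_cexp {q : ℂ} (hq : 0 < q.re) (m : ℕ) :
    IntegrableOn (fun r : ℝ => (r : ℂ) ^ m * cexp (-q * (r : ℂ) ^ 2)) (Set.Ioi 0) := by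
  have h := integrableOn_rpow_mul_exp_neg_mul_sq hq (s := m) (by linarith [Nat.cast_nonneg (α := ℝ) m])
  refine h.mono' (by fun_prop) ?_
  filter_upwards [ae_restrict_mem measurableSet_Ioi] with r hr
  have hr0 : (0 : ℝ) < r := hr
  rw [norm_mul, norm_pow, norm_real, Real.norm_of_nonneg hr0.le, norm_cexp_neg_mul_sq,
    Real.rpow_natCast]

/-- Integrating the derivative of `r^(2m+2) exp(-q r²)` links consecutive odd moments. Odd powers
are the ones needed because the radial Jacobian in dimension `2n` is `r^(2n-1)`. -/
theorem integral_odd_pow_mul_cexp {q : ℂ} (hq : 0 < q.re) (m : ℕ) :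
    ∫ r : ℝ in Set.Ioi 0, (r : ℂ) ^ (2 * m + 1) * cexp (-q * (r : ℂ) ^ 2) =
      m.factorial / (2 * q ^ (m + 1)) := by
  have hq0 : q ≠ 0 := by rintro rfl; simp at hq
  induction m with
  | zero => simpa using integral_mul_cexp_neg_mul_sq hq
  | succ m ih =>
    set f : ℝ → ℂ := fun r => (r : ℂ) ^ (2 * (m + 1)) * cexp (-q * (r : ℂ) ^ 2) with hf
    have hd : ∀ r ∈ Set.Ici (0 : ℝ), HasDerivAt f ((2 * (m + 1) : ℂ) * ((r : ℂ) ^ (2 * m + 1) *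
        cexp (-q * (r : ℂ) ^ 2)) - 2 * q * ((r : ℂ) ^ (2 * (m + 1) + 1) *
        cexp (-q * (r : ℂ) ^ 2))) r := by
      intro r _
      have h1 : HasDerivAt (fun z : ℂ => z ^ (2 * (m + 1)) * cexp (-q * z ^ 2))
          (((2 * (m + 1) : ℕ) : ℂ) * (r : ℂ) ^ (2 * (m + 1) - 1) * cexp (-q * (r : ℂ) ^ 2) +
          (r : ℂ) ^ (2 * (m + 1)) * (cexp (-q * (r : ℂ) ^ 2) * (-q * ((2 : ℕ) * (r : ℂ) ^ 1))))
          (r : ℂ) :=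
        (hasDerivAt_pow _ _).mul (((hasDerivAt_pow 2 (r : ℂ)).const_mul (-q)).cexp)
      convert h1.comp_ofReal using 1
      rw [show 2 * (m + 1) - 1 = 2 * m + 1 by omega]
      push_cast
      ring
    have hi := ((integrableOn_pow_mul_cexp hq (2 * m + 1)).const_mul (2 * (m + 1) : ℂ)).sub
      ((integrableOn_pow_mul_cexp hq (2 * (m + 1) + 1)).const_mul (2 * q))
    have ht : Tendsto f atTop (𝓝 0) := by
      rw [tendsto_zero_iff_norm_tendsto_zero]
      have ho := (rpow_mul_exp_neg_mul_sq_isLittleO_exp_neg hq (2 * (m + 1) : ℕ)).trans_tendsto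
        (Real.tendsto_exp_atBot.comp (tendsto_id.const_mul_atTop_of_neg (by norm_num)))
      refine ho.congr' ?_
      filter_upwards [eventually_ge_atTop 0] with r hr
      rw [hf, norm_mul, norm_pow, norm_real, Real.norm_of_nonneg hr, norm_cexp_neg_mul_sq,
        Real.rpow_natCast]
    have h := integral_Ioi_of_hasDerivAt_of_tendsto' hd hi ht
    rw [integral_sub ((integrableOn_pow_mul_cexp hq (2 * m + 1)).const_mul _)
      ((integrableOn_pow_mul_cexp hq (2 * (m + 1) + 1)).const_mul _), integral_const_mul,
      integral_const_mul, ih] at h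
    have hf0 : f 0 = 0 := by simp [hf]
    rw [hf0, sub_zero, sub_eq_zero] at h
    rw [Nat.factorial_succ]
    push_cast
    field_simp at h ⊢
    linear_combination -h

theorem integral_polar {E : Type*} [NormedAddCommGroup E] [NormedSpace ℝ E] [FiniteDimensional ℝ E]
    [MeasurableSpace E] [BorelSpace E] [Nontrivial E] (μ : Measure E) [μ.IsAddHaarMeasure]
    {f : E → ℂ} (hf : Integrable f μ) :
    ∫ x, f x ∂μ = ∫ ω, (∫ r in Set.Ioi (0 : ℝ), ((r ^ (finrank ℝ E - 1) : ℝ) : ℂ) *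
      f (r • (ω : E))) ∂μ.toSphere := by
  have h1 : ∫ x, f x ∂μ = ∫ x : ({(0)}ᶜ : Set E), f x ∂(μ.comap (↑)) := by
    rw [integral_subtype_comap (measurableSet_singleton _).compl, restrict_compl_singleton]
  have hmp := μ.measurePreserving_homeomorphUnitSphereProd
  have hemb : MeasurableEmbedding (homeomorphUnitSphereProd E) := Homeomorph.measurableEmbedding _
  have h3 : ∀ x : ({(0)}ᶜ : Set E), f (((homeomorphUnitSphereProd E x).2 : ℝ) •
      ((homeomorphUnitSphereProd E x).1 : E)) = f x := by
    intro x
    congr 1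
    have : ‖(x : E)‖ ≠ 0 := norm_ne_zero_iff.2 x.2
    simp [smul_smul, this]
  have h2 := hmp.integral_comp hemb (fun p => f ((p.2 : ℝ) • (p.1 : E)))
  have hint : Integrable (fun p : Metric.sphere (0 : E) 1 × Set.Ioi (0 : ℝ) =>
      f ((p.2 : ℝ) • (p.1 : E))) (μ.toSphere.prod (Measure.volumeIoiPow (finrank ℝ E - 1))) := by
    rw [← hmp.integrable_comp_emb hemb]
    simp only [Function.comp_def, h3]
    refine (integrableOn_iff_comap_subtypeVal (measurableSet_singleton _).compl).1 ?_
    rw [IntegrableOn, restrict_compl_singleton]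
    exact hf
  simp_rw [h3] at h2
  rw [h1, h2, integral_prod _ hint]
  refine integral_congr_ae (Eventually.of_forall fun ω => ?_)
  simp only [Measure.volumeIoiPow]
  rw [integral_withDensity_eq_integral_toReal_smul (by fun_prop)
    (Eventually.of_forall fun _ => ENNReal.ofReal_lt_top),
    ← integral_subtype_comap measurableSet_Ioi
    fun r : ℝ => ((r ^ (finrank ℝ E - 1) : ℝ) : ℂ) * f (r • (ω : E))]
  refine integral_congr_ae (Eventually.of_forall fun r => ?_)
  simp only [ENNReal.toReal_ofReal (pow_nonneg (le_of_lt r.2) _), real_smul]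

theorem re_sum_mul_sq_pos {N : ℕ} {z : Fin N → ℂ} (hz : ∀ j, 0 < (z j).re)
    {x : EuclideanSpace ℝ (Fin N)} (hx : ‖x‖ = 1) : 0 < (∑ j, z j * (x j : ℂ) ^ 2).re := by
  have h : (∑ j, z j * (x j : ℂ) ^ 2).re = ∑ j, (z j).re * x j ^ 2 := by
    rw [re_sum]
    refine sum_congr rfl fun j _ => ?_
    rw [← ofReal_pow, re_mul_ofReal]
  rw [h]
  obtain ⟨j, hj⟩ : ∃ j, x j ≠ 0 := by
    by_contra! h0
    have : x = 0 := by ext j; simp [h0 j]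
    simp [this] at hx
  exact sum_pos' (fun j _ => mul_nonneg (hz j).le (sq_nonneg _))
    ⟨j, mem_univ j, mul_pos (hz j) (by positivity)⟩

/-- An even dimensional sphere average of inverse powers of a quadratic form with eigenvalues in
the right half plane. -/
theorem integral_sphere_inv_pow {n : ℕ} (hn : 0 < n) {z : Fin (2 * n) → ℂ}
    (hz : ∀ j, 0 < (z j).re) :
    ∏ j, z j ^ (-(1 / 2) : ℂ) = ((n - 1).factorial / (2 * (Real.pi : ℂ) ^ n)) *
      ∫ x, ((∑ j, z j * (x j : ℂ) ^ 2) ^ n)⁻¹ ∂sphereMeasure (EuclideanSpace ℝ (Fin (2 * n))) := by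
  have hne : Nonempty (Fin (2 * n)) := ⟨⟨0, by omega⟩⟩
  have h1 := GaussianFourier.integral_cexp_neg_sum_mul_add hz 0
  have hi := GaussianFourier.integrable_cexp_neg_sum_mul_add hz 0
  simp only [Pi.zero_apply, zero_mul, sum_const_zero, add_zero, ne_eq, OfNat.ofNat_ne_zero,
    not_false_eq_true, zero_pow, zero_div, Complex.exp_zero, mul_one] at h1 hi
  have hmp := PiLp.volume_preserving_ofLp (Fin (2 * n))
  have hemb : MeasurableEmbedding (WithLp.ofLp : EuclideanSpace ℝ (Fin (2 * n)) → _) :=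
    (MeasurableEquiv.toLp 2 _).symm.measurableEmbedding
  rw [← hmp.integrable_comp_emb hemb, Function.comp_def] at hi
  rw [← hmp.integral_comp hemb, integral_polar volume hi] at h1
  have hrad : ∀ ω : Metric.sphere (0 : EuclideanSpace ℝ (Fin (2 * n))) 1,
      ∫ r in Set.Ioi (0 : ℝ), ((r ^ (finrank ℝ (EuclideanSpace ℝ (Fin (2 * n))) - 1) : ℝ) : ℂ) *
        cexp (-∑ j, z j * ((r • (ω : EuclideanSpace ℝ (Fin (2 * n)))) j : ℂ) ^ 2) =
      ((n - 1).factorial / 2 : ℂ) * ((∑ j, z j * ((ω : EuclideanSpace ℝ (Fin (2 * n))) j : ℂ) ^ 2) ^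
        n)⁻¹ := by
    intro ω
    have hq := re_sum_mul_sq_pos hz (x := ω) (by simp)
    have h := integral_odd_pow_mul_cexp hq (n - 1)
    rw [Nat.sub_add_cancel hn, show 2 * (n - 1) + 1 = 2 * n - 1 by omega] at h
    rw [finrank_euclideanSpace_fin]
    calc _ = _ := by
          refine integral_congr_ae (Eventually.of_forall fun r => ?_)
          simp only [PiLp.smul_apply, smul_eq_mul, ofReal_mul, ofReal_pow]
          congr 2
          rw [neg_mul, sum_mul]
          congr 1
          exact sum_congr rfl fun j _ => by ring
      _ = _ := h
      _ = _ := by rw [div_mul_eq_div_div, div_eq_mul_inv]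
  -- The principal power splits because `z j` lies in the right half plane, away from the cut. The
  -- `2n` factors `√π` combine to `π^n`.
  have hprod : ∏ j, ((Real.pi : ℂ) / z j) ^ (1 / 2 : ℂ) =
      (Real.pi : ℂ) ^ n * ∏ j, z j ^ (-(1 / 2) : ℂ) := by
    have hj : ∀ j, ((Real.pi : ℂ) / z j) ^ (1 / 2 : ℂ) =
        (Real.pi : ℂ) ^ (1 / 2 : ℂ) * z j ^ (-(1 / 2) : ℂ) := by
      intro j
      have hz0 : z j ≠ 0 := fun h => by simpa [h] using hz j
      have harg : (z j).arg ≠ Real.pi := by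
        have := abs_arg_lt_pi_div_two_iff.2 (Or.inl (hz j))
        have h2 := le_abs_self (z j).arg
        have := Real.pi_pos
        intro h
        linarith
      rw [div_eq_mul_inv, cpow_neg, ← inv_cpow _ _ harg,
        cpow_def_of_ne_zero (mul_ne_zero (ofReal_ne_zero.2 Real.pi_ne_zero) (inv_ne_zero hz0)),
        cpow_def_of_ne_zero (ofReal_ne_zero.2 Real.pi_ne_zero),
        cpow_def_of_ne_zero (inv_ne_zero hz0), ← Complex.exp_add,
        log_ofReal_mul Real.pi_pos (inv_ne_zero hz0), ofReal_log Real.pi_pos.le]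
      ring_nf
    rw [prod_congr rfl fun j _ => hj j, prod_mul_distrib, prod_const, card_univ, Fintype.card_fin,
      pow_mul, ← cpow_nat_mul]
    norm_num
  rw [integral_congr_ae (Eventually.of_forall hrad), integral_const_mul, hprod] at h1
  have hm : Measurable fun x : EuclideanSpace ℝ (Fin (2 * n)) =>
      ((∑ j, z j * (x j : ℂ) ^ 2) ^ n)⁻¹ := by fun_prop
  unfold sphereMeasure
  rw [integral_map (by fun_prop) hm.aestronglyMeasurable]
  have hpi : (Real.pi : ℂ) ^ n ≠ 0 := pow_ne_zero _ (ofReal_ne_zero.2 Real.pi_ne_zero)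
  rw [div_mul_eq_div_div, div_mul_eq_mul_div, h1, mul_div_cancel_left₀ _ hpi]

end SphereIdentity

/-! ### The branched product off the interval of eigenvalues -/

section BranchedProduct

open Finset Complex

/-- Principal logarithms add as long as the sum of the arguments stays in `(-π, π]`. -/
theorem cpow_eq_mul_cpow_of_arg {ζ z : ℂ} (hζ : ζ ≠ 0) (hz : z ≠ 0)
    (h : (ζ⁻¹).arg + (ζ * z).arg ∈ Set.Ioc (-Real.pi) Real.pi) (a : ℂ) :
    z ^ a = ζ⁻¹ ^ a * (ζ * z) ^ a := by
  have h1 := (log_mul_eq_add_log_iff (inv_ne_zero hζ) (mul_ne_zero hζ hz)).2 h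
  rw [inv_mul_cancel_left₀ hζ] at h1
  rw [cpow_def_of_ne_zero hz, cpow_def_of_ne_zero (inv_ne_zero hζ),
    cpow_def_of_ne_zero (mul_ne_zero hζ hz), ← Complex.exp_add, h1, add_mul]

theorem mem_convexHull_of_le {N : ℕ} {l : Fin N → ℝ} {t : ℂ} (ht : t.im = 0) {i j : Fin N}
    (hi : l i ≤ t.re) (hj : t.re ≤ l j) :
    t ∈ convexHull ℝ (Set.range fun i => (l i : ℂ)) := by
  have hm : t.re ∈ segment ℝ (l i) (l j) := by
    rw [segment_eq_Icc (hi.trans hj)]; exact ⟨hi, hj⟩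
  obtain ⟨a, b, ha, hb, hab, h⟩ := hm
  refine segment_subset_convexHull (Set.mem_range_self i) (Set.mem_range_self j)
    ⟨a, b, ha, hb, hab, ?_⟩
  apply Complex.ext
  · simpa using h
  · simp [ht]

/-- Off the convex hull of the nodes, all the differences can be rotated to the right half plane
without crossing the branch cut. -/
theorem exists_rotation {N : ℕ} {l : Fin N → ℝ} {t : ℂ}
    (ht : t ∉ convexHull ℝ (Set.range fun i => (l i : ℂ))) :
    ∃ ζ : ℂ, ζ ≠ 0 ∧ ∀ j, 0 < (ζ * (t - l j)).re ∧
      ∀ a : ℂ, (t - l j) ^ a = ζ⁻¹ ^ a * (ζ * (t - l j)) ^ a := by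
  suffices h : ∃ ζ : ℂ, ζ ≠ 0 ∧ ∀ j, 0 < (ζ * (t - l j)).re ∧
      (ζ⁻¹).arg + (ζ * (t - l j)).arg ∈ Set.Ioc (-Real.pi) Real.pi by
    obtain ⟨ζ, hζ, h⟩ := h
    refine ⟨ζ, hζ, fun j => ⟨(h j).1, fun a => cpow_eq_mul_cpow_of_arg hζ ?_ (h j).2 a⟩⟩
    intro h0
    simpa [h0] using (h j).1
  have hpi := Real.pi_pos
  have harg : ∀ w : ℂ, 0 < w.re → -(Real.pi / 2) < w.arg ∧ w.arg < Real.pi / 2 := fun w hw =>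
    abs_lt.1 (abs_arg_lt_pi_div_two_iff.2 (Or.inl hw))
  -- The multiplier is `I` below the real axis, `-I` above it, `1` to the right of all nodes and
  -- `-1` to their left.
  rcases lt_trichotomy t.im 0 with him | him | him
  · refine ⟨I, I_ne_zero, fun j => ?_⟩
    have hre : 0 < (I * (t - l j)).re := by simpa using him
    refine ⟨hre, ?_⟩
    rw [inv_I, arg_neg_I]
    constructor <;> linarith [harg _ hre]
  · rcases Classical.em (∃ i, l i ≤ t.re) with ⟨i, hi⟩ | h
    · have hlt : ∀ j, l j < t.re := fun j => by
        by_contra! hj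
        exact ht (mem_convexHull_of_le him hi hj)
      refine ⟨1, one_ne_zero, fun j => ?_⟩
      have hre : 0 < (1 * (t - l j)).re := by simpa using hlt j
      refine ⟨hre, ?_⟩
      rw [inv_one, arg_one]
      constructor <;> linarith [harg _ hre]
    · push Not at h
      refine ⟨-1, by simp, fun j => ?_⟩
      have hre : 0 < (-1 * (t - l j)).re := by simpa using h j
      refine ⟨hre, ?_⟩
      -- Here `t - l j` lies on the cut itself. The arguments `π` and `0` add up to the endpoint
      -- `π`, which the principal range includes.
      have h0 : (-1 * (t - l j)).arg = 0 := arg_eq_zero_iff.2 ⟨hre.le, by simp [him]⟩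
      rw [h0, show (-1 : ℂ)⁻¹ = -1 by norm_num, arg_neg_one]
      constructor <;> linarith
  · refine ⟨-I, neg_ne_zero.2 I_ne_zero, fun j => ?_⟩
    have hre : 0 < (-I * (t - l j)).re := by simpa using him
    refine ⟨hre, ?_⟩
    rw [inv_neg, inv_I, neg_neg, arg_I]
    constructor <;> linarith [harg _ hre]

/-- The point of the convex hull of the nodes with the given spherical weights. -/
def sphereNode {N : ℕ} (l : Fin N → ℝ) (x : EuclideanSpace ℝ (Fin N)) : ℝ := ∑ j, l j * x j ^ 2

theorem sphereNode_mem_convexHull {N : ℕ} (l : Fin N → ℝ) {x : EuclideanSpace ℝ (Fin N)}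
    (hx : ‖x‖ = 1) : (sphereNode l x : ℂ) ∈ convexHull ℝ (Set.range fun i => (l i : ℂ)) := by
  have h1 : ∑ j, x j ^ 2 = 1 := by rw [← EuclideanSpace.real_norm_sq_eq, hx, one_pow]
  have h := (convex_convexHull ℝ (Set.range fun i => (l i : ℂ))).sum_mem
    (t := univ) (w := fun j => x j ^ 2) (z := fun i => (l i : ℂ)) (fun j _ => sq_nonneg _) h1
    fun i _ => subset_convexHull _ _ (Set.mem_range_self i)
  convert h using 1
  simp [sphereNode, mul_comm]

theorem continuous_sphereNode {N : ℕ} (l : Fin N → ℝ) : Continuous (sphereNode l) := by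
  unfold sphereNode; fun_prop

/-- The `2n` half powers of the rotation multiply to `ζ^n`, which cancels the `ζ^(-n)` coming out of
the spherical integral. Evenness of the dimension thus removes the branching, including on the
half-line left of all nodes. -/
theorem prod_sub_cpow_eq {n : ℕ} (hn : 0 < n) {l : Fin (2 * n) → ℝ} {t : ℂ}
    (ht : t ∉ convexHull ℝ (Set.range fun i => (l i : ℂ))) :
    ∏ j, (t - l j) ^ (-(1 / 2) : ℂ) = ((n - 1).factorial / (2 * (Real.pi : ℂ) ^ n)) *
      ∫ x, ((t - sphereNode l x) ^ n)⁻¹ ∂sphereMeasure (EuclideanSpace ℝ (Fin (2 * n))) := by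
  obtain ⟨ζ, hζ, h⟩ := exists_rotation ht
  have hζn : ζ ^ n ≠ 0 := pow_ne_zero _ hζ
  have hpow : (ζ⁻¹ ^ (-(1 / 2) : ℂ)) ^ (2 * n) = ζ ^ n := by
    rw [pow_mul, ← cpow_nat_mul]
    norm_num [cpow_neg_one]
  rw [prod_congr rfl fun j _ => (h j).2 _, prod_mul_distrib, prod_const, card_univ,
    Fintype.card_fin, hpow, integral_sphere_inv_pow hn fun j => (h j).1, mul_left_comm,
    ← integral_const_mul]
  congr 1
  refine integral_congr_ae ?_
  filter_upwards [ae_norm_eq_one_sphereMeasure] with x hx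
  have h1 : ∑ j, (x j : ℂ) ^ 2 = 1 := by
    have : ∑ j, x j ^ 2 = 1 := by rw [← EuclideanSpace.real_norm_sq_eq, hx, one_pow]
    exact_mod_cast this
  have hs : ∑ j, ζ * (t - l j) * (x j : ℂ) ^ 2 = ζ * (t - sphereNode l x) := by
    unfold sphereNode
    push_cast
    calc _ = ζ * (t * ∑ j, (x j : ℂ) ^ 2 - ∑ j, (l j : ℂ) * (x j : ℂ) ^ 2) := by
          rw [mul_sum, ← sum_sub_distrib, mul_sum]
          exact sum_congr rfl fun j _ => by ring
      _ = _ := by rw [h1, mul_one]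
  simp only [hs]
  rw [mul_pow, mul_inv, mul_inv_cancel_left₀ hζn]

end BranchedProduct

/-! ### Integrals along piecewise `C¹` closed paths and a residue computation -/

section Contour

open Complex Set

variable {z : ℂ} {γ : Path z z}

theorem contourIntegral_eq (γ : Path z z) (f : ℂ → ℂ) : contourIntegral γ f =
    ∫ s in (0 : ℝ)..1, f (γ.extend s) * derivWithin γ.extend unitInterval s := by
  unfold contourIntegral
  rw [curveIntegral_def]
  refine intervalIntegral.integral_congr fun s _ => ?_
  simp only [curveIntegralFun_def, ContinuousLinearMap.toSpanSingleton_apply, smul_eq_mul]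
  ring

theorem intervalIntegrable_derivWithin_of_subinterval {a b : ℝ} (ha : 0 ≤ a) (hab : a < b)
    (hb : b ≤ 1) (h : ContDiffOn ℝ 1 γ.extend (Icc a b)) :
    IntervalIntegrable (derivWithin γ.extend unitInterval) volume a b := by
  have hc := h.continuousOn_derivWithin (uniqueDiffOn_Icc hab) le_rfl
  refine (hc.intervalIntegrable_of_Icc hab.le).congr_ae ?_
  rw [uIoc_of_le hab.le, ← restrict_Ioo_eq_restrict_Ioc]
  filter_upwards [ae_restrict_mem measurableSet_Ioo] with s hs
  rw [derivWithin_of_mem_nhds (Icc_mem_nhds hs.1 hs.2), derivWithin_of_mem_nhds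
    (Icc_mem_nhds (ha.trans_lt hs.1) (hs.2.trans_le hb))]

theorem IsPiecewiseC1.intervalIntegrable (h : IsPiecewiseC1 γ) :
    IntervalIntegrable (derivWithin γ.extend unitInterval) volume 0 1 := by
  obtain ⟨B, hB⟩ := h
  -- Generalizing the interval lets the induction cut it at one break point at a time.
  suffices H : ∀ B : Finset ℝ, ∀ a b : ℝ, 0 ≤ a → a ≤ b → b ≤ 1 →
      (∀ c d : ℝ, a ≤ c → c < d → d ≤ b → (∀ s ∈ B, s ∉ Ioo c d) →
        ContDiffOn ℝ 1 γ.extend (Icc c d)) →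
      IntervalIntegrable (derivWithin γ.extend unitInterval) volume a b from
    H B 0 1 le_rfl zero_le_one le_rfl hB
  intro B
  induction B using Finset.induction_on with
  | empty =>
    intro a b ha hab hb h
    rcases hab.eq_or_lt with rfl | hab
    · exact IntervalIntegrable.refl
    · exact intervalIntegrable_derivWithin_of_subinterval ha hab hb
        (h a b le_rfl hab le_rfl (by simp))
  | insert s B _ ih =>
    intro a b ha hab hb h
    by_cases hs : s ∈ Ioo a b
    · refine (ih a s ha hs.1.le (hs.2.le.trans hb) fun c d hc hcd hd hcB => ?_).trans
        (ih s b (ha.trans hs.1.le) hs.2.le hb fun c d hc hcd hd hcB => ?_)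
      · refine h c d hc hcd (hd.trans hs.2.le) fun r hr => ?_
        rcases Finset.mem_insert.1 hr with rfl | hr
        · exact fun hm => absurd hm.2 (not_lt.2 hd)
        · exact hcB r hr
      · refine h c d (hs.1.le.trans hc) hcd hd fun r hr => ?_
        rcases Finset.mem_insert.1 hr with rfl | hr
        · exact fun hm => absurd hm.1 (not_lt.2 hc)
        · exact hcB r hr
    · refine ih a b ha hab hb fun c d hc hcd hd hcB => h c d hc hcd hd fun r hr => ?_
      rcases Finset.mem_insert.1 hr with rfl | hr
      · exact fun hm => hs ⟨hc.trans_lt hm.1, hm.2.trans_le hd⟩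
      · exact hcB r hr

theorem IsPiecewiseC1.exists_hasDerivAt (h : IsPiecewiseC1 γ) : ∃ B : Set ℝ, B.Countable ∧
    ∀ s ∈ Ioo (0 : ℝ) 1 \ B,
      HasDerivAt γ.extend (derivWithin γ.extend unitInterval s) s := by
  obtain ⟨B, hB⟩ := h
  refine ⟨B, B.countable_toSet, fun s hs => ?_⟩
  have hopen : Ioo (0 : ℝ) 1 \ B ∈ nhds s :=
    (isOpen_Ioo.sdiff B.finite_toSet.isClosed).mem_nhds hs
  obtain ⟨ε, hε, hsub⟩ := Metric.mem_nhds_iff.1 hopen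
  rw [Real.ball_eq_Ioo] at hsub
  have hsub' : ∀ r ∈ Icc (s - ε / 2) (s + ε / 2), r ∈ Ioo (0 : ℝ) 1 \ B := fun r hr =>
    hsub ⟨by linarith [hr.1], by linarith [hr.2]⟩
  have hc := hB (s - ε / 2) (s + ε / 2) (hsub' _ ⟨le_rfl, by linarith⟩).1.1.le (by linarith)
    (hsub' _ ⟨by linarith, le_rfl⟩).1.2.le fun r hr hm => (hsub' r ⟨hm.1.le, hm.2.le⟩).2 hr
  have hd := (hc.differentiableOn (by norm_num) s ⟨by linarith, by linarith⟩).differentiableAt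
    (Icc_mem_nhds (by linarith) (by linarith))
  rw [derivWithin_of_mem_nhds (Icc_mem_nhds hs.1.1 hs.1.2)]
  exact hd.hasDerivAt

theorem IsPiecewiseC1.intervalIntegrable_mul (h : IsPiecewiseC1 γ) {f : ℂ → ℂ}
    (hf : ∀ s, ContinuousAt f (γ s)) :
    IntervalIntegrable (fun s => f (γ.extend s) * derivWithin γ.extend unitInterval s)
      volume 0 1 := by
  refine h.intervalIntegrable.continuousOn_mul ?_
  rw [uIcc_of_le zero_le_one]
  intro s hs
  refine ContinuousAt.continuousWithinAt (ContinuousAt.comp (g := f) ?_ γ.continuous_extend.continuousAt)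
  rw [γ.extend_apply hs]
  exact hf _

/-- The fundamental theorem of calculus for `F ∘ γ`, which is differentiable off a countable set and
takes equal values at the two ends. -/
theorem IsPiecewiseC1.contourIntegral_eq_zero (h : IsPiecewiseC1 γ) {f F : ℂ → ℂ}
    (hf : ∀ s, ContinuousAt f (γ s)) (hF : ∀ s, HasDerivAt F (f (γ s)) (γ s)) :
    contourIntegral γ f = 0 := by
  obtain ⟨B, hBc, hB⟩ := h.exists_hasDerivAt
  have hF' : ∀ s ∈ Icc (0 : ℝ) 1, HasDerivAt F (f (γ.extend s)) (γ.extend s) := by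
    intro s hs
    rw [γ.extend_apply hs]
    exact hF _
  rw [contourIntegral_eq, integral_eq_of_hasDerivAt_off_countable (fun s => F (γ.extend s)) _ hBc
    ?_ ?_ (h.intervalIntegrable_mul hf)]
  · simp
  · rw [uIcc_of_le zero_le_one]
    exact fun s hs => ((hF' s hs).continuousAt.comp
      γ.continuous_extend.continuousAt).continuousWithinAt
  · rw [min_eq_left zero_le_one, max_eq_right zero_le_one]
    intro s hs
    exact (hF' s (Ioo_subset_Icc_self hs.1)).comp s (hB s hs)

theorem IsPiecewiseC1.contourIntegral_add (h : IsPiecewiseC1 γ) {f g : ℂ → ℂ}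
    (hf : ∀ s, ContinuousAt f (γ s)) (hg : ∀ s, ContinuousAt g (γ s)) :
    contourIntegral γ (fun t => f t + g t) = contourIntegral γ f + contourIntegral γ g := by
  simp only [contourIntegral_eq, add_mul]
  exact intervalIntegral.integral_add (h.intervalIntegrable_mul hf) (h.intervalIntegrable_mul hg)

theorem contourIntegral_const_mul (c : ℂ) (f : ℂ → ℂ) :
    contourIntegral γ (fun t => c * f t) = c * contourIntegral γ f := by
  simp only [contourIntegral_eq, mul_assoc]
  exact intervalIntegral.integral_const_mul _ _

/-- For a simple pole, subtracting `exp(cw)/(t - w)` leaves an entire function, which has a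
primitive; the pole term is given by the winding number. Higher poles reduce to lower ones because
the derivative of `exp(ct) (t - w)^(-m-1)` integrates to zero. -/
theorem contourIntegral_exp_mul_inv_pow (h : IsPiecewiseC1 γ) {w : ℂ} (hw : ∀ s, γ s ≠ w)
    (hwind : windingNumber γ w = 1) (c : ℂ) (m : ℕ) :
    contourIntegral γ (fun t => cexp (c * t) * ((t - w) ^ (m + 1))⁻¹) =
      2 * Real.pi * I * (c ^ m / m.factorial) * cexp (c * w) := by
  have hsub : ∀ s, γ s - w ≠ 0 := fun s => sub_ne_zero.2 (hw s)
  have hcont : ∀ m : ℕ, ∀ s, ContinuousAt (fun t => cexp (c * t) * ((t - w) ^ m)⁻¹) (γ s) :=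
    fun m s => ContinuousAt.mul (by fun_prop) (ContinuousAt.inv₀ (by fun_prop)
      (pow_ne_zero _ (hsub s)))
  induction m with
  | zero =>
    have hdiff : Differentiable ℂ (dslope (fun t => cexp (c * t)) w) := by
      rw [← differentiableOn_univ, differentiableOn_dslope Filter.univ_mem]
      fun_prop
    obtain ⟨F, hF⟩ := hdiff.isExactOn_univ
    have h0 : contourIntegral γ (dslope (fun t => cexp (c * t)) w) = 0 :=
      h.contourIntegral_eq_zero (fun s => hdiff.continuous.continuousAt) fun s => hF _ (mem_univ _)
    have h1 : contourIntegral γ (fun t => (t - w)⁻¹) = 2 * Real.pi * I := by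
      have h2 : (2 * Real.pi * I : ℂ) ≠ 0 := by simp [Real.pi_ne_zero, I_ne_zero]
      unfold windingNumber at hwind
      rwa [inv_mul_eq_one₀ h2, eq_comm] at hwind
    have h2 : contourIntegral γ (fun t => cexp (c * t) * ((t - w) ^ (0 + 1))⁻¹) =
        contourIntegral γ (fun t => dslope (fun t => cexp (c * t)) w t +
          cexp (c * w) * (t - w)⁻¹) := by
      rw [contourIntegral_eq, contourIntegral_eq]
      refine intervalIntegral.integral_congr fun s hs => ?_
      rw [uIcc_of_le zero_le_one] at hs
      have hne : γ.extend s ≠ w := by rw [γ.extend_apply hs]; exact hw _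
      simp only [dslope_of_ne _ hne, slope_def_field]
      have := sub_ne_zero.2 hne
      field_simp
      ring
    have hinv : ∀ s, ContinuousAt (fun t => cexp (c * w) * (t - w)⁻¹) (γ s) := fun s =>
      continuousAt_const.mul (ContinuousAt.inv₀ (f := fun t => t - w) (by fun_prop) (hsub s))
    rw [h2, h.contourIntegral_add (fun s => hdiff.continuous.continuousAt) hinv, h0,
      contourIntegral_const_mul, h1]
    simp
    ring
  | succ m ih =>
    have hd : ∀ s, HasDerivAt (fun t => cexp (c * t) * ((t - w) ^ (m + 1))⁻¹)
        (c * (cexp (c * γ s) * ((γ s - w) ^ (m + 1))⁻¹) +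
          (-(m + 1 : ℂ)) * (cexp (c * γ s) * ((γ s - w) ^ (m + 1 + 1))⁻¹)) (γ s) := by
      intro s
      have h1 : HasDerivAt (fun t => cexp (c * t)) (cexp (c * γ s) * c) (γ s) := by
        simpa using ((hasDerivAt_id (γ s)).const_mul c).cexp
      have h2 : HasDerivAt (fun t => (t - w) ^ (m + 1))
          (((m + 1 : ℕ) : ℂ) * (γ s - w) ^ m) (γ s) := by
        simpa using (hasDerivAt_pow (m + 1) (γ s - w)).comp_sub_const (γ s) w
      refine (h1.fun_mul (h2.fun_inv (pow_ne_zero _ (hsub s)))).congr_deriv ?_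
      have := hsub s
      push_cast
      field_simp
      ring
    have h0 := h.contourIntegral_eq_zero (f := fun t => c * (cexp (c * t) * ((t - w) ^ (m + 1))⁻¹) +
          (-(m + 1 : ℂ)) * (cexp (c * t) * ((t - w) ^ (m + 1 + 1))⁻¹))
      (fun s => ((hcont (m + 1) s).const_mul c).add ((hcont (m + 1 + 1) s).const_mul _)) hd
    rw [h.contourIntegral_add (fun s => (hcont (m + 1) s).const_mul c)
      (fun s => (hcont (m + 1 + 1) s).const_mul _), contourIntegral_const_mul,
      contourIntegral_const_mul, ih] at h0
    have hm : (m + 1 : ℂ) ≠ 0 := by exact_mod_cast Nat.succ_ne_zero m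
    have hf : (m.factorial : ℂ) ≠ 0 := by exact_mod_cast Nat.factorial_ne_zero m
    rw [Nat.factorial_succ]
    push_cast
    field_simp at h0 ⊢
    linear_combination -h0

end Contour

/-! ### The contour formula for the spiked density -/

section ContourFormula

open Complex Set

variable {z : ℂ} {γ : Path z z} {n : ℕ}

theorem contourIntegral_congr {f g : ℂ → ℂ} (h : ∀ s, f (γ s) = g (γ s)) :
    contourIntegral γ f = contourIntegral γ g := by
  rw [contourIntegral_eq, contourIntegral_eq]
  refine intervalIntegral.integral_congr fun s hs => ?_
  rw [uIcc_of_le zero_le_one] at hs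
  simp only [γ.extend_apply hs, h]

/-- Fubini applies because path and convex hull are disjoint and compact, which bounds the kernel,
while the speed of the path is integrable. Each inner integral is a residue at a point with winding
number `1`. -/
theorem contourIntegral_exp_mul_sphere (hn : 0 < n) {l : Fin (2 * n) → ℝ}
    (hγ : EnclosesCounterclockwise γ (convexHull ℝ (range fun i => (l i : ℂ)))) (c : ℂ) :
    contourIntegral γ (fun t => cexp (c * t) *
        ∫ x, ((t - sphereNode l x) ^ n)⁻¹ ∂sphereMeasure (EuclideanSpace ℝ (Fin (2 * n)))) =
      2 * Real.pi * I * (c ^ (n - 1) / (n - 1).factorial) *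
        ∫ x, cexp (c * sphereNode l x) ∂sphereMeasure (EuclideanSpace ℝ (Fin (2 * n))) := by
  set K := convexHull ℝ (range fun i => (l i : ℂ)) with hK
  set σ := sphereMeasure (EuclideanSpace ℝ (Fin (2 * n))) with hσ
  have hKc : IsCompact K := (finite_range _).isCompact_convexHull ℝ
  have hne : ∀ s ∈ Icc (0 : ℝ) 1, ∀ w ∈ K, γ.extend s - w ≠ 0 := by
    intro s hs w hw h0
    rw [γ.extend_apply hs, sub_eq_zero] at h0
    exact hγ.avoids ⟨s, hs⟩ (h0 ▸ hw)
  have hcont : ContinuousOn (fun p : ℝ × ℂ => cexp (c * γ.extend p.1) *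
      ((γ.extend p.1 - p.2) ^ n)⁻¹) (Icc 0 1 ×ˢ K) := by
    have h1 : Continuous fun p : ℝ × ℂ => γ.extend p.1 := γ.continuous_extend.comp continuous_fst
    refine ContinuousOn.mul (by fun_prop) (ContinuousOn.inv₀ (by fun_prop) ?_)
    exact fun p hp => pow_ne_zero _ (hne _ hp.1 _ hp.2)
  obtain ⟨C, hC⟩ := (isCompact_Icc.prod hKc).exists_bound_of_continuousOn hcont
  have hmem : ∀ᵐ x ∂σ, (sphereNode l x : ℂ) ∈ K := by
    filter_upwards [ae_norm_eq_one_sphereMeasure] with x hx using sphereNode_mem_convexHull l hx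
  have hd : Integrable (derivWithin γ.extend unitInterval)
      (volume.restrict (Ioc (0 : ℝ) 1)) :=
    (intervalIntegrable_iff_integrableOn_Ioc_of_le zero_le_one).1 hγ.piecewise.intervalIntegrable
  have hint : Integrable (Function.uncurry fun (s : ℝ) (x : EuclideanSpace ℝ (Fin (2 * n))) =>
      cexp (c * γ.extend s) * ((γ.extend s - sphereNode l x) ^ n)⁻¹ *
        derivWithin γ.extend unitInterval s) ((volume.restrict (Ioc (0 : ℝ) 1)).prod σ) := by
    have hdp : Integrable (fun p : ℝ × EuclideanSpace ℝ (Fin (2 * n)) =>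
      derivWithin γ.extend unitInterval p.1) ((volume.restrict (Ioc (0 : ℝ) 1)).prod σ) :=
      hd.comp_fst σ
    refine Integrable.mono' (hdp.norm.const_mul C) (AEStronglyMeasurable.mul
      (Measurable.aestronglyMeasurable ?_) hdp.aestronglyMeasurable) ?_
    · have h1 : Measurable fun p : ℝ × EuclideanSpace ℝ (Fin (2 * n)) => γ.extend p.1 :=
        γ.continuous_extend.measurable.comp measurable_fst
      have h2 : Measurable fun p : ℝ × EuclideanSpace ℝ (Fin (2 * n)) => sphereNode l p.2 :=
        (continuous_sphereNode l).measurable.comp measurable_snd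
      fun_prop
    · have e1 : ∀ᵐ p ∂((volume.restrict (Ioc (0 : ℝ) 1)).prod σ), p.1 ∈ Ioc (0 : ℝ) 1 :=
        Measure.quasiMeasurePreserving_fst.ae (ae_restrict_mem measurableSet_Ioc)
      have e2 : ∀ᵐ p ∂((volume.restrict (Ioc (0 : ℝ) 1)).prod σ), (sphereNode l p.2 : ℂ) ∈ K :=
        Measure.quasiMeasurePreserving_snd.ae hmem
      filter_upwards [e1, e2] with p h1 h2
      simp only [Function.uncurry]
      rw [norm_mul]
      exact mul_le_mul_of_nonneg_right (hC (p.1, (sphereNode l p.2 : ℂ))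
        ⟨Ioc_subset_Icc_self h1, h2⟩) (norm_nonneg _)
  calc contourIntegral γ (fun t => cexp (c * t) * ∫ x, ((t - sphereNode l x) ^ n)⁻¹ ∂σ)
      = ∫ s in Ioc (0 : ℝ) 1, ∫ x, cexp (c * γ.extend s) *
          ((γ.extend s - sphereNode l x) ^ n)⁻¹ * derivWithin γ.extend unitInterval s ∂σ := by
        rw [contourIntegral_eq, intervalIntegral.integral_of_le zero_le_one]
        simp only [integral_mul_const, integral_const_mul]
    _ = ∫ x, (∫ s in Ioc (0 : ℝ) 1, cexp (c * γ.extend s) *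
          ((γ.extend s - sphereNode l x) ^ n)⁻¹ * derivWithin γ.extend unitInterval s) ∂σ :=
        integral_integral_swap hint
    _ = ∫ x, 2 * Real.pi * I * (c ^ (n - 1) / (n - 1).factorial) *
          cexp (c * sphereNode l x) ∂σ := by
        refine integral_congr_ae ?_
        filter_upwards [hmem] with x hx
        have h := contourIntegral_exp_mul_inv_pow hγ.piecewise
          (fun s hs => hγ.avoids s (hs ▸ hx)) (hγ.winding _ hx) c (n - 1)
        rw [Nat.sub_add_cancel hn, contourIntegral_eq,
          intervalIntegral.integral_of_le zero_le_one] at h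
        exact h
    _ = _ := integral_const_mul _ _

theorem integral_exp_sphereNode {N : ℕ} (c : ℝ) (l : Fin N → ℝ) :
    ∫ x, cexp (c * sphereNode l x) ∂sphereMeasure (EuclideanSpace ℝ (Fin N)) =
      ((sphereExp N c l).toReal : ℂ) := by
  have hc := continuous_sphereNode l
  have h : ∀ x, cexp (c * sphereNode l x) = ((Real.exp (c * sphereNode l x) : ℝ) : ℂ) := by
    intro x; push_cast; rfl
  simp_rw [h]
  rw [integral_complex_ofReal, integral_eq_lintegral_of_nonneg_ae
    (Filter.Eventually.of_forall fun x => (Real.exp_pos _).le)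
    (Measurable.aestronglyMeasurable (by fun_prop))]
  rfl

theorem sphereExp_ne_top {N : ℕ} (c : ℝ) (l : Fin N → ℝ) : sphereExp N c l ≠ ⊤ := by
  have hb : ∀ᵐ x ∂sphereMeasure (EuclideanSpace ℝ (Fin N)),
      ENNReal.ofReal (Real.exp (c * ∑ j, l j * x j ^ 2)) ≤
        ENNReal.ofReal (Real.exp (|c| * ∑ j, |l j|)) := by
    filter_upwards [ae_norm_eq_one_sphereMeasure] with x hx
    refine ENNReal.ofReal_le_ofReal (Real.exp_le_exp.2 ((le_abs_self _).trans ?_))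
    rw [abs_mul]
    refine mul_le_mul_of_nonneg_left ((Finset.abs_sum_le_sum_abs _ _).trans
      (Finset.sum_le_sum fun j _ => ?_)) (abs_nonneg c)
    have h1 : x j ^ 2 ≤ 1 := by
      rw [← one_pow 2, ← hx, EuclideanSpace.real_norm_sq_eq]
      exact Finset.single_le_sum (f := fun i => x i ^ 2) (fun i _ => sq_nonneg _)
        (Finset.mem_univ j)
    rw [abs_mul, abs_of_nonneg (sq_nonneg (x j))]
    exact mul_le_of_le_one_right (abs_nonneg _) h1
  refine ((lintegral_mono_ae hb).trans_lt ?_).ne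
  rw [lintegral_const]
  exact ENNReal.mul_lt_top ENNReal.ofReal_lt_top (measure_lt_top _ _)

/-- The constant is `(n-1)!/(2π^n)` from the spherical identity times `2πi c^(n-1)/(n-1)!` from the
residue. -/
theorem contourIntegral_densityIntegrand (hn : 0 < n) (M : ℕ) (τ : ℝ) {l : Fin (2 * n) → ℝ}
    (hl : ∀ i, 0 < l i)
    (hγ : EnclosesCounterclockwise γ (convexHull ℝ (range fun i => (l i : ℂ)))) :
    contourIntegral γ (densityIntegrand (2 * n) M τ l) =
      (I * ((M * τ / (2 * (1 + τ)) : ℝ) : ℂ) ^ (n - 1) / (Real.pi : ℂ) ^ (n - 1)) *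
        ((spikedDensity (2 * n) M τ l).toReal : ℂ) := by
  set c : ℝ := M * τ / (2 * (1 + τ)) with hc
  have hpos : 0 < ∏ i, l i := Finset.prod_pos fun i _ => hl i
  have hA : (spikedDensity (2 * n) M τ l).toReal = absVdm l *
      (∏ j, (Real.exp (-(M : ℝ) / 2 * l j) * l j ^ (((M : ℝ) - (2 * n : ℕ) - 1) / 2))) *
      (sphereExp (2 * n) c l).toReal := by
    unfold spikedDensity wishartDensity
    rw [ENNReal.toReal_mul, ENNReal.toReal_mul, ENNReal.toReal_ofReal (Real.exp_pos _).le,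
      ENNReal.toReal_ofReal (mul_nonneg (by unfold absVdm; positivity)
        (Real.rpow_nonneg hpos.le _)), Finset.prod_mul_distrib, ← Real.exp_sum, ← Finset.mul_sum,
      Real.finsetProd_rpow _ _ fun i _ => (hl i).le]
    ring
  have hcongr : contourIntegral γ (densityIntegrand (2 * n) M τ l) =
      contourIntegral γ (fun t => ((absVdm l * ∏ j, (Real.exp (-(M : ℝ) / 2 * l j) *
        l j ^ (((M : ℝ) - (2 * n : ℕ) - 1) / 2)) : ℝ) : ℂ) *
        ((n - 1).factorial / (2 * (Real.pi : ℂ) ^ n)) * (cexp (c * t) *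
        ∫ x, ((t - sphereNode l x) ^ n)⁻¹ ∂sphereMeasure (EuclideanSpace ℝ (Fin (2 * n))))) := by
    refine contourIntegral_congr fun s => ?_
    unfold densityIntegrand
    rw [Finset.prod_mul_distrib, prod_sub_cpow_eq hn (hγ.avoids s), ← ofReal_prod, ofReal_mul]
    unfold absVdm
    ring
  rw [hcongr, contourIntegral_const_mul, contourIntegral_exp_mul_sphere hn hγ,
    integral_exp_sphereNode, hA]
  have hf : ((n - 1).factorial : ℂ) ≠ 0 := by exact_mod_cast Nat.factorial_ne_zero _
  have hpi : (Real.pi : ℂ) ≠ 0 := ofReal_ne_zero.2 Real.pi_ne_zero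
  have hpn : (Real.pi : ℂ) ^ n = (Real.pi : ℂ) ^ (n - 1) * Real.pi := by
    rw [← pow_succ, Nat.sub_add_cancel hn]
  rw [hpn]
  push_cast
  field_simp

end ContourFormula

/-! ### Passage to the closed chamber and the joint law -/

section JointLaw

/-- The two regions differ only where coordinates coincide, and there the density vanishes
identically. -/
theorem restrict_withDensity_chamber {N : ℕ} {f : (Fin N → ℝ) → ENNReal}
    (hf : ∀ l, ¬ Function.Injective l → f l = 0) :
    (volume.restrict (chamber N)).withDensity f =
      (volume.restrict {l : Fin N → ℝ | (∀ i, 0 < l i) ∧ Monotone l}).withDensity f := by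
  have hm : MeasurableSet {l : Fin N → ℝ | (∀ i, 0 < l i) ∧ Monotone l} := by
    unfold Monotone; measurability
  ext s hs
  rw [withDensity_apply _ hs, withDensity_apply _ hs, ← lintegral_indicator hs,
    ← lintegral_indicator measurableSet_chamber, ← lintegral_indicator hs, ← lintegral_indicator hm]
  refine lintegral_congr fun l => ?_
  by_cases hi : Function.Injective l
  · have : l ∈ chamber N ↔ l ∈ {l : Fin N → ℝ | (∀ i, 0 < l i) ∧ Monotone l} :=
      and_congr_right fun _ => ⟨StrictMono.monotone, fun h => h.strictMono_of_injective hi⟩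
    by_cases hl : l ∈ chamber N
    · rw [Set.indicator_of_mem hl, Set.indicator_of_mem (this.1 hl)]
    · rw [Set.indicator_of_notMem hl, Set.indicator_of_notMem (mt this.2 hl)]
  · have h0 : s.indicator f l = 0 := Set.indicator_apply_eq_zero.2 fun _ => hf l hi
    rw [Set.indicator_apply_eq_zero.2 fun _ => h0, Set.indicator_apply_eq_zero.2 fun _ => h0]

theorem spikedDensity_ne_top {N M : ℕ} (τ : ℝ) (l : Fin N → ℝ) : spikedDensity N M τ l ≠ ⊤ :=
  ENNReal.mul_ne_top ENNReal.ofReal_ne_top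
    (ENNReal.mul_ne_top ENNReal.ofReal_ne_top (sphereExp_ne_top _ _))

theorem spikedDensity_eq_zero {N M : ℕ} (τ : ℝ) {l : Fin N → ℝ} (hl : ¬ Function.Injective l) :
    spikedDensity N M τ l = 0 := by
  unfold spikedDensity wishartDensity
  rw [absVdm_eq_zero hl, zero_mul, ENNReal.ofReal_zero, zero_mul]

end JointLaw

end

end SpikedWishart

theorem mainTheorem2 (N M : ℕ) (hN : 0 < N) (hNeven : Even N) (hNM : N < M)
    (τ : ℝ) (hτ : -1 < τ) (hτ0 : τ ≠ 0) :
    ∃ (Z : ℂ) (P : (Fin N → ℝ) → ℝ), Z ≠ 0 ∧ Measurable P ∧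
      (∀ lam : Fin N → ℝ, (∀ i, 0 < lam i) →
        0 ≤ P lam ∧
        ∀ (z : ℂ) (γ : Path z z),
          SpikedWishart.EnclosesCounterclockwise γ
            (convexHull ℝ (Set.range fun i => (lam i : ℂ))) →
          (P lam : ℂ) = Z⁻¹ *
            SpikedWishart.contourIntegral γ (SpikedWishart.densityIntegrand N M τ lam)) ∧
      ∀ (S : Matrix (Fin N) (Fin N) ℝ), SpikedWishart.IsRankOneSpike S τ →
        ∀ (Ω : Type*) [MeasurableSpace Ω] (μ : Measure Ω) [IsProbabilityMeasure μ]
          (X : Ω → Matrix (Fin N) (Fin M) ℝ), SpikedWishart.IsGaussianData X S μ →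
          HasLaw
            (fun ω => SpikedWishart.orderedEigenvalues
              (SpikedWishart.sampleCovariance_isHermitian (X ω)))
            ((volume.restrict {lam : Fin N → ℝ | (∀ i, 0 < lam i) ∧ Monotone lam}).withDensity
              fun lam => ENNReal.ofReal (P lam)) μ := by
  obtain ⟨n, rfl⟩ := even_iff_exists_two_mul.1 hNeven
  have hn : 0 < n := by omega
  obtain ⟨hm0, hmt⟩ := SpikedWishart.spikedMass_ne_zero_ne_top hN hNM.le hτ
  set m := SpikedWishart.spikedMass (2 * n) M τ
  have hm : (m.toReal : ℂ) ≠ 0 := Complex.ofReal_ne_zero.2 (ENNReal.toReal_ne_zero.2 ⟨hm0, hmt⟩)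
  have hc : ((M * τ / (2 * (1 + τ)) : ℝ) : ℂ) ≠ 0 := by
    have hM : (M : ℝ) ≠ 0 := Nat.cast_ne_zero.2 (by omega)
    have hτ1 : 1 + τ ≠ 0 := by linarith
    exact Complex.ofReal_ne_zero.2 (div_ne_zero (mul_ne_zero hM hτ0) (mul_ne_zero two_ne_zero hτ1))
  have hconst : Complex.I * ((M * τ / (2 * (1 + τ)) : ℝ) : ℂ) ^ (n - 1) / (Real.pi : ℂ) ^ (n - 1) ≠ 0 :=
    div_ne_zero (mul_ne_zero Complex.I_ne_zero (pow_ne_zero _ hc))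
      (pow_ne_zero _ (Complex.ofReal_ne_zero.2 Real.pi_ne_zero))
  -- `Z` is the total mass times the constant of the contour formula. `P` is the normalized real
  -- density, defined without a contour, so nonnegativity and independence of the contour are built
  -- in.
  refine ⟨m.toReal * (Complex.I * ((M * τ / (2 * (1 + τ)) : ℝ) : ℂ) ^ (n - 1) /
    (Real.pi : ℂ) ^ (n - 1)), fun l => (m⁻¹ * SpikedWishart.spikedDensity (2 * n) M τ l).toReal,
    mul_ne_zero hm hconst,
    ((SpikedWishart.measurable_spikedDensity τ).const_mul _).ennreal_toReal,
    fun l hl => ⟨ENNReal.toReal_nonneg, fun z γ hγ => ?_⟩, fun S hS Ω _ μ _ X hX => ?_⟩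
  · rw [SpikedWishart.contourIntegral_densityIntegrand hn M τ hl hγ, mul_inv, mul_assoc,
      inv_mul_cancel_left₀ hconst]
    simp only [ENNReal.toReal_mul, ENNReal.toReal_inv, Complex.ofReal_mul, Complex.ofReal_inv]
  · have hlaw := SpikedWishart.hasLaw_orderedEigenvalues hN hNM.le hτ hS hX
    rw [SpikedWishart.restrict_withDensity_chamber fun l hl => by
      rw [SpikedWishart.spikedDensity_eq_zero τ hl, mul_zero]] at hlaw
    have hfin : ∀ l, ENNReal.ofReal (m⁻¹ * SpikedWishart.spikedDensity (2 * n) M τ l).toReal =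
        m⁻¹ * SpikedWishart.spikedDensity (2 * n) M τ l := fun l =>
      ENNReal.ofReal_toReal (ENNReal.mul_ne_top (ENNReal.inv_ne_top.2 hm0)
        (SpikedWishart.spikedDensity_ne_top τ l))
    simp only [hfin]
    exact hlaw
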